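/- **Setting.** All of $\mathcal X,\mathcal X_1,\mathcal S,\mathcal S_d,\mathcal Y,\mathcal Y_1$ are finite alphabets, $\hat{\mathcal S}_d$ is a reconstruction alphabet, and $d:\mathcal S_d\times\hat{\mathcal S}_d\to[0,\infty)$ is a bounded distortion function. A state-dependent discrete memoryless relay channel is given by pmfs $P_{SS_d}$ and $P_{YY_1|XX_1S}$: the pairs $(S_i,S_{d,i})$ are i.i.d. $\sim P_{SS_d}$ and independent of the message, and, given the past, $(Y_i,Y_{1,i})$ has law $P_{YY_1|XX_1S}(\cdot|x_i,x_{1,i},s_i)$. A $(2^{nR},n)$ code consists of a message $W$ uniform on $\{1,\dots,2^{\lceil nR\rceil}\}$, a source encoder $x^n=e_n(w)$, relay encoders $x_{1,i}=f_i(y_1^{i-1})$, $1\le i\le n$, a decoder $\hat w=h_n(y^n)$, and an estimator $\hat s_d^n=g_n(y^n)\in\hat{\mathcal S}_d^n$. A pair $(R,D)$ with $R\ge 0$ is achievable if there is a sequence of $(2^{nR},n)$ codes with $\lim_{n\to\infty}\Pr(\hat W\ne W)=0$ and $\limsup_{n\to\infty}\frac1n\sum_{i=1}^n\mathbb E[d(S_{d,i},\hat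 S_{d,i})]\le D$. The capacity-distortion function is $C(D)=\sup\{R\ge0:(R,D)\text{ is achievable}\}$ (with $\sup\emptyset=-\infty$). **Theorem.** Let $U,A,V$ take values in finite alphabets and let $(U,A,X,X_1,S,S_d,Y,Y_1,V)$ have the joint distribution $$P_UP_{A|U}P_{X|UA}P_{X_1|U}P_{SS_d}P_{YY_1|XX_1S}P_{V|UAX_1Y_1},$$ where $P_{SS_d}P_{YY_1|XX_1S}$ is given by the channel and $P_U,P_{A|U},P_{X|UA},P_{X_1|U},P_{V|UAX_1Y_1}$ are arbitrary. Let $\hat S_d(x,x_1,y,v)\in\operatorname*{argmin}_{s'\in\hat{\mathcal S}_d}\sum_{s_d\in\mathcal S_d}P_{S_d|XX_1YV}(s_d|x,x_1,y,v)\,d(s_d,s')$. If a real number $R\ge0$ and a real number $D$ satisfy (all information quantities in bits) $$R\le I(A;Y_1|UX_1)+I(X;VY|UAX_1),$$ $$R\le I(A;Y_1|UX_1)+I(XX_1;Y|UA)-I(V;Y_1|UAXX_1Y),$$ $$R\le I(XX_1;Y)-I(V;Y_1|UAXX_1Y),$$ $$I(X_1;Y|UAX)\ge I(V;Y_1|UAXX_1Y),$$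 $$\mathbb E\big[d(S_d,\hat S_d(X,X_1,Y,V))\big]\le D,$$ then $C(D)\ge R$. -/

import Mathlib

open Filter Topology

namespace BistaticISAC

/-! ## Shannon information measures (base 2) for random variables on a finite space -/

section Information

variable {Ω α β γ : Type*} [Fintype Ω] [Fintype α] [Fintype β] [Fintype γ]

open Classical in
/-- The pmf of the random variable `f` when the sample space `Ω` carries the pmf `p`. -/
noncomputable def marg (p : Ω → ℝ) (f : Ω → α) (a : α) : ℝ :=
  ∑ ω, if f ω = a then p ω else 0

/-- Conditional probability `P(f = a | g = b)` (equal to `0` if `P(g = b) = 0`). -/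
noncomputable def condProb (p : Ω → ℝ) (f : Ω → α) (g : Ω → β) (a : α) (b : β) : ℝ :=
  marg p (fun ω => (f ω, g ω)) (a, b) / marg p g b

/-- Entropy `H(f)` in bits. -/
noncomputable def entropy (p : Ω → ℝ) (f : Ω → α) : ℝ :=
  -∑ a, marg p f a * Real.logb 2 (marg p f a)

/-- Conditional entropy `H(f | g) = H(f, g) - H(g)`. -/
noncomputable def condEntropy (p : Ω → ℝ) (f : Ω → α) (g : Ω → β) : ℝ :=
  entropy p (fun ω => (f ω, g ω)) - entropy p g

/-- Mutual information `I(f ; g) = H(f) - H(f | g)`. -/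
noncomputable def mutualInfo (p : Ω → ℝ) (f : Ω → α) (g : Ω → β) : ℝ :=
  entropy p f - condEntropy p f g

/-- Conditional mutual information `I(f ; g | h) = H(f | h) - H(f | g, h)`. -/
noncomputable def condMutualInfo (p : Ω → ℝ) (f : Ω → α) (g : Ω → β) (h : Ω → γ) : ℝ :=
  condEntropy p f h - condEntropy p f (fun ω => (g ω, h ω))

end Information

/-! ## The channel, codes and achievability -/

/-- A state-dependent discrete memoryless relay channel with sensing parameter:
the law `P_{S S_d}` and the transition law `P_{Y Y₁ | X X₁ S}`. -/
structure Channel (X X₁ S Sd Y Y₁ : Type*) where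
  state : PMF (S × Sd)
  output : X → X₁ → S → PMF (Y × Y₁)

/-- A block code with `M` messages and `n` channel uses. -/
structure Code (X X₁ Y Y₁ Shat : Type*) (M n : ℕ) where
  /-- source encoder `xⁿ = e(w)` -/
  enc : Fin M → Fin n → X
  /-- relay encoders `x₁ᵢ = fᵢ(y₁^{i-1})`; time is indexed from `0`,
  so `i` symbols are known before time `i` -/
  relay : (i : Fin n) → (Fin i → Y₁) → X₁
  /-- message decoder `ŵ = h(yⁿ)` -/
  dec : (Fin n → Y) → Fin M
  /-- parameter estimator `ŝ_dⁿ = g(yⁿ)` -/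
  est : (Fin n → Y) → Fin n → Shat

section Operational

variable {X X₁ S Sd Y Y₁ Shat : Type*} {M n : ℕ}

/-- The input sent by the relay at time `i` if it receives the sequence `y₁ⁿ`. -/
def Code.relayInput (c : Code X X₁ Y Y₁ Shat M n) (y₁ : Fin n → Y₁) (i : Fin n) : X₁ :=
  c.relay i (fun j => y₁ (Fin.castLE i.isLt.le j))

/-- The joint pmf of `(W, Sⁿ, S_dⁿ, Yⁿ, Y₁ⁿ)` induced by a code: the message is uniform, the
pairs `(Sᵢ, S_{d,i})` are i.i.d. and independent of it, and the channel is memoryless. -/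
noncomputable def blockLaw (ch : Channel X X₁ S Sd Y Y₁) (c : Code X X₁ Y Y₁ Shat M n)
    (w : Fin M) (s : Fin n → S) (sd : Fin n → Sd) (y : Fin n → Y) (y₁ : Fin n → Y₁) : ℝ :=
  (1 / (M : ℝ)) * ∏ i, ((ch.state (s i, sd i)).toReal *
    (ch.output (c.enc w i) (c.relayInput y₁ i) (s i) (y i, y₁ i)).toReal)

variable [Fintype S] [Fintype Sd] [Fintype Y] [Fintype Y₁]

/-- Probability of a message decoding error, `Pr(Ŵ ≠ W)`. -/
noncomputable def errorProb (ch : Channel X X₁ S Sd Y Y₁) (c : Code X X₁ Y Y₁ Shat M n) : ℝ :=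
  ∑ w : Fin M, ∑ s : Fin n → S, ∑ sd : Fin n → Sd, ∑ y : Fin n → Y, ∑ y₁ : Fin n → Y₁,
    if c.dec y ≠ w then blockLaw ch c w s sd y y₁ else 0

/-- Expected average distortion `E[(1/n) ∑ᵢ d(S_{d,i}, Ŝ_{d,i})]`. -/
noncomputable def avgDistortion (ch : Channel X X₁ S Sd Y Y₁) (d : Sd → Shat → ℝ)
    (c : Code X X₁ Y Y₁ Shat M n) : ℝ :=
  ∑ w : Fin M, ∑ s : Fin n → S, ∑ sd : Fin n → Sd, ∑ y : Fin n → Y, ∑ y₁ : Fin n → Y₁,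
    blockLaw ch c w s sd y y₁ * ((1 / (n : ℝ)) * ∑ i, d (sd i) (c.est y i))

/-- The number `2^⌈nR⌉` of messages of a `(2^{nR}, n)` code, `R ≥ 0`. -/
noncomputable def numMessages (R : ℝ) (n : ℕ) : ℕ := 2 ^ ⌈(n : ℝ) * R⌉₊

/-- Achievability of a rate-distortion pair `(R, D)`. -/
def Achievable (ch : Channel X X₁ S Sd Y Y₁) (d : Sd → Shat → ℝ) (R D : ℝ) : Prop :=
  ∃ c : (n : ℕ) → Code X X₁ Y Y₁ Shat (numMessages R n) n,
    Tendsto (fun n => errorProb ch (c n)) atTop (𝓝 0) ∧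
    limsup (fun n => avgDistortion ch d (c n)) atTop ≤ D

/-- The capacity-distortion function `C(D)`: the supremum of the rates `R ≥ 0` such that `(R, D)`
is achievable, taken in the extended reals, so that it is `-∞` (and not `0`) if there is none. -/
noncomputable def capacityDistortion (ch : Channel X X₁ S Sd Y Y₁) (d : Sd → Shat → ℝ) (D : ℝ) :
    EReal :=
  sSup ((fun R : ℝ => (R : EReal)) '' {R : ℝ | 0 ≤ R ∧ Achievable ch d R D})

end Operational

/-! ## The single-letter distribution -/

/-- The distributions to be chosen:
`P_U`, `P_{A|U}`, `P_{X|UA}`, `P_{X₁|U}` and `P_{V|U A X₁ Y₁}`. -/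
structure Choice (U A X X₁ Y₁ V : Type*) where
  pU : PMF U
  pA : U → PMF A
  pX : U → A → PMF X
  pX₁ : U → PMF X₁
  pV : U → A → X₁ → Y₁ → PMF V

/-- Sample space of the tuple `(U, A, X, X₁, S, S_d, Y, Y₁, V)`. -/
abbrev Sample (U A X X₁ S Sd Y Y₁ V : Type*) := U × A × X × X₁ × S × Sd × Y × Y₁ × V

section SingleLetter

variable {U A X X₁ S Sd Y Y₁ V : Type*}

/-- The random variable `U`. -/
def rU (ω : Sample U A X X₁ S Sd Y Y₁ V) : U := ω.1
/-- The random variable `A`. -/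
def rA (ω : Sample U A X X₁ S Sd Y Y₁ V) : A := ω.2.1
/-- The random variable `X`. -/
def rX (ω : Sample U A X X₁ S Sd Y Y₁ V) : X := ω.2.2.1
/-- The random variable `X₁`. -/
def rX₁ (ω : Sample U A X X₁ S Sd Y Y₁ V) : X₁ := ω.2.2.2.1
/-- The random variable `S`. -/
def rS (ω : Sample U A X X₁ S Sd Y Y₁ V) : S := ω.2.2.2.2.1
/-- The random variable `S_d`. -/
def rSd (ω : Sample U A X X₁ S Sd Y Y₁ V) : Sd := ω.2.2.2.2.2.1
/-- The random variable `Y`. -/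
def rY (ω : Sample U A X X₁ S Sd Y Y₁ V) : Y := ω.2.2.2.2.2.2.1
/-- The random variable `Y₁`. -/
def rY₁ (ω : Sample U A X X₁ S Sd Y Y₁ V) : Y₁ := ω.2.2.2.2.2.2.2.1
/-- The random variable `V`. -/
def rV (ω : Sample U A X X₁ S Sd Y Y₁ V) : V := ω.2.2.2.2.2.2.2.2

/-- The joint pmf
`P_U P_{A|U} P_{X|UA} P_{X₁|U} P_{S S_d} P_{Y Y₁|X X₁ S} P_{V|U A X₁ Y₁}`. -/
noncomputable def jointLaw (ch : Channel X X₁ S Sd Y Y₁) (q : Choice U A X X₁ Y₁ V)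
    (ω : Sample U A X X₁ S Sd Y Y₁ V) : ℝ :=
  (q.pU (rU ω)).toReal * (q.pA (rU ω) (rA ω)).toReal * (q.pX (rU ω) (rA ω) (rX ω)).toReal *
    (q.pX₁ (rU ω) (rX₁ ω)).toReal * (ch.state (rS ω, rSd ω)).toReal *
    (ch.output (rX ω) (rX₁ ω) (rS ω) (rY ω, rY₁ ω)).toReal *
    (q.pV (rU ω) (rA ω) (rX₁ ω) (rY₁ ω) (rV ω)).toReal

variable {Shat : Type*} [Fintype U] [Fintype A] [Fintype X] [Fintype X₁] [Fintype S] [Fintype Sd]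
  [Fintype Y] [Fintype Y₁] [Fintype V]

/-- `est` is a state estimator
`Ŝ_d(x, x₁, y, v) ∈ argmin_{s'} ∑_{s_d} P_{S_d | X X₁ Y V}(s_d | x, x₁, y, v) d(s_d, s')`. -/
def IsOptimalEstimator (ch : Channel X X₁ S Sd Y Y₁) (q : Choice U A X X₁ Y₁ V)
    (d : Sd → Shat → ℝ) (est : X → X₁ → Y → V → Shat) : Prop :=
  ∀ x x₁ y v s',
    ∑ sd, condProb (jointLaw ch q) rSd (fun ω => (rX ω, rX₁ ω, rY ω, rV ω)) sd (x, x₁, y, v) *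
        d sd (est x x₁ y v) ≤
      ∑ sd, condProb (jointLaw ch q) rSd (fun ω => (rX ω, rX₁ ω, rY ω, rV ω)) sd (x, x₁, y, v) *
        d sd s'

/-- The single-letter expected distortion `E[d(S_d, Ŝ_d(X, X₁, Y, V))]`. -/
noncomputable def expDistortion (ch : Channel X X₁ S Sd Y Y₁) (q : Choice U A X X₁ Y₁ V)
    (d : Sd → Shat → ℝ) (est : X → X₁ → Y → V → Shat) : ℝ :=
  ∑ ω : Sample U A X X₁ S Sd Y Y₁ V,
    jointLaw ch q ω * d (rSd ω) (est (rX ω) (rX₁ ω) (rY ω) (rV ω))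

end SingleLetter

end BistaticISAC

open BistaticISAC

/-!
A rate `R' < R` (or `R' = 0`) is achieved by block Markov random coding, in which the relay decodes
a part of the message and sends a compressed version of what else it observes.

*One block.* The relay enters a block in a state `(w, k)`: `w` is the part of the message that it
decoded in the preceding block, `k` the index of the description of its preceding observation.
The state selects the words `U` (by `w`) and `X₁` (by `w, k`); the new message part `w'` selects
`A`, and a private message `w''` selects `X`. The relay decodes `w'` from `Y₁`, and picks the index
`k'` of a description `V` of `Y₁` with a likelihood encoder, so that the words have almost the law
of the theorem (`mean_likelihood_le`). The decoder works backward: knowing `(w', k')` from the later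
blocks, it finds `(w, w'', k)` from `Y`, and estimates the parameter from `X, X₁, Y, V`.

*Tests.* Decoding is by threshold tests on nonnegative functions `τ₀, …, τ₄` (in `Description`)
whose mean is at most one when the tested words are independent of the observation. Markov's
inequality then bounds the probability that wrong words pass (`mean_treeBlock_not_good_le`), and
products over the letters have the same property, so that the bound for one letter is also the bound
for words of `m` letters (`Description.pow`). The right words pass because the logarithms of the
`τᵢ` concentrate around their means `rateᵢ` by Chebyshev's inequality. This gives good blocks
(`eventually_hasBlocks`); chaining many of them and a terminating block, in which nothing is
described, gives codes of every large length (`eventually_hasSchemes`,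
`exists_code_of_hasSchemes`).

*Rates.* For likelihood ratios under the law of the theorem, with
`J = I(V; Y₁ | U A X₁) - I(V; Y₁ | U A X X₁ Y)`, the means are `I(A; Y₁ | U X₁)`,
`I(X; V Y | U A X₁)`, `I(X X₁; Y | U A) + J`, `I(X₁; Y | U A X) + J` and
`I(U A X X₁; Y) + J ≥ I(X X₁; Y) + J`, and the description needs the rate `I(V; Y₁ | U A X₁)`
(`rate₀_description`, …, `le_rate₄_description`). Subtracting the rate of the description leaves the
bounds on `R`, where `exists_rate_split` divides the rate between `w'` and `w''`, and the condition
`I(X₁; Y | U A X) > I(V; Y₁ | U A X X₁ Y)` with strict inequality.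

*Equality.* If `I(X₁; Y | U A X) > 0`, then dropping the description with a small probability makes
the inequality strict, because all rates are affine in this probability (`Description.mix`). If
`I(X₁; Y | U A X) = 0`, then `I(V; Y₁ | U A X X₁ Y) = 0`, hence `V` and `Y₁` are independent given
`U A X X₁ Y`; the decoder can then choose a value of `V` as a function of these variables at no loss
(`exists_erased_estimator`), and no description is sent. The optimality of the given estimator
plays no role for achievability.
-/

namespace BistaticISAC

/-! ### Means with respect to finite probability vectors -/

section Mean

/-- The mean of `f` with respect to the weights `p`. -/
noncomputable def mean {α : Type*} [Fintype α] (p f : α → ℝ) : ℝ := ∑ a, p a * f a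

/-- The real-valued indicator of a proposition. -/
noncomputable def ind (P : Prop) : ℝ := open Classical in if P then 1 else 0

lemma ind_true {P : Prop} (h : P) : ind P = 1 := by simp [ind, h]

lemma ind_false {P : Prop} (h : ¬ P) : ind P = 0 := by simp [ind, h]

lemma ind_nonneg (P : Prop) : 0 ≤ ind P := by unfold ind; split_ifs <;> norm_num

lemma ind_le_one (P : Prop) : ind P ≤ 1 := by unfold ind; split_ifs <;> norm_num

lemma ind_mono {P Q : Prop} (h : P → Q) : ind P ≤ ind Q := by
  by_cases hP : P
  · rw [ind_true hP, ind_true (h hP)]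
  · rw [ind_false hP]; exact ind_nonneg Q

lemma ind_or_le (P Q : Prop) : ind (P ∨ Q) ≤ ind P + ind Q := by
  by_cases hP : P
  · rw [ind_true hP, ind_true (Or.inl hP)]; linarith [ind_nonneg Q]
  · rw [ind_false hP, zero_add]; exact ind_mono (fun h => h.resolve_left hP)

variable {α β : Type*} [Fintype α] [Fintype β] {p f g : α → ℝ}

lemma mean_mono (hp : p ∈ stdSimplex ℝ α) (h : ∀ a, f a ≤ g a) : mean p f ≤ mean p g :=
  Finset.sum_le_sum fun a _ => mul_le_mul_of_nonneg_left (h a) (hp.1 a)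

lemma mean_const (hp : p ∈ stdSimplex ℝ α) (c : ℝ) : mean p (fun _ => c) = c := by
  rw [mean, ← Finset.sum_mul, hp.2, one_mul]

lemma mean_le_const (hp : p ∈ stdSimplex ℝ α) {c : ℝ} (h : ∀ a, f a ≤ c) : mean p f ≤ c :=
  (mean_mono hp h).trans_eq (mean_const hp c)

lemma mean_nonneg (hp : p ∈ stdSimplex ℝ α) (h : ∀ a, 0 ≤ f a) : 0 ≤ mean p f :=
  Finset.sum_nonneg fun a _ => mul_nonneg (hp.1 a) (h a)

lemma mean_add (p f g : α → ℝ) : mean p (fun a => f a + g a) = mean p f + mean p g := by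
  simp only [mean, mul_add, Finset.sum_add_distrib]

lemma mean_sub (p f g : α → ℝ) : mean p (fun a => f a - g a) = mean p f - mean p g := by
  simp only [mean, mul_sub, Finset.sum_sub_distrib]

lemma mean_mul_left (p f : α → ℝ) (c : ℝ) : mean p (fun a => c * f a) = c * mean p f := by
  simp only [mean, Finset.mul_sum]; exact Finset.sum_congr rfl fun a _ => by ring

lemma mean_mul_right (p f : α → ℝ) (c : ℝ) : mean p (fun a => f a * c) = mean p f * c := by
  simp only [mean, Finset.sum_mul]; exact Finset.sum_congr rfl fun a _ => by ring

lemma mean_div (p f : α → ℝ) (c : ℝ) : mean p (fun a => f a / c) = mean p f / c := by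
  simp only [div_eq_mul_inv, mean_mul_right]

lemma mean_sum {κ : Type*} (s : Finset κ) (p : α → ℝ) (f : κ → α → ℝ) :
    mean p (fun a => ∑ k ∈ s, f k a) = ∑ k ∈ s, mean p (f k) := by
  simp only [mean, Finset.mul_sum]; exact Finset.sum_comm

lemma mean_comm (p : α → ℝ) (q : β → ℝ) (f : α → β → ℝ) :
    mean p (fun a => mean q (f a)) = mean q (fun b => mean p (fun a => f a b)) := by
  simp only [mean, Finset.mul_sum]
  rw [Finset.sum_comm]
  exact Finset.sum_congr rfl fun b _ => Finset.sum_congr rfl fun a _ => by ring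

lemma mean_sq_le (hp : p ∈ stdSimplex ℝ α) (f : α → ℝ) :
    mean p f ^ 2 ≤ mean p (fun a => f a ^ 2) := by
  have h : 0 ≤ mean p (fun a => (f a - mean p f) ^ 2) := mean_nonneg hp fun a => sq_nonneg _
  have e : mean p (fun a => (f a - mean p f) ^ 2) =
      mean p (fun a => f a ^ 2) - mean p f ^ 2 := by
    have : ∀ a, (f a - mean p f) ^ 2 = f a ^ 2 - 2 * mean p f * f a + mean p f ^ 2 := fun a => by
      ring
    simp only [this]
    rw [mean_add, mean_sub, mean_mul_left, mean_const hp]; ring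
  linarith

lemma mean_abs_le_sqrt (hp : p ∈ stdSimplex ℝ α) (f : α → ℝ) :
    mean p (fun a => |f a|) ≤ √(mean p (fun a => f a ^ 2)) := by
  apply Real.le_sqrt_of_sq_le
  simpa using mean_sq_le hp (fun a => |f a|)

lemma exists_le_mean [Nonempty α] (hp : p ∈ stdSimplex ℝ α) (f : α → ℝ) : ∃ a, f a ≤ mean p f := by
  by_contra! h
  have : mean p (fun _ => mean p f) < mean p f := by
    obtain ⟨a, ha⟩ : ∃ a, p a ≠ 0 := by
      by_contra! h0
      have := hp.2
      simp [h0] at this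
    exact Finset.sum_lt_sum (fun a _ => mul_le_mul_of_nonneg_left (h a).le (hp.1 a))
      ⟨a, Finset.mem_univ a, mul_lt_mul_of_pos_left (h a) (lt_of_le_of_ne (hp.1 a) ha.symm)⟩
  rw [mean_const hp] at this
  exact this.false

end Mean

/-! ### Product laws -/

section Product

variable {ι : Type*} [Fintype ι] [DecidableEq ι] {α : ι → Type*} [∀ i, Fintype (α i)]

/-- The product of a family of weights. -/
def prodLaw (p : ∀ i, α i → ℝ) (ω : ∀ i, α i) : ℝ := ∏ i, p i (ω i)

lemma sum_pi_prod (f : ∀ i, α i → ℝ) : ∑ ω : ∀ i, α i, ∏ i, f i (ω i) = ∏ i, ∑ a, f i a := by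
  rw [Finset.prod_univ_sum, Fintype.piFinset_univ]

lemma prodLaw_mem {p : ∀ i, α i → ℝ} (hp : ∀ i, p i ∈ stdSimplex ℝ (α i)) :
    prodLaw p ∈ stdSimplex ℝ (∀ i, α i) := by
  refine ⟨fun ω => Finset.prod_nonneg fun i _ => (hp i).1 _, ?_⟩
  unfold prodLaw
  rw [sum_pi_prod]
  exact Finset.prod_eq_one fun i _ => (hp i).2

/-- A product law is the product of one coordinate and the others. -/
lemma mean_prodLaw_split (p : ∀ i, α i → ℝ) (i : ι)
    (F : α i → (∀ j : {j // j ≠ i}, α j) → ℝ) :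
    mean (prodLaw p) (fun ω => F (ω i) (fun j => ω j)) =
      mean (p i) (fun a => mean (prodLaw fun j : {j // j ≠ i} => p j) (F a)) := by
  simp only [mean, Finset.mul_sum]
  rw [← Fintype.sum_prod_type']
  refine Fintype.sum_equiv (Equiv.piSplitAt i α) _ _ fun ω => ?_
  simp only [Equiv.piSplitAt_apply, prodLaw]
  rw [Fintype.prod_eq_mul_prod_subtype_ne (fun j => p j (ω j)) i, mul_assoc]

/-- The coordinates of a product law have the given laws. -/
lemma mean_prodLaw_one {p : ∀ i, α i → ℝ} (hp : ∀ i, p i ∈ stdSimplex ℝ (α i)) (i : ι)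
    (f : α i → ℝ) : mean (prodLaw p) (fun ω => f (ω i)) = mean (p i) f := by
  rw [mean_prodLaw_split p i (fun a _ => f a)]
  simp only [mean_const (prodLaw_mem fun j : {j // j ≠ i} => hp j)]

/-- Two different coordinates of a product law are independent. -/
lemma mean_prodLaw_two {p : ∀ i, α i → ℝ} (hp : ∀ i, p i ∈ stdSimplex ℝ (α i)) {i j : ι}
    (hij : j ≠ i) (f : α i → α j → ℝ) :
    mean (prodLaw p) (fun ω => f (ω i) (ω j)) = mean (p i) (fun a => mean (p j) (f a)) := by
  rw [mean_prodLaw_split p i (fun a ω' => f a (ω' ⟨j, hij⟩))]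
  congr 1
  funext a
  exact mean_prodLaw_one (p := fun j : {j // j ≠ i} => p j) (fun j => hp j) ⟨j, hij⟩ (f a)

variable {β : Type*} [Fintype β] {p : β → ℝ}

/-- The second moment of a sum of independent centred variables. -/
lemma mean_prodLaw_sum_sq (hp : p ∈ stdSimplex ℝ β) {f : β → ℝ} (hf : mean p f = 0) :
    mean (prodLaw fun _ : ι => p) (fun ω => (∑ i, f (ω i)) ^ 2) =
      Fintype.card ι * mean p (fun b => f b ^ 2) := by
  have h1 : ∀ ω : ι → β, (∑ i, f (ω i)) ^ 2 = ∑ i, ∑ j, f (ω i) * f (ω j) := fun ω => by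
    rw [sq, Finset.sum_mul_sum]
  simp only [h1, mean_sum]
  have h2 : ∀ i j : ι, mean (prodLaw fun _ : ι => p) (fun ω => f (ω i) * f (ω j)) =
      if j = i then mean p (fun b => f b ^ 2) else 0 := by
    intro i j
    split_ifs with h
    · subst h
      rw [mean_prodLaw_one (p := fun _ : ι => p) (fun _ => hp) j (fun b => f b * f b)]
      simp only [sq]
    · rw [mean_prodLaw_two (p := fun _ : ι => p) (fun _ => hp) h (fun a b => f a * f b)]
      simp only [mean_mul_left, hf, mul_zero]
      exact mean_const hp 0
  simp only [h2, Finset.sum_ite_eq', Finset.mem_univ, if_true, Finset.sum_const, Finset.card_univ,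
    nsmul_eq_mul]

/-- Chebyshev's inequality for the lower tail of a sum of i.i.d. variables. -/
lemma exists_tail_bound (hp : p ∈ stdSimplex ℝ β) (f : β → ℝ) :
    ∃ C : ℝ, 0 ≤ C ∧ ∀ (m : ℕ) (η : ℝ), 0 < m → 0 < η →
      mean (prodLaw fun _ : Fin m => p) (fun ω => ind (∑ i, f (ω i) ≤ m * (mean p f - η))) ≤
        C / (m * η ^ 2) := by
  set μ := mean p f
  have h0 : mean p (fun b => f b - μ) = 0 := by
    rw [mean_sub, mean_const hp, sub_self]
  refine ⟨mean p (fun b => (f b - μ) ^ 2), mean_nonneg hp fun b => sq_nonneg _, ?_⟩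
  intro m η hm hη
  have hm' : (0 : ℝ) < m := by exact_mod_cast hm
  have h1 : ∀ ω : Fin m → β, ind (∑ i, f (ω i) ≤ m * (μ - η)) ≤
      (∑ i, (f (ω i) - μ)) ^ 2 / (m * η) ^ 2 := by
    intro ω
    by_cases h : ∑ i, f (ω i) ≤ m * (μ - η)
    · rw [ind_true h, le_div_iff₀ (by positivity), one_mul, Finset.sum_sub_distrib]
      simp only [Finset.sum_const, Finset.card_univ, Fintype.card_fin, nsmul_eq_mul]
      have : m * η ≤ m * μ - ∑ i, f (ω i) := by linarith
      nlinarith [mul_pos hm' hη]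
    · rw [ind_false h]; positivity
  refine (mean_mono (prodLaw_mem fun _ => hp) h1).trans_eq ?_
  rw [mean_div, mean_prodLaw_sum_sq hp h0, Fintype.card_fin]
  field_simp

end Product

/-! ### The likelihood encoder -/

section Covering

variable {V K : Type*} [Fintype V] [Fintype K]

/-- The probability with which the likelihood encoder selects the index `k` from the codebook `cb`
drawn from `r`, if the target law is `t`; the choice is uniform when all the likelihoods vanish. -/
noncomputable def likelihood (r t : V → ℝ) (cb : K → V) (k : K) : ℝ :=
  open Classical in
  if ∑ j, t (cb j) / r (cb j) = 0 then (1 / Fintype.card K : ℝ)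
  else (t (cb k) / r (cb k)) / ∑ j, t (cb j) / r (cb j)

variable {r t : V → ℝ}

lemma likelihood_mem [Nonempty K] (hr : r ∈ stdSimplex ℝ V) (ht : t ∈ stdSimplex ℝ V)
    (cb : K → V) : likelihood r t cb ∈ stdSimplex ℝ K := by
  have hg : ∀ v, 0 ≤ t v / r v := fun v => div_nonneg (ht.1 v) (hr.1 v)
  constructor
  · intro k
    unfold likelihood
    split_ifs
    · positivity
    · exact div_nonneg (hg _) (Finset.sum_nonneg fun j _ => hg _)
  · unfold likelihood
    split_ifs with h
    · simp
    · rw [← Finset.sum_div, div_self h]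

/-- The covering lemma for the likelihood encoder: the selected codeword has almost the target
law `t`, as soon as the codebook has many more than `c` words, where `t ≤ c * r` typically. -/
lemma mean_likelihood_le [DecidableEq K] [Nonempty K] (hr : r ∈ stdSimplex ℝ V)
    (ht : t ∈ stdSimplex ℝ V) {c b : ℝ} (hc : 0 ≤ c) (hb : 0 ≤ b) {φ : V → ℝ}
    (hφ : ∀ v, 0 ≤ φ v) (hφb : ∀ v, φ v ≤ b) :
    mean (prodLaw fun _ : K => r) (fun cb => mean (likelihood r t cb) (fun k => φ (cb k))) ≤
      mean t φ + b * (mean t (fun v => ind (¬ t v ≤ c * r v)) + √(c / Fintype.card K)) := by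
  have hP := prodLaw_mem (fun _ : K => hr)
  set N : ℝ := (Fintype.card K : ℝ)
  have hN : 0 < N := by simp only [N]; exact_mod_cast Fintype.card_pos
  set g : V → ℝ := fun v => t v / r v with hg_def
  have hg : ∀ v, 0 ≤ g v := fun v => div_nonneg (ht.1 v) (hr.1 v)
  have hrg : ∀ v, r v * g v ≤ t v := by
    intro v
    by_cases h : r v = 0
    · simp [h, ht.1 v]
    · simp only [g]; rw [mul_div_cancel₀ _ h]
  set g' : V → ℝ := fun v => g v * ind (t v ≤ c * r v) with hg'_def
  have hg'0 : ∀ v, 0 ≤ g' v := fun v => mul_nonneg (hg v) (ind_nonneg _)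
  have hg'g : ∀ v, g' v ≤ g v := fun v => mul_le_of_le_one_right (hg v) (ind_le_one _)
  have hg'c : ∀ v, g' v ≤ c := by
    intro v
    by_cases h : t v ≤ c * r v
    · simp only [g', ind_true h, mul_one, g]
      rcases (hr.1 v).eq_or_lt with h0 | h0
      · simp [← h0, hc]
      · rwa [div_le_iff₀ h0]
    · simp [g', ind_false h, hc]
  set δ := mean t (fun v => ind (¬ t v ≤ c * r v)) with hδ
  -- the truncated likelihood ratio has mean `1 - δ`
  have hEg' : mean r g' = 1 - δ := by
    have : ∀ v, r v * g' v = t v - t v * ind (¬ t v ≤ c * r v) := by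
      intro v
      by_cases h : t v ≤ c * r v
      · simp only [g', ind_true h, ind_false (not_not.2 h), g]
        by_cases h0 : r v = 0
        · have : t v = 0 := le_antisymm (by simpa [h0] using h) (ht.1 v)
          simp [h0, this]
        · field_simp; ring
      · simp only [g', ind_false h, ind_true h]; ring
    rw [mean, Finset.sum_congr rfl fun v _ => this v, Finset.sum_sub_distrib, ht.2]; rfl
  set Z : (K → V) → ℝ := fun cb => (∑ k, g (cb k)) / N
  set Z' : (K → V) → ℝ := fun cb => (∑ k, g' (cb k)) / N
  have hpt : ∀ cb : K → V, mean (likelihood r t cb) (fun k => φ (cb k)) ≤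
      (∑ k, g (cb k) * φ (cb k)) / N + b * (δ + |(∑ k, (g' (cb k) - (1 - δ))) / N|) := by
    intro cb
    have hs := likelihood_mem (K := K) hr ht cb
    have hsZ : ∀ k, g (cb k) / N = likelihood r t cb k * Z cb := by
      intro k
      unfold likelihood
      by_cases h : ∑ j, t (cb j) / r (cb j) = 0
      · have h1 : Z cb = 0 := by simp only [Z, g, h, zero_div]
        have h2 : g (cb k) = 0 :=
          (Finset.sum_eq_zero_iff_of_nonneg (fun j _ => hg (cb j))).1 h k (Finset.mem_univ k)
        rw [h1, h2]; simp
      · rw [if_neg h]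
        simp only [Z, g]
        field_simp
    have hsφ : mean (likelihood r t cb) (fun k => φ (cb k)) ≤ b :=
      mean_le_const hs fun k => hφb _
    have hsφ0 : 0 ≤ mean (likelihood r t cb) (fun k => φ (cb k)) :=
      mean_nonneg hs fun k => hφ _
    have e1 : (∑ k, g (cb k) * φ (cb k)) / N =
        mean (likelihood r t cb) (fun k => φ (cb k)) * Z cb := by
      rw [Finset.sum_div, mean, Finset.sum_mul]
      refine Finset.sum_congr rfl fun k _ => ?_
      rw [mul_div_right_comm, hsZ k]; ring
    have hZZ' : Z' cb ≤ Z cb := by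
      simp only [Z, Z']
      gcongr
      exact hg'g _
    have hZ' : (∑ k, (g' (cb k) - (1 - δ))) / N = Z' cb - (1 - δ) := by
      rw [Finset.sum_sub_distrib, Finset.sum_const, Finset.card_univ, nsmul_eq_mul, sub_div,
        mul_div_cancel_left₀ _ hN.ne']
    have hmain : 1 - Z cb ≤ δ + |(∑ k, (g' (cb k) - (1 - δ))) / N| := by
      rw [hZ']
      linarith [neg_abs_le (Z' cb - (1 - δ))]
    have hδ0 : 0 ≤ δ := mean_nonneg ht fun v => ind_nonneg _
    rw [e1]
    have hA : 0 ≤ δ + |(∑ k, (g' (cb k) - (1 - δ))) / N| := by positivity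
    nlinarith [mul_le_mul_of_nonneg_left hmain hsφ0,
      mul_le_mul_of_nonneg_right hsφ hA]
  refine (mean_mono hP hpt).trans ?_
  rw [mean_add, mean_div, mean_sum, mean_mul_left, mean_add, mean_const hP]
  have e2 : ∀ k : K, mean (prodLaw fun _ : K => r) (fun cb => g (cb k) * φ (cb k)) ≤ mean t φ := by
    intro k
    rw [mean_prodLaw_one (p := fun _ : K => r) (fun _ => hr) k (fun v => g v * φ v)]
    refine Finset.sum_le_sum fun v _ => ?_
    rw [← mul_assoc]
    exact mul_le_mul_of_nonneg_right (hrg v) (hφ v)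
  have e3 : (∑ k : K, mean (prodLaw fun _ : K => r) (fun cb => g (cb k) * φ (cb k))) / N
      ≤ mean t φ := by
    rw [div_le_iff₀ hN]
    refine (Finset.sum_le_sum fun k _ => e2 k).trans_eq ?_
    rw [Finset.sum_const, Finset.card_univ, nsmul_eq_mul, mul_comm]
  have e4 : mean (prodLaw fun _ : K => r) (fun cb => |(∑ k, (g' (cb k) - (1 - δ))) / N|) ≤
      √(c / N) := by
    refine (mean_abs_le_sqrt hP _).trans (Real.sqrt_le_sqrt ?_)
    simp only [div_pow]
    rw [mean_div, mean_prodLaw_sum_sq hr (f := fun v => g' v - (1 - δ))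
      (by rw [mean_sub, hEg', mean_const hr, sub_self])]
    have hvar : mean r (fun v => (g' v - (1 - δ)) ^ 2) ≤ c := by
      have h1 : mean r (fun v => (g' v - (1 - δ)) ^ 2) =
          mean r (fun v => g' v ^ 2) - (1 - δ) ^ 2 := by
        have : ∀ v, (g' v - (1 - δ)) ^ 2 = g' v ^ 2 - 2 * (1 - δ) * g' v + (1 - δ) ^ 2 :=
          fun v => by ring
        simp only [this]
        rw [mean_add, mean_sub, mean_mul_left, mean_const hr, hEg']; ring
      have h2 : mean r (fun v => g' v ^ 2) ≤ c * (1 - δ) := by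
        rw [← hEg', ← mean_mul_left]
        refine mean_mono hr fun v => ?_
        rw [sq]
        exact mul_le_mul_of_nonneg_right (hg'c v) (hg'0 v)
      have hδ0 : 0 ≤ δ := mean_nonneg ht fun v => ind_nonneg _
      nlinarith [sq_nonneg (1 - δ), mul_nonneg hc hδ0]
    change N * _ / N ^ 2 ≤ c / N
    rw [div_le_div_iff₀ (by positivity) hN]
    nlinarith [mul_le_mul_of_nonneg_left hvar (by positivity : 0 ≤ N ^ 2)]
  linarith [mul_le_mul_of_nonneg_left e4 hb]

end Covering

/-! ### Block codes and ensembles -/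

/-- A code for one block. The relay enters the block with the state `(w, k) : W × K` and leaves it
with a state in `W' × K'`; the source knows `w`, the next value `w'` and a private message `w''`.
The decoder and the estimator are given the state at the end of the block. -/
structure Block (X X₁ Y Y₁ Shat W K W' K' W'' : Type*) where
  enc : W → W' → W'' → X
  inp : W → K → X₁
  out : W → K → Y₁ → W' × K'
  dec : W' → K' → Y → W × W'' × K
  est : W' → K' → Y → Shat

/-- The relay recovers `w'`, and the decoder recovers the rest from the final state. -/
def Block.Good {X X₁ Y Y₁ Shat W K W' K' W'' : Type*} (B : Block X X₁ Y Y₁ Shat W K W' K' W'')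
    (w : W) (w' : W') (w'' : W'') (k : K) (y : Y) (y₁ : Y₁) : Prop :=
  (B.out w k y₁).1 = w' ∧ B.dec w' (B.out w k y₁).2 y = (w, w'', k)

/-- The kernels from which the codewords `U`, `A`, `X`, `X₁` are drawn, and the channel, whose
output `o : O` determines what the receiver and the relay observe. -/
structure Ensemble (U A X X₁ O Y Y₁ : Type*) [Fintype U] [Fintype A] [Fintype X] [Fintype X₁]
    [Fintype O] where
  pU : U → ℝ
  pA : U → A → ℝ
  pX : U → A → X → ℝ
  pX₁ : U → X₁ → ℝ
  Q : X → X₁ → O → ℝ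
  outY : O → Y
  outY₁ : O → Y₁
  pU_mem : pU ∈ stdSimplex ℝ U
  pA_mem : ∀ u, pA u ∈ stdSimplex ℝ A
  pX_mem : ∀ u a, pX u a ∈ stdSimplex ℝ X
  pX₁_mem : ∀ u, pX₁ u ∈ stdSimplex ℝ X₁
  Q_mem : ∀ x x₁, Q x x₁ ∈ stdSimplex ℝ O

/-- A description `V` of the relay's observation: its kernel `pV`, the law `r` of the codebook
from which the description is selected, and the test functions of the decoders. Each test function
has mean at most one when the codewords that it tests are drawn independently of the observation:
for `τ₀` the word `a`, for `τ₁` the word `x`, for `τ₂` the words `x, x₁, v`, for `τ₃` the words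
`x₁, v`, and for `τ₄` all five words. -/
structure Description {U A X X₁ O Y Y₁ : Type*} [Fintype U] [Fintype A] [Fintype X] [Fintype X₁]
    [Fintype O] (E : Ensemble U A X X₁ O Y Y₁) (V : Type*) [Fintype V] where
  pV : U → A → X₁ → Y₁ → V → ℝ
  r : U → A → X₁ → V → ℝ
  pV_mem : ∀ u a x₁ y₁, pV u a x₁ y₁ ∈ stdSimplex ℝ V
  r_mem : ∀ u a x₁, r u a x₁ ∈ stdSimplex ℝ V
  τ₀ : U → A → X₁ → Y₁ → ℝ
  τ₁ : U → A → X → X₁ → V → Y → ℝ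
  τ₂ : U → A → X → X₁ → V → Y → ℝ
  τ₃ : U → A → X → X₁ → V → Y → ℝ
  τ₄ : U → A → X → X₁ → V → Y → ℝ
  τ₀_nonneg : ∀ u a x₁ y₁, 0 ≤ τ₀ u a x₁ y₁
  τ₁_nonneg : ∀ u a x x₁ v y, 0 ≤ τ₁ u a x x₁ v y
  τ₂_nonneg : ∀ u a x x₁ v y, 0 ≤ τ₂ u a x x₁ v y
  τ₃_nonneg : ∀ u a x x₁ v y, 0 ≤ τ₃ u a x x₁ v y
  τ₄_nonneg : ∀ u a x x₁ v y, 0 ≤ τ₄ u a x x₁ v y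
  τ₀_mean : ∀ u x₁ y₁, mean (E.pA u) (fun a => τ₀ u a x₁ y₁) ≤ 1
  τ₁_mean : ∀ u a x₁ v y, mean (E.pX u a) (fun x => τ₁ u a x x₁ v y) ≤ 1
  τ₂_mean : ∀ u a y, mean (E.pX u a) (fun x => mean (E.pX₁ u) fun x₁ =>
    mean (r u a x₁) fun v => τ₂ u a x x₁ v y) ≤ 1
  τ₃_mean : ∀ u a x y, mean (E.pX₁ u) (fun x₁ => mean (r u a x₁) fun v => τ₃ u a x x₁ v y) ≤ 1
  τ₄_mean : ∀ y, mean E.pU (fun u => mean (E.pA u) fun a => mean (E.pX u a) fun x =>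
    mean (E.pX₁ u) fun x₁ => mean (r u a x₁) fun v => τ₄ u a x x₁ v y) ≤ 1

section

variable {U A X X₁ O Y Y₁ V : Type*} [Fintype U] [Fintype A] [Fintype X] [Fintype X₁] [Fintype O]
  [Fintype V] {E : Ensemble U A X X₁ O Y Y₁}

/-- The mean under the joint law of `(U, A, X, X₁, O, V)`. -/
noncomputable def Description.avg (t : Description E V) (F : U → A → X → X₁ → O → V → ℝ) : ℝ :=
  mean E.pU fun u => mean (E.pA u) fun a => mean (E.pX u a) fun x => mean (E.pX₁ u) fun x₁ =>
    mean (E.Q x x₁) fun o => mean (t.pV u a x₁ (E.outY₁ o)) fun v => F u a x x₁ o v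

lemma Description.avg_mono (t : Description E V) {F G : U → A → X → X₁ → O → V → ℝ}
    (h : ∀ u a x x₁ o v, F u a x x₁ o v ≤ G u a x x₁ o v) : t.avg F ≤ t.avg G :=
  mean_mono E.pU_mem fun _ => mean_mono (E.pA_mem _) fun _ => mean_mono (E.pX_mem _ _) fun _ =>
    mean_mono (E.pX₁_mem _) fun _ => mean_mono (E.Q_mem _ _) fun _ =>
      mean_mono (t.pV_mem _ _ _ _) fun _ => h _ _ _ _ _ _

lemma Description.avg_add (t : Description E V) (F G : U → A → X → X₁ → O → V → ℝ) :
    t.avg (fun u a x x₁ o v => F u a x x₁ o v + G u a x x₁ o v) = t.avg F + t.avg G := by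
  simp only [Description.avg, mean_add]

lemma Description.avg_mul_left (t : Description E V) (F : U → A → X → X₁ → O → V → ℝ) (c : ℝ) :
    t.avg (fun u a x x₁ o v => c * F u a x x₁ o v) = c * t.avg F := by
  simp only [Description.avg, mean_mul_left]

lemma Description.avg_const (t : Description E V) (c : ℝ) :
    t.avg (fun _ _ _ _ _ _ => c) = c := by
  simp only [Description.avg, mean_const (E.pU_mem), mean_const (E.pA_mem _),
    mean_const (E.pX_mem _ _), mean_const (E.pX₁_mem _), mean_const (E.Q_mem _ _),
    mean_const (t.pV_mem _ _ _ _)]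

end

/-! ### Random superposition codes -/

section Pair

variable {α β : Type*} [Fintype α] [Fintype β]

/-- The joint law of a variable with law `p` and a variable with conditional law `q`. -/
def pairLaw (p : α → ℝ) (q : α → β → ℝ) (z : α × β) : ℝ := p z.1 * q z.1 z.2

lemma mean_pairLaw (p : α → ℝ) (q : α → β → ℝ) (f : α × β → ℝ) :
    mean (pairLaw p q) f = mean p fun a => mean (q a) fun b => f (a, b) := by
  simp only [mean, Fintype.sum_prod_type, pairLaw, Finset.mul_sum, mul_assoc]

lemma pairLaw_mem {p : α → ℝ} {q : α → β → ℝ} (hp : p ∈ stdSimplex ℝ α)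
    (hq : ∀ a, q a ∈ stdSimplex ℝ β) : pairLaw p q ∈ stdSimplex ℝ (α × β) := by
  refine ⟨fun z => mul_nonneg (hp.1 _) ((hq _).1 _), ?_⟩
  have := mean_pairLaw p q (fun _ => 1)
  simp only [mean_const (hq _), mean_const hp] at this
  simpa [mean] using this

end Pair

/-- The codewords below a value of `w`: the word `u`, the words `a` indexed by `w'`, the words `x`
indexed by `(w', w'')`, and for every `k` the word `x₁` and, for every `w'`, a codebook of
descriptions together with the selection made by the relay. -/
abbrev Tree (U A X X₁ Y₁ V W' K W'' K' : Type*) :=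
  U × (W' → A) × (W' × W'' → X) × (K → X₁ × (W' → (K' → V) × (Y₁ → K')))

section Tree

set_option synthInstance.maxSize 1000

variable {U A X X₁ O Y Y₁ V W K W' K' W'' : Type*}
  [Fintype U] [Fintype A] [Fintype X] [Fintype X₁] [Fintype O] [Fintype V] [Fintype Y₁]
  [Fintype W] [Fintype K] [Fintype W'] [Fintype K'] [Fintype W'']
  [DecidableEq Y₁] [DecidableEq W] [DecidableEq K] [DecidableEq W'] [DecidableEq K']
  [DecidableEq W'']

/-- The law of the relay's words for one value of `k`. -/
def relayLaw (E : Ensemble U A X X₁ O Y Y₁) (C : U → A → X₁ → (K' → V) × (Y₁ → K') → ℝ) (u : U)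
    (ta : W' → A) : X₁ × (W' → (K' → V) × (Y₁ → K')) → ℝ :=
  pairLaw (E.pX₁ u) fun x₁ => prodLaw fun w' => C u (ta w') x₁

/-- The law of superposition coding, where `C` is the law of a codebook with its selection. -/
def treeLaw (E : Ensemble U A X X₁ O Y Y₁) (C : U → A → X₁ → (K' → V) × (Y₁ → K') → ℝ) :
    Tree U A X X₁ Y₁ V W' K W'' K' → ℝ :=
  pairLaw E.pU fun u => pairLaw (prodLaw fun _ => E.pA u) fun ta =>
    pairLaw (prodLaw fun i => E.pX u (ta i.1)) fun _ => prodLaw fun _ => relayLaw E C u ta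

variable {E : Ensemble U A X X₁ O Y Y₁} {C : U → A → X₁ → (K' → V) × (Y₁ → K') → ℝ}

lemma relayLaw_mem (hC : ∀ u a x₁, C u a x₁ ∈ stdSimplex ℝ _) (u : U) (ta : W' → A) :
    relayLaw E C u ta ∈ stdSimplex ℝ _ :=
  pairLaw_mem (E.pX₁_mem u) fun _ => prodLaw_mem fun _ => hC _ _ _

lemma treeLaw_mem (hC : ∀ u a x₁, C u a x₁ ∈ stdSimplex ℝ _) :
    treeLaw E C ∈ stdSimplex ℝ (Tree U A X X₁ Y₁ V W' K W'' K') :=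
  pairLaw_mem E.pU_mem fun _ => pairLaw_mem (prodLaw_mem fun _ => E.pA_mem _) fun _ =>
    pairLaw_mem (prodLaw_mem fun _ => E.pX_mem _ _) fun _ => prodLaw_mem fun _ => relayLaw_mem hC _ _

lemma mean_relayLaw (hC : ∀ u a x₁, C u a x₁ ∈ stdSimplex ℝ _) (u : U) (ta : W' → A) (w' : W')
    (F : X₁ → (K' → V) × (Y₁ → K') → ℝ) :
    mean (relayLaw E C u ta) (fun z => F z.1 (z.2 w')) =
      mean (E.pX₁ u) fun x₁ => mean (C u (ta w') x₁) (F x₁) := by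
  rw [relayLaw, mean_pairLaw]
  congr 1; funext x₁
  exact mean_prodLaw_one (p := fun w' => C u (ta w') x₁) (fun _ => hC _ _ _) w' (F x₁)

/-- The joint law of the words that belong to one choice of the indices. -/
lemma mean_treeLaw (hC : ∀ u a x₁, C u a x₁ ∈ stdSimplex ℝ _) (w' : W') (w'' : W'') (k : K)
    (F : U → A → X → X₁ → (K' → V) × (Y₁ → K') → ℝ) :
    mean (treeLaw E C) (fun ν : Tree U A X X₁ Y₁ V W' K W'' K' =>
      F ν.1 (ν.2.1 w') (ν.2.2.1 (w', w'')) (ν.2.2.2 k).1 ((ν.2.2.2 k).2 w')) =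
    mean E.pU fun u => mean (E.pA u) fun a => mean (E.pX u a) fun x => mean (E.pX₁ u) fun x₁ =>
      mean (C u a x₁) fun c => F u a x x₁ c := by
  simp only [treeLaw, mean_pairLaw]
  congr 1; funext u
  rw [← mean_prodLaw_one (p := fun _ : W' => E.pA u) (fun _ => E.pA_mem u) w'
    (fun a => mean (E.pX u a) fun x => mean (E.pX₁ u) fun x₁ => mean (C u a x₁) fun c =>
      F u a x x₁ c)]
  congr 1; funext ta
  rw [← mean_prodLaw_one (p := fun i : W' × W'' => E.pX u (ta i.1)) (fun _ => E.pX_mem u _)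
    (w', w'') (fun x => mean (E.pX₁ u) fun x₁ => mean (C u (ta w') x₁) fun c =>
      F u (ta w') x x₁ c)]
  congr 1; funext tx
  rw [mean_prodLaw_one (p := fun _ : K => relayLaw E C u ta) (fun _ => relayLaw_mem hC u ta) k
    (fun z => F u (ta w') (tx (w', w'')) z.1 (z.2 w'))]
  exact mean_relayLaw hC u ta w' (fun x₁ c => F u (ta w') (tx (w', w'')) x₁ c)

variable (t : Description E V) (hC : ∀ u a x₁, C u a x₁ ∈ stdSimplex ℝ _)
  (hCr : ∀ u a x₁ k φ, mean (C u a x₁) (fun c => φ (c.1 k)) = mean (t.r u a x₁) φ)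
include hC

/-- The test of a wrong word `a` at the relay. -/
lemma mean_tree_wrong_a {w' w₂' : W'} (h : w₂' ≠ w') (w'' : W'') (k : K) :
    mean (treeLaw E C) (fun ν : Tree U A X X₁ Y₁ V W' K W'' K' =>
      mean (E.Q (ν.2.2.1 (w', w'')) (ν.2.2.2 k).1) fun o =>
        t.τ₀ ν.1 (ν.2.1 w₂') (ν.2.2.2 k).1 (E.outY₁ o)) ≤ 1 := by
  simp only [treeLaw, mean_pairLaw]
  refine mean_le_const E.pU_mem fun u => ?_
  have h1 : ∀ ta : W' → A, mean (prodLaw fun i : W' × W'' => E.pX u (ta i.1)) (fun tx =>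
      mean (prodLaw fun _ : K => relayLaw E C u ta) fun tz => mean (E.Q (tx (w', w'')) (tz k).1)
        fun o => t.τ₀ u (ta w₂') (tz k).1 (E.outY₁ o)) =
      mean (E.pX u (ta w')) (fun x => mean (E.pX₁ u) fun x₁ => mean (E.Q x x₁) fun o =>
        t.τ₀ u (ta w₂') x₁ (E.outY₁ o)) := by
    intro ta
    rw [← mean_prodLaw_one (p := fun i : W' × W'' => E.pX u (ta i.1)) (fun _ => E.pX_mem u _)
      (w', w'') (fun x => mean (E.pX₁ u) fun x₁ => mean (E.Q x x₁) fun o =>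
        t.τ₀ u (ta w₂') x₁ (E.outY₁ o))]
    congr 1; funext tx
    rw [mean_prodLaw_one (p := fun _ : K => relayLaw E C u ta) (fun _ => relayLaw_mem hC u ta) k
      (fun z => mean (E.Q (tx (w', w'')) z.1) fun o => t.τ₀ u (ta w₂') z.1 (E.outY₁ o))]
    rw [mean_relayLaw hC u ta w' (fun x₁ _ => mean (E.Q (tx (w', w'')) x₁) fun o =>
      t.τ₀ u (ta w₂') x₁ (E.outY₁ o))]
    simp only [mean_const (hC _ _ _)]
  simp only [h1]
  rw [mean_prodLaw_two (p := fun _ : W' => E.pA u) (fun _ => E.pA_mem u) h (fun a a₂ =>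
    mean (E.pX u a) (fun x => mean (E.pX₁ u) fun x₁ => mean (E.Q x x₁) fun o =>
        t.τ₀ u a₂ x₁ (E.outY₁ o)))]
  refine mean_le_const (E.pA_mem u) fun a => ?_
  rw [mean_comm]
  refine mean_le_const (E.pX_mem u a) fun x => ?_
  rw [mean_comm]
  refine mean_le_const (E.pX₁_mem u) fun x₁ => ?_
  rw [mean_comm]
  exact mean_le_const (E.Q_mem x x₁) fun o => t.τ₀_mean u x₁ _

/-- The test of a wrong word `x` at the decoder. -/
lemma mean_tree_wrong_x (w' : W') {w'' w₂'' : W''} (h : w₂'' ≠ w'') (k : K) :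
    mean (treeLaw E C) (fun ν : Tree U A X X₁ Y₁ V W' K W'' K' =>
      mean (E.Q (ν.2.2.1 (w', w'')) (ν.2.2.2 k).1) fun o =>
        t.τ₁ ν.1 (ν.2.1 w') (ν.2.2.1 (w', w₂'')) (ν.2.2.2 k).1
          (((ν.2.2.2 k).2 w').1 (((ν.2.2.2 k).2 w').2 (E.outY₁ o))) (E.outY o)) ≤ 1 := by
  simp only [treeLaw, mean_pairLaw]
  refine mean_le_const E.pU_mem fun u => ?_
  refine mean_le_const (prodLaw_mem fun _ => E.pA_mem u) fun ta => ?_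
  rw [mean_comm]
  refine mean_le_const (prodLaw_mem fun _ => relayLaw_mem hC u ta) fun tz => ?_
  rw [mean_prodLaw_two (p := fun i : W' × W'' => E.pX u (ta i.1)) (fun _ => E.pX_mem u _)
    (i := (w', w'')) (j := (w', w₂'')) (by simpa using h) (fun x x₂ =>
    mean (E.Q x (tz k).1) fun o => t.τ₁ u (ta w') x₂ (tz k).1
      (((tz k).2 w').1 (((tz k).2 w').2 (E.outY₁ o))) (E.outY o))]
  refine mean_le_const (E.pX_mem u _) fun x => ?_
  rw [mean_comm]
  exact mean_le_const (E.Q_mem _ _) fun o => t.τ₁_mean _ _ _ _ _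

include hCr

/-- The test of wrong words `x`, `x₁`, `v` at the decoder. -/
lemma mean_tree_wrong_x_x₁ (w' : W') {w'' w₂'' : W''} (h : w₂'' ≠ w'') {k k₂ : K} (hk : k₂ ≠ k) :
    mean (treeLaw E C) (fun ν : Tree U A X X₁ Y₁ V W' K W'' K' =>
      mean (E.Q (ν.2.2.1 (w', w'')) (ν.2.2.2 k).1) fun o =>
        t.τ₂ ν.1 (ν.2.1 w') (ν.2.2.1 (w', w₂'')) (ν.2.2.2 k₂).1
          (((ν.2.2.2 k₂).2 w').1 (((ν.2.2.2 k).2 w').2 (E.outY₁ o))) (E.outY o)) ≤ 1 := by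
  simp only [treeLaw, mean_pairLaw]
  refine mean_le_const E.pU_mem fun u => ?_
  refine mean_le_const (prodLaw_mem fun _ => E.pA_mem u) fun ta => ?_
  have h1 := fun tz : K → X₁ × (W' → (K' → V) × (Y₁ → K')) =>
    mean_prodLaw_two (p := fun i : W' × W'' => E.pX u (ta i.1)) (fun _ => E.pX_mem u _)
    (i := (w', w'')) (j := (w', w₂'')) (by simpa using h) (fun x x₂ =>
    mean (E.Q x (tz k).1) fun o => t.τ₂ u (ta w') x₂ (tz k₂).1
      (((tz k₂).2 w').1 (((tz k).2 w').2 (E.outY₁ o))) (E.outY o))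
  rw [mean_comm]
  simp only [h1]
  rw [mean_comm]
  refine mean_le_const (E.pX_mem u _) fun x => ?_
  rw [mean_prodLaw_two (p := fun _ : K => relayLaw E C u ta) (fun _ => relayLaw_mem hC u ta) hk
    (fun z z₂ => mean (E.pX u (ta w')) fun x₂ => mean (E.Q x z.1) fun o => t.τ₂ u (ta w') x₂ z₂.1
      ((z₂.2 w').1 ((z.2 w').2 (E.outY₁ o))) (E.outY o))]
  refine mean_le_const (relayLaw_mem hC u ta) fun z => ?_
  rw [← mean_pairLaw (relayLaw E C u ta) (fun _ => E.pX u (ta w'))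
    (fun q => mean (E.Q x z.1) fun o => t.τ₂ u (ta w') q.2 q.1.1
      ((q.1.2 w').1 ((z.2 w').2 (E.outY₁ o))) (E.outY o)), mean_comm]
  refine mean_le_const (E.Q_mem _ _) fun o => ?_
  rw [mean_pairLaw, mean_comm]
  refine le_trans (le_of_eq ?_) (t.τ₂_mean u (ta w') (E.outY o))
  congr 1; funext x₂
  rw [mean_relayLaw hC u ta w' (fun x₁ c => t.τ₂ u (ta w') x₂ x₁
    (c.1 ((z.2 w').2 (E.outY₁ o))) (E.outY o))]
  congr 1; funext x₁
  exact hCr _ _ _ _ fun v => t.τ₂ u (ta w') x₂ x₁ v (E.outY o)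

/-- The test of wrong words `x₁`, `v` at the decoder. -/
lemma mean_tree_wrong_x₁ (w' : W') (w'' : W'') {k k₂ : K} (hk : k₂ ≠ k) :
    mean (treeLaw E C) (fun ν : Tree U A X X₁ Y₁ V W' K W'' K' =>
      mean (E.Q (ν.2.2.1 (w', w'')) (ν.2.2.2 k).1) fun o =>
        t.τ₃ ν.1 (ν.2.1 w') (ν.2.2.1 (w', w'')) (ν.2.2.2 k₂).1
          (((ν.2.2.2 k₂).2 w').1 (((ν.2.2.2 k).2 w').2 (E.outY₁ o))) (E.outY o)) ≤ 1 := by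
  simp only [treeLaw, mean_pairLaw]
  refine mean_le_const E.pU_mem fun u => ?_
  refine mean_le_const (prodLaw_mem fun _ => E.pA_mem u) fun ta => ?_
  refine mean_le_const (prodLaw_mem fun _ => E.pX_mem u _) fun tx => ?_
  rw [mean_prodLaw_two (p := fun _ : K => relayLaw E C u ta) (fun _ => relayLaw_mem hC u ta) hk
    (fun z z₂ => mean (E.Q (tx (w', w'')) z.1) fun o => t.τ₃ u (ta w') (tx (w', w'')) z₂.1
      ((z₂.2 w').1 ((z.2 w').2 (E.outY₁ o))) (E.outY o))]
  refine mean_le_const (relayLaw_mem hC u ta) fun z => ?_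
  rw [mean_comm]
  refine mean_le_const (E.Q_mem _ _) fun o => ?_
  refine le_trans (le_of_eq ?_) (t.τ₃_mean u (ta w') (tx (w', w'')) (E.outY o))
  rw [mean_relayLaw hC u ta w' (fun x₁ c => t.τ₃ u (ta w') (tx (w', w'')) x₁
    (c.1 ((z.2 w').2 (E.outY₁ o))) (E.outY o))]
  congr 1; funext x₁
  exact hCr _ _ _ _ fun v => t.τ₃ u (ta w') (tx (w', w'')) x₁ v (E.outY o)

/-- The test of words that belong to a wrong value of `w`. -/
lemma mean_tree_wrong_u {w w₂ : W} (h : w₂ ≠ w) (w' : W') (w'' w₂'' : W'') (k k₂ : K) :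
    mean (prodLaw fun _ : W => treeLaw E C) (fun θ : W → Tree U A X X₁ Y₁ V W' K W'' K' =>
      mean (E.Q ((θ w).2.2.1 (w', w'')) ((θ w).2.2.2 k).1) fun o =>
        t.τ₄ (θ w₂).1 ((θ w₂).2.1 w') ((θ w₂).2.2.1 (w', w₂'')) ((θ w₂).2.2.2 k₂).1
          ((((θ w₂).2.2.2 k₂).2 w').1 ((((θ w).2.2.2 k).2 w').2 (E.outY₁ o))) (E.outY o)) ≤ 1 := by
  rw [mean_prodLaw_two (p := fun _ : W => treeLaw E C) (fun _ => treeLaw_mem hC) h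
    (fun ν ν₂ => mean (E.Q (ν.2.2.1 (w', w'')) (ν.2.2.2 k).1) fun o =>
        t.τ₄ ν₂.1 (ν₂.2.1 w') (ν₂.2.2.1 (w', w₂'')) (ν₂.2.2.2 k₂).1
          (((ν₂.2.2.2 k₂).2 w').1 (((ν.2.2.2 k).2 w').2 (E.outY₁ o))) (E.outY o))]
  refine mean_le_const (treeLaw_mem hC) fun ν => ?_
  rw [mean_comm]
  refine mean_le_const (E.Q_mem _ _) fun o => ?_
  rw [mean_treeLaw hC w' w₂'' k₂ (fun u a x x₁ c => t.τ₄ u a x x₁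
    (c.1 (((ν.2.2.2 k).2 w').2 (E.outY₁ o))) (E.outY o))]
  refine le_trans (le_of_eq ?_) (t.τ₄_mean (E.outY o))
  congr 1; funext u; congr 1; funext a; congr 1; funext x; congr 1; funext x₁
  exact hCr _ _ _ _ fun v => t.τ₄ u a x x₁ v (E.outY o)

omit hCr in
/-- The words actually sent, together with the selected description, have almost the joint law of
the ensemble. -/
lemma mean_tree_true {κ : U → A → X₁ → Y₁ → ℝ}
    (hCκ : ∀ u a x₁ y₁ (φ : V → ℝ) (b : ℝ), (∀ v, 0 ≤ φ v) → (∀ v, φ v ≤ b) →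
      mean (C u a x₁) (fun c => φ (c.1 (c.2 y₁))) ≤ mean (t.pV u a x₁ y₁) φ + b * κ u a x₁ y₁)
    (w' : W') (w'' : W'') (k : K) {F : U → A → X → X₁ → O → V → ℝ} {b : ℝ}
    (hF : ∀ u a x x₁ o v, 0 ≤ F u a x x₁ o v) (hFb : ∀ u a x x₁ o v, F u a x x₁ o v ≤ b) :
    mean (treeLaw E C) (fun ν : Tree U A X X₁ Y₁ V W' K W'' K' =>
      mean (E.Q (ν.2.2.1 (w', w'')) (ν.2.2.2 k).1) fun o =>
        F ν.1 (ν.2.1 w') (ν.2.2.1 (w', w'')) (ν.2.2.2 k).1 o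
          (((ν.2.2.2 k).2 w').1 (((ν.2.2.2 k).2 w').2 (E.outY₁ o)))) ≤
      t.avg F + b * t.avg (fun u a _ x₁ o _ => κ u a x₁ (E.outY₁ o)) := by
  rw [mean_treeLaw hC w' w'' k (fun u a x x₁ c => mean (E.Q x x₁) fun o =>
    F u a x x₁ o (c.1 (c.2 (E.outY₁ o)))), ← t.avg_mul_left, ← t.avg_add]
  refine mean_mono E.pU_mem fun u => mean_mono (E.pA_mem u) fun a => mean_mono (E.pX_mem u a)
    fun x => mean_mono (E.pX₁_mem u) fun x₁ => ?_
  rw [mean_comm]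
  refine mean_mono (E.Q_mem x x₁) fun o => ?_
  rw [mean_add, mean_const (t.pV_mem _ _ _ _)]
  exact hCκ u a x₁ _ (fun v => F u a x x₁ o v) b (fun v => hF _ _ _ _ _ _) (fun v => hFb _ _ _ _ _ _)

end Tree

/-! ### The one-shot bounds -/

lemma sum_le_card_of_le_one {ι : Type*} {s : Finset ι} {N : ℕ} {F : ι → ℝ} (hN : s.card = N)
    (hF : ∀ i ∈ s, F i ≤ 1) : ∑ i ∈ s, F i ≤ N := by
  refine (Finset.sum_le_sum hF).trans ?_
  simp [hN]

section OneShot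

set_option synthInstance.maxSize 1000

variable {U A X X₁ O Y Y₁ V Shat W K W' K' W'' : Type*}
  [Fintype U] [Fintype A] [Fintype X] [Fintype X₁] [Fintype O] [Fintype V] [Fintype Y₁]
  [Fintype W] [Fintype K] [Fintype W'] [Fintype K'] [Fintype W'']
  {E : Ensemble U A X X₁ O Y Y₁}

/-- The words pass the four tests of the decoder. -/
def Description.Pass (t : Description E V) (c₁ c₂ c₃ c₄ : ℝ) (u : U) (a : A) (x : X) (x₁ : X₁)
    (v : V) (y : Y) : Prop :=
  c₁ < t.τ₁ u a x x₁ v y ∧ c₂ < t.τ₂ u a x x₁ v y ∧ c₃ < t.τ₃ u a x x₁ v y ∧ c₄ < t.τ₄ u a x x₁ v y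

/-- The block code with the codewords `θ` in which the relay and the decoder look for words that
pass the tests, and the estimator `e` is applied to the decoded words. If no words pass, or several
do, the choice is arbitrary. -/
noncomputable def treeBlock [Nonempty W] [Nonempty K] [Nonempty W'] [Nonempty W'']
    (t : Description E V) (c₀ c₁ c₂ c₃ c₄ : ℝ) (e : U → A → X → X₁ → V → Y → Shat)
    (θ : W → Tree U A X X₁ Y₁ V W' K W'' K') : Block X X₁ Y Y₁ Shat W K W' K' W'' :=
  let dec : W' → K' → Y → W × W'' × K := fun w' k' y => Classical.epsilon fun j : W × W'' × K =>
    t.Pass c₁ c₂ c₃ c₄ (θ j.1).1 ((θ j.1).2.1 w') ((θ j.1).2.2.1 (w', j.2.1))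
      ((θ j.1).2.2.2 j.2.2).1 ((((θ j.1).2.2.2 j.2.2).2 w').1 k') y
  { enc := fun w w' w'' => (θ w).2.2.1 (w', w'')
    inp := fun w k => ((θ w).2.2.2 k).1
    out := fun w k y₁ =>
      let w' := Classical.epsilon fun w' : W' =>
        c₀ < t.τ₀ (θ w).1 ((θ w).2.1 w') ((θ w).2.2.2 k).1 y₁
      (w', (((θ w).2.2.2 k).2 w').2 y₁)
    dec := dec
    est := fun w' k' y =>
      let j := dec w' k' y
      e (θ j.1).1 ((θ j.1).2.1 w') ((θ j.1).2.2.1 (w', j.2.1))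
        ((θ j.1).2.2.2 j.2.2).1 ((((θ j.1).2.2.2 j.2.2).2 w').1 k') y }

variable [Nonempty W] [Nonempty K] [Nonempty W'] [Nonempty W'']
  (t : Description E V) {c₀ c₁ c₂ c₃ c₄ : ℝ} (e : U → A → X → X₁ → V → Y → Shat)

omit [Fintype Y₁] [Fintype W] [Fintype K] [Fintype W'] [Fintype K'] [Fintype W''] in
lemma treeBlock_good {θ : W → Tree U A X X₁ Y₁ V W' K W'' K'} {w : W} {w' : W'} {w'' : W''} {k : K}
    {y : Y} {y₁ : Y₁} (h0 : c₀ < t.τ₀ (θ w).1 ((θ w).2.1 w') ((θ w).2.2.2 k).1 y₁)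
    (h0' : ∀ w₂', w₂' ≠ w' → ¬ c₀ < t.τ₀ (θ w).1 ((θ w).2.1 w₂') ((θ w).2.2.2 k).1 y₁)
    (h1 : t.Pass c₁ c₂ c₃ c₄ (θ w).1 ((θ w).2.1 w') ((θ w).2.2.1 (w', w''))
      ((θ w).2.2.2 k).1 ((((θ w).2.2.2 k).2 w').1 ((((θ w).2.2.2 k).2 w').2 y₁)) y)
    (h1' : ∀ w₂ w₂'' k₂, (w₂, w₂'', k₂) ≠ (w, w'', k) →
      ¬ t.Pass c₁ c₂ c₃ c₄ (θ w₂).1 ((θ w₂).2.1 w') ((θ w₂).2.2.1 (w', w₂''))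
      ((θ w₂).2.2.2 k₂).1 ((((θ w₂).2.2.2 k₂).2 w').1 ((((θ w).2.2.2 k).2 w').2 y₁)) y) :
    (treeBlock t c₀ c₁ c₂ c₃ c₄ e θ).Good w w' w'' k y y₁ := by
  have hw : (Classical.epsilon fun w' : W' =>
      c₀ < t.τ₀ (θ w).1 ((θ w).2.1 w') ((θ w).2.2.2 k).1 y₁) = w' := by
    by_contra hne
    exact h0' _ hne (Classical.epsilon_spec (p := fun w' : W' =>
      c₀ < t.τ₀ (θ w).1 ((θ w).2.1 w') ((θ w).2.2.2 k).1 y₁) ⟨w', h0⟩)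
  refine ⟨hw, ?_⟩
  simp only [treeBlock, hw]
  by_contra hne
  exact h1' _ _ _ hne (Classical.epsilon_spec (p := fun j : W × W'' × K =>
    t.Pass c₁ c₂ c₃ c₄ (θ j.1).1 ((θ j.1).2.1 w') ((θ j.1).2.2.1 (w', j.2.1))
      ((θ j.1).2.2.2 j.2.2).1
      ((((θ j.1).2.2.2 j.2.2).2 w').1 ((((θ w).2.2.2 k).2 w').2 y₁)) y) ⟨(w, w'', k), h1⟩)

variable [DecidableEq W] [DecidableEq K] [DecidableEq W'] [DecidableEq W'']

/-- The union bound: if a block is not decoded, then the words sent fail a test or wrong words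
pass one. -/
lemma ind_not_good_le (hc₀ : 0 < c₀) (hc₁ : 0 < c₁) (hc₂ : 0 < c₂) (hc₃ : 0 < c₃) (hc₄ : 0 < c₄)
    (θ : W → Tree U A X X₁ Y₁ V W' K W'' K') (w : W) (w' : W') (w'' : W'') (k : K)
    (y : Y) (y₁ : Y₁) :
    ind (¬ (treeBlock t c₀ c₁ c₂ c₃ c₄ e θ).Good w w' w'' k y y₁) ≤
      ind (¬ (c₀ < t.τ₀ (θ w).1 ((θ w).2.1 w') ((θ w).2.2.2 k).1 y₁ ∧
        t.Pass c₁ c₂ c₃ c₄ (θ w).1 ((θ w).2.1 w') ((θ w).2.2.1 (w', w''))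
          ((θ w).2.2.2 k).1 ((((θ w).2.2.2 k).2 w').1 ((((θ w).2.2.2 k).2 w').2 y₁)) y)) +
      ∑ w₂' ∈ Finset.univ.erase w', t.τ₀ (θ w).1 ((θ w).2.1 w₂') ((θ w).2.2.2 k).1 y₁ / c₀ +
      ∑ w₂'' ∈ Finset.univ.erase w'', t.τ₁ (θ w).1 ((θ w).2.1 w') ((θ w).2.2.1 (w', w₂''))
        ((θ w).2.2.2 k).1 ((((θ w).2.2.2 k).2 w').1 ((((θ w).2.2.2 k).2 w').2 y₁)) y / c₁ +
      ∑ w₂'' ∈ Finset.univ.erase w'', ∑ k₂ ∈ Finset.univ.erase k,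
        t.τ₂ (θ w).1 ((θ w).2.1 w') ((θ w).2.2.1 (w', w₂'')) ((θ w).2.2.2 k₂).1
          ((((θ w).2.2.2 k₂).2 w').1 ((((θ w).2.2.2 k).2 w').2 y₁)) y / c₂ +
      ∑ k₂ ∈ Finset.univ.erase k,
        t.τ₃ (θ w).1 ((θ w).2.1 w') ((θ w).2.2.1 (w', w'')) ((θ w).2.2.2 k₂).1
          ((((θ w).2.2.2 k₂).2 w').1 ((((θ w).2.2.2 k).2 w').2 y₁)) y / c₃ +
      ∑ w₂ ∈ Finset.univ.erase w, ∑ w₂'' : W'', ∑ k₂ : K,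
        t.τ₄ (θ w₂).1 ((θ w₂).2.1 w') ((θ w₂).2.2.1 (w', w₂'')) ((θ w₂).2.2.2 k₂).1
          ((((θ w₂).2.2.2 k₂).2 w').1 ((((θ w).2.2.2 k).2 w').2 y₁)) y / c₄ := by
  have n0 := fun w₂' (_ : w₂' ∈ Finset.univ.erase w') =>
    div_nonneg (t.τ₀_nonneg (θ w).1 ((θ w).2.1 w₂') ((θ w).2.2.2 k).1 y₁) hc₀.le
  have n1 := fun w₂'' (_ : w₂'' ∈ Finset.univ.erase w'') =>
    div_nonneg (t.τ₁_nonneg (θ w).1 ((θ w).2.1 w') ((θ w).2.2.1 (w', w₂''))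
        ((θ w).2.2.2 k).1 ((((θ w).2.2.2 k).2 w').1 ((((θ w).2.2.2 k).2 w').2 y₁)) y) hc₁.le
  have n2 := fun w₂'' k₂ => div_nonneg (t.τ₂_nonneg (θ w).1 ((θ w).2.1 w')
    ((θ w).2.2.1 (w', w₂'')) ((θ w).2.2.2 k₂).1
          ((((θ w).2.2.2 k₂).2 w').1 ((((θ w).2.2.2 k).2 w').2 y₁)) y) hc₂.le
  have n3 := fun k₂ (_ : k₂ ∈ Finset.univ.erase k) => div_nonneg (t.τ₃_nonneg (θ w).1
    ((θ w).2.1 w') ((θ w).2.2.1 (w', w'')) ((θ w).2.2.2 k₂).1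
          ((((θ w).2.2.2 k₂).2 w').1 ((((θ w).2.2.2 k).2 w').2 y₁)) y) hc₃.le
  have n4 := fun w₂ w₂'' k₂ => div_nonneg (t.τ₄_nonneg (θ w₂).1 ((θ w₂).2.1 w')
    ((θ w₂).2.2.1 (w', w₂'')) ((θ w₂).2.2.2 k₂).1
          ((((θ w₂).2.2.2 k₂).2 w').1 ((((θ w).2.2.2 k).2 w').2 y₁)) y) hc₄.le
  have s0 := Finset.sum_nonneg n0
  have s1 := Finset.sum_nonneg n1
  have n2' := fun w₂'' (_ : w₂'' ∈ Finset.univ.erase w'') =>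
    Finset.sum_nonneg fun k₂ (_ : k₂ ∈ Finset.univ.erase k) => n2 w₂'' k₂
  have s2 := Finset.sum_nonneg n2'
  have s3 := Finset.sum_nonneg n3
  have n4'' := fun w₂ w₂'' => Finset.sum_nonneg fun k₂ (_ : k₂ ∈ Finset.univ) => n4 w₂ w₂'' k₂
  have n4' := fun w₂ (_ : w₂ ∈ Finset.univ.erase w) =>
    Finset.sum_nonneg fun w₂'' (_ : w₂'' ∈ Finset.univ) => n4'' w₂ w₂''
  have s4 := Finset.sum_nonneg n4'
  have one : ∀ {c τ : ℝ}, 0 < c → c < τ → 1 ≤ τ / c := fun hc h => by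
    rw [le_div_iff₀ hc]; linarith
  set T := ind (¬ (c₀ < t.τ₀ (θ w).1 ((θ w).2.1 w') ((θ w).2.2.2 k).1 y₁ ∧
        t.Pass c₁ c₂ c₃ c₄ (θ w).1 ((θ w).2.1 w') ((θ w).2.2.1 (w', w''))
          ((θ w).2.2.2 k).1 ((((θ w).2.2.2 k).2 w').1 ((((θ w).2.2.2 k).2 w').2 y₁)) y)) with hT
  have sT : 0 ≤ T := ind_nonneg _
  by_cases hgood : (treeBlock t c₀ c₁ c₂ c₃ c₄ e θ).Good w w' w'' k y y₁
  · rw [ind_false (not_not.2 hgood)]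
    linarith
  refine (ind_le_one _).trans ?_
  by_cases hT1 : c₀ < t.τ₀ (θ w).1 ((θ w).2.1 w') ((θ w).2.2.2 k).1 y₁ ∧
        t.Pass c₁ c₂ c₃ c₄ (θ w).1 ((θ w).2.1 w') ((θ w).2.2.1 (w', w''))
          ((θ w).2.2.2 k).1 ((((θ w).2.2.2 k).2 w').1 ((((θ w).2.2.2 k).2 w').2 y₁)) y
  swap
  · have : T = 1 := ind_true hT1
    linarith
  by_cases hA : ∃ w₂', w₂' ≠ w' ∧ c₀ < t.τ₀ (θ w).1 ((θ w).2.1 w₂') ((θ w).2.2.2 k).1 y₁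
  · obtain ⟨w₂', hne, h⟩ := hA
    have := (one hc₀ h).trans (Finset.single_le_sum n0 (Finset.mem_erase.2 ⟨hne, Finset.mem_univ _⟩))
    linarith
  push Not at hA
  have hB : ∃ w₂ w₂'' k₂, (w₂, w₂'', k₂) ≠ (w, w'', k) ∧
      t.Pass c₁ c₂ c₃ c₄ (θ w₂).1 ((θ w₂).2.1 w') ((θ w₂).2.2.1 (w', w₂''))
      ((θ w₂).2.2.2 k₂).1 ((((θ w₂).2.2.2 k₂).2 w').1 ((((θ w).2.2.2 k).2 w').2 y₁)) y := by
    by_contra! hB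
    exact hgood (treeBlock_good t e hT1.1 (fun w₂' hne => not_lt.2 (hA w₂' hne)) hT1.2 hB)
  obtain ⟨w₂, w₂'', k₂, hne, h1, h2, h3, h4⟩ := hB
  by_cases hw : w₂ = w
  swap
  · have := (one hc₄ h4).trans (Finset.single_le_sum (fun k₂ _ => n4 w₂ w₂'' k₂)
      (Finset.mem_univ k₂))
    have := this.trans (Finset.single_le_sum (fun w₂'' _ => n4'' w₂ w₂'') (Finset.mem_univ w₂''))
    have := this.trans (Finset.single_le_sum n4' (Finset.mem_erase.2 ⟨hw, Finset.mem_univ _⟩))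
    linarith
  subst hw
  by_cases hw'' : w₂'' = w''
  · subst hw''
    have hk : k₂ ≠ k := fun hk => hne (by rw [hk])
    have := (one hc₃ h3).trans (Finset.single_le_sum n3 (Finset.mem_erase.2 ⟨hk, Finset.mem_univ _⟩))
    linarith
  by_cases hk : k₂ = k
  · subst hk
    have := (one hc₁ h1).trans (Finset.single_le_sum n1
      (Finset.mem_erase.2 ⟨hw'', Finset.mem_univ _⟩))
    linarith
  · have := (one hc₂ h2).trans (Finset.single_le_sum (fun k₂ _ => n2 w₂'' k₂)
      (Finset.mem_erase.2 ⟨hk, Finset.mem_univ _⟩))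
    have := this.trans (Finset.single_le_sum n2' (Finset.mem_erase.2 ⟨hw'', Finset.mem_univ _⟩))
    linarith

variable [DecidableEq Y₁] [DecidableEq K']
  {C : U → A → X₁ → (K' → V) × (Y₁ → K') → ℝ}
  (hC : ∀ u a x₁, C u a x₁ ∈ stdSimplex ℝ _)
  (hCr : ∀ u a x₁ k φ, mean (C u a x₁) (fun c => φ (c.1 k)) = mean (t.r u a x₁) φ)
  {κ : U → A → X₁ → Y₁ → ℝ}
  (hCκ : ∀ u a x₁ y₁ (φ : V → ℝ) (b : ℝ), (∀ v, 0 ≤ φ v) → (∀ v, φ v ≤ b) →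
    mean (C u a x₁) (fun c => φ (c.1 (c.2 y₁))) ≤ mean (t.pV u a x₁ y₁) φ + b * κ u a x₁ y₁)
include hC hCr hCκ

/-- The probability that a random block fails: the right words fail a test, the description selected
by the relay is atypical (`κ`), or some wrong words pass, where the number of wrong words of each
kind is divided by the threshold of their test. -/
theorem mean_treeBlock_not_good_le (hc₀ : 0 < c₀) (hc₁ : 0 < c₁) (hc₂ : 0 < c₂) (hc₃ : 0 < c₃)
    (hc₄ : 0 < c₄) (w : W) (w' : W') (w'' : W'') (k : K) :
    mean (prodLaw fun _ : W => treeLaw E C) (fun θ : W → Tree U A X X₁ Y₁ V W' K W'' K' =>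
      mean (E.Q ((treeBlock t c₀ c₁ c₂ c₃ c₄ e θ).enc w w' w'')
        ((treeBlock t c₀ c₁ c₂ c₃ c₄ e θ).inp w k)) fun o =>
        ind (¬ (treeBlock t c₀ c₁ c₂ c₃ c₄ e θ).Good w w' w'' k (E.outY o) (E.outY₁ o))) ≤
      t.avg (fun u a x x₁ o v => ind (¬ (c₀ < t.τ₀ u a x₁ (E.outY₁ o) ∧
        t.Pass c₁ c₂ c₃ c₄ u a x x₁ v (E.outY o)))) +
      t.avg (fun u a _ x₁ o _ => κ u a x₁ (E.outY₁ o)) +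
      ((Fintype.card W' - 1 : ℕ) : ℝ) / c₀ + ((Fintype.card W'' - 1 : ℕ) : ℝ) / c₁ +
      ((Fintype.card W'' - 1 : ℕ) : ℝ) * ((Fintype.card K - 1 : ℕ) : ℝ) / c₂ +
      ((Fintype.card K - 1 : ℕ) : ℝ) / c₃ +
      ((Fintype.card W - 1 : ℕ) : ℝ) * Fintype.card W'' * Fintype.card K / c₄ := by
  have hG := prodLaw_mem (fun _ : W => treeLaw_mem (W' := W') (K := K) (W'' := W'') (E := E) hC)
  refine (mean_mono hG fun θ => mean_mono (E.Q_mem _ _) fun o =>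
    ind_not_good_le t e hc₀ hc₁ hc₂ hc₃ hc₄ θ w w' w'' k (E.outY o) (E.outY₁ o)).trans ?_
  simp only [mean_add, mean_sum, mean_div]
  have one := fun (F : Tree U A X X₁ Y₁ V W' K W'' K' → ℝ) =>
    mean_prodLaw_one (p := fun _ : W => treeLaw E C) (fun _ => treeLaw_mem hC) w F
  have card : ∀ {N : ℕ} {c S : ℝ}, 0 < c → S ≤ N → S / c ≤ (N : ℝ) / c := fun hc h => by gcongr
  refine add_le_add (add_le_add (add_le_add (add_le_add (add_le_add ?_ ?_) ?_) ?_) ?_) ?_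
  · have h := mean_tree_true t hC hCκ w' w'' k
      (F := fun u a x x₁ o v => ind (¬ (c₀ < t.τ₀ u a x₁ (E.outY₁ o) ∧
        t.Pass c₁ c₂ c₃ c₄ u a x x₁ v (E.outY o)))) (b := 1)
      (fun _ _ _ _ _ _ => ind_nonneg _) (fun _ _ _ _ _ _ => ind_le_one _)
    rw [one_mul] at h
    exact (one _).trans_le h
  · rw [← Finset.sum_div]
    refine card hc₀ (sum_le_card_of_le_one (by simp) fun w₂' h => ?_)
    exact (one _).trans_le (mean_tree_wrong_a t hC (Finset.ne_of_mem_erase h) w'' k)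
  · rw [← Finset.sum_div]
    refine card hc₁ (sum_le_card_of_le_one (by simp) fun w₂'' h => ?_)
    exact (one _).trans_le (mean_tree_wrong_x t hC w' (Finset.ne_of_mem_erase h) k)
  · simp only [← Finset.sum_div]
    rw [← Nat.cast_mul, ← Finset.sum_product']
    refine card hc₂ (sum_le_card_of_le_one (by simp) fun j h => ?_)
    rw [Finset.mem_product] at h
    exact (one _).trans_le (mean_tree_wrong_x_x₁ t hC hCr w' (Finset.ne_of_mem_erase h.1)
      (Finset.ne_of_mem_erase h.2))
  · rw [← Finset.sum_div]
    refine card hc₃ (sum_le_card_of_le_one (by simp) fun k₂ h => ?_)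
    exact (one _).trans_le (mean_tree_wrong_x₁ t hC hCr w' w'' (Finset.ne_of_mem_erase h))
  · simp only [← Finset.sum_div]
    rw [← Nat.cast_mul, ← Nat.cast_mul]
    simp only [← Finset.sum_product']
    refine card hc₄ (sum_le_card_of_le_one (by simp [mul_assoc]) fun j h => ?_)
    rw [Finset.mem_product] at h
    exact mean_tree_wrong_u t hC hCr (Finset.ne_of_mem_erase h.1) w' w'' j.2.1 k j.2.2

omit hCr in
/-- On the event of success the estimator sees the words sent, so that the cost is almost that of
the ensemble. -/
theorem mean_treeBlock_cost_le {δ : O → Shat → ℝ} {b : ℝ} (hδ : ∀ o s, 0 ≤ δ o s)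
    (hδb : ∀ o s, δ o s ≤ b) (w : W) (w' : W') (w'' : W'') (k : K) :
    mean (prodLaw fun _ : W => treeLaw E C) (fun θ : W → Tree U A X X₁ Y₁ V W' K W'' K' =>
      mean (E.Q ((treeBlock t c₀ c₁ c₂ c₃ c₄ e θ).enc w w' w'')
        ((treeBlock t c₀ c₁ c₂ c₃ c₄ e θ).inp w k)) fun o =>
        ind ((treeBlock t c₀ c₁ c₂ c₃ c₄ e θ).Good w w' w'' k (E.outY o) (E.outY₁ o)) *
          δ o ((treeBlock t c₀ c₁ c₂ c₃ c₄ e θ).est w'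
            ((treeBlock t c₀ c₁ c₂ c₃ c₄ e θ).out w k (E.outY₁ o)).2 (E.outY o))) ≤
      t.avg (fun u a x x₁ o v => δ o (e u a x x₁ v (E.outY o))) +
      b * t.avg (fun u a _ x₁ o _ => κ u a x₁ (E.outY₁ o)) := by
  have hG := prodLaw_mem (fun _ : W => treeLaw_mem (W' := W') (K := K) (W'' := W'') (E := E) hC)
  refine le_trans ?_ (mean_tree_true t hC hCκ w' w'' k
    (F := fun u a x x₁ o v => δ o (e u a x x₁ v (E.outY o))) (b := b)
    (fun _ _ _ _ _ _ => hδ _ _) (fun _ _ _ _ _ _ => hδb _ _))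
  rw [← mean_prodLaw_one (p := fun _ : W => treeLaw E C) (fun _ => treeLaw_mem hC) w
    (fun ν => mean (E.Q (ν.2.2.1 (w', w'')) (ν.2.2.2 k).1) fun o =>
        δ o (e ν.1 (ν.2.1 w') (ν.2.2.1 (w', w'')) (ν.2.2.2 k).1
          (((ν.2.2.2 k).2 w').1 (((ν.2.2.2 k).2 w').2 (E.outY₁ o))) (E.outY o)))]
  refine mean_mono hG fun θ => mean_mono (E.Q_mem _ _) fun o => ?_
  by_cases h : (treeBlock t c₀ c₁ c₂ c₃ c₄ e θ).Good w w' w'' k (E.outY o) (E.outY₁ o)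
  swap
  · rw [ind_false h, zero_mul]; exact hδ _ _
  rw [ind_true h, one_mul]
  have h1 := h.1
  have h2 := h.2
  simp only [treeBlock] at h1 h2 ⊢
  rw [h1] at h2 ⊢
  rw [h2]

end OneShot

/-! ### Codebooks of descriptions -/

section Codebook

variable {V K Y₁ : Type*} [Fintype V] [Fintype K] [Fintype Y₁] [DecidableEq K] [DecidableEq Y₁]

/-- The law of a codebook drawn from `r`, together with the index selected for every `y₁`
according to the conditional law `s`. -/
def codebookLaw (r : V → ℝ) (s : (K → V) → Y₁ → K → ℝ) : (K → V) × (Y₁ → K) → ℝ :=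
  pairLaw (prodLaw fun _ => r) fun cb => prodLaw (s cb)

variable {r : V → ℝ} {s : (K → V) → Y₁ → K → ℝ}

lemma codebookLaw_mem (hr : r ∈ stdSimplex ℝ V) (hs : ∀ cb y₁, s cb y₁ ∈ stdSimplex ℝ K) :
    codebookLaw r s ∈ stdSimplex ℝ _ :=
  pairLaw_mem (prodLaw_mem fun _ => hr) fun _ => prodLaw_mem fun _ => hs _ _

lemma mean_codebookLaw_word (hr : r ∈ stdSimplex ℝ V) (hs : ∀ cb y₁, s cb y₁ ∈ stdSimplex ℝ K)
    (k : K) (φ : V → ℝ) : mean (codebookLaw r s) (fun c => φ (c.1 k)) = mean r φ := by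
  rw [codebookLaw, mean_pairLaw]
  simp only [mean_const (prodLaw_mem fun y₁ => hs _ y₁)]
  exact mean_prodLaw_one (p := fun _ : K => r) (fun _ => hr) k φ

lemma mean_codebookLaw_selected (hs : ∀ cb y₁, s cb y₁ ∈ stdSimplex ℝ K) (y₁ : Y₁) (φ : V → ℝ) :
    mean (codebookLaw r s) (fun c => φ (c.1 (c.2 y₁))) =
      mean (prodLaw fun _ : K => r) fun cb => mean (s cb y₁) fun k => φ (cb k) := by
  rw [codebookLaw, mean_pairLaw]
  congr 1; funext cb
  exact mean_prodLaw_one (hs cb) y₁ (fun k => φ (cb k))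

end Codebook

lemma mean_equiv {α β : Type*} [Fintype α] [Fintype β] (e : α ≃ β) (p f : α → ℝ) :
    mean (p ∘ e.symm) (f ∘ e.symm) = mean p f :=
  Fintype.sum_equiv e.symm _ _ fun _ => rfl

lemma comp_equiv_mem {α β : Type*} [Fintype α] [Fintype β] (e : α ≃ β) {p : α → ℝ}
    (hp : p ∈ stdSimplex ℝ α) : p ∘ e.symm ∈ stdSimplex ℝ β :=
  ⟨fun _ => hp.1 _, (Fintype.sum_equiv e.symm _ _ fun _ => rfl).trans hp.2⟩

/-- There is a random block code whose probability of failure is at most `ε`, and whose cost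
(the mean of `δ` on the event of success) is at most `c`, for every state and all messages. -/
def HasBlocks {X X₁ O Y Y₁ Shat : Type*} [Fintype O] (Q : X → X₁ → O → ℝ) (outY : O → Y)
    (outY₁ : O → Y₁) (δ : O → Shat → ℝ) (W K W' K' W'' : Type*) (ε c : ℝ) : Prop :=
  ∃ (N : ℕ) (p : Fin N → ℝ) (B : Fin N → Block X X₁ Y Y₁ Shat W K W' K' W''),
    p ∈ stdSimplex ℝ (Fin N) ∧ ∀ w w' w'' k,
      mean p (fun i => mean (Q ((B i).enc w w' w'') ((B i).inp w k)) fun o =>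
        ind (¬ (B i).Good w w' w'' k (outY o) (outY₁ o))) ≤ ε ∧
      mean p (fun i => mean (Q ((B i).enc w w' w'') ((B i).inp w k)) fun o =>
        ind ((B i).Good w w' w'' k (outY o) (outY₁ o)) *
          δ o ((B i).est w' ((B i).out w k (outY₁ o)).2 (outY o))) ≤ c

section

variable {U A X X₁ O Y Y₁ V Shat : Type*}
  [Fintype U] [Fintype A] [Fintype X] [Fintype X₁] [Fintype O] [Fintype V] [Fintype Y₁]
  {E : Ensemble U A X X₁ O Y Y₁}

set_option synthInstance.maxSize 1000 in
/-- The one-shot coding theorem for a block. If `pV = r`, then no description has to be selected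
and there is no covering error. -/
theorem hasBlocks_of_description (t : Description E V) (e : U → A → X → X₁ → V → Y → Shat)
    {δ : O → Shat → ℝ} {b : ℝ} (hδ : ∀ o s, 0 ≤ δ o s) (hδb : ∀ o s, δ o s ≤ b)
    {c₀ c₁ c₂ c₃ c₄ c κ : ℝ}
    (hc₀ : 0 < c₀) (hc₁ : 0 < c₁) (hc₂ : 0 < c₂) (hc₃ : 0 < c₃) (hc₄ : 0 < c₄) (hc : 0 ≤ c)
    (hκ : 0 ≤ κ) (hb : 0 ≤ b) {W K W' K' W'' : ℕ} (hW : W ≠ 0) (hK : K ≠ 0) (hW' : W' ≠ 0)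
    (hK' : K' ≠ 0) (hW'' : W'' ≠ 0)
    (hcover : (∀ u a x₁ y₁, t.pV u a x₁ y₁ = t.r u a x₁) ∨
      t.avg (fun u a _ x₁ o v => ind (¬ t.pV u a x₁ (E.outY₁ o) v ≤ c * t.r u a x₁ v)) +
        √(c / K') ≤ κ) :
    HasBlocks E.Q E.outY E.outY₁ δ (Fin W) (Fin K) (Fin W') (Fin K') (Fin W'')
      (t.avg (fun u a x x₁ o v => ind (¬ (c₀ < t.τ₀ u a x₁ (E.outY₁ o) ∧
        t.Pass c₁ c₂ c₃ c₄ u a x x₁ v (E.outY o)))) + κ +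
      ((W' - 1 : ℕ) : ℝ) / c₀ + ((W'' - 1 : ℕ) : ℝ) / c₁ +
      ((W'' - 1 : ℕ) : ℝ) * ((K - 1 : ℕ) : ℝ) / c₂ + ((K - 1 : ℕ) : ℝ) / c₃ +
      ((W - 1 : ℕ) : ℝ) * W'' * K / c₄)
      (t.avg (fun u a x x₁ o v => δ o (e u a x x₁ v (E.outY o))) + b * κ) := by
  classical
  have : Nonempty (Fin W) := ⟨⟨0, Nat.pos_of_ne_zero hW⟩⟩
  have : Nonempty (Fin K) := ⟨⟨0, Nat.pos_of_ne_zero hK⟩⟩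
  have : Nonempty (Fin W') := ⟨⟨0, Nat.pos_of_ne_zero hW'⟩⟩
  have : Nonempty (Fin K') := ⟨⟨0, Nat.pos_of_ne_zero hK'⟩⟩
  have : Nonempty (Fin W'') := ⟨⟨0, Nat.pos_of_ne_zero hW''⟩⟩
  obtain ⟨C, κ', hC, hCr, hCκ, hκ'⟩ : ∃ (C : U → A → X₁ → (Fin K' → V) × (Y₁ → Fin K') → ℝ)
      (κ' : U → A → X₁ → Y₁ → ℝ), (∀ u a x₁, C u a x₁ ∈ stdSimplex ℝ _) ∧
      (∀ u a x₁ k φ, mean (C u a x₁) (fun c => φ (c.1 k)) = mean (t.r u a x₁) φ) ∧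
      (∀ u a x₁ y₁ (φ : V → ℝ) (b : ℝ), (∀ v, 0 ≤ φ v) → (∀ v, φ v ≤ b) →
        mean (C u a x₁) (fun c => φ (c.1 (c.2 y₁))) ≤
          mean (t.pV u a x₁ y₁) φ + b * κ' u a x₁ y₁) ∧
      t.avg (fun u a _ x₁ o _ => κ' u a x₁ (E.outY₁ o)) ≤ κ := by
    rcases hcover with h | h
    · have hs : (fun _ => (1 / Fintype.card (Fin K') : ℝ)) ∈ stdSimplex ℝ (Fin K') := by
        refine ⟨fun _ => by positivity, ?_⟩
        simp [hK']
      refine ⟨fun u a x₁ => codebookLaw (t.r u a x₁) fun _ _ _ => 1 / Fintype.card (Fin K'),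
        fun _ _ _ _ => 0, fun u a x₁ => codebookLaw_mem (t.r_mem u a x₁) fun _ _ => hs,
        fun u a x₁ k φ => mean_codebookLaw_word (t.r_mem u a x₁) (fun _ _ => hs) k φ, ?_, ?_⟩
      · intro u a x₁ y₁ φ b _ _
        rw [mean_codebookLaw_selected (fun _ _ => hs), mean_comm]
        have : ∀ k, mean (prodLaw fun _ : Fin K' => t.r u a x₁) (fun cb => φ (cb k)) =
            mean (t.r u a x₁) φ := fun k =>
          mean_prodLaw_one (p := fun _ : Fin K' => t.r u a x₁) (fun _ => t.r_mem u a x₁) k φ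
        simp only [this]
        rw [mean_const hs, h]
        simp
      · rw [t.avg_const]; exact hκ
    · have hs := fun u a x₁ (cb : Fin K' → V) (y₁ : Y₁) =>
        likelihood_mem (t.r_mem u a x₁) (t.pV_mem u a x₁ y₁) cb
      refine ⟨fun u a x₁ => codebookLaw (t.r u a x₁) fun cb y₁ =>
          likelihood (t.r u a x₁) (t.pV u a x₁ y₁) cb,
        fun u a x₁ y₁ => mean (t.pV u a x₁ y₁)
          (fun v => ind (¬ t.pV u a x₁ y₁ v ≤ c * t.r u a x₁ v)) + √(c / Fintype.card (Fin K')),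
        fun u a x₁ => codebookLaw_mem (t.r_mem u a x₁) (hs u a x₁),
        fun u a x₁ k φ => mean_codebookLaw_word (t.r_mem u a x₁) (hs u a x₁) k φ, ?_, ?_⟩
      · intro u a x₁ y₁ φ b h0 hb'
        have hb0 : 0 ≤ b := by
          obtain ⟨v, -⟩ : ∃ v, t.r u a x₁ v ≠ 0 := by
            by_contra! hz
            have := (t.r_mem u a x₁).2
            simp [hz] at this
          exact (h0 v).trans (hb' v)
        rw [mean_codebookLaw_selected (hs u a x₁)]
        exact mean_likelihood_le (t.r_mem u a x₁) (t.pV_mem u a x₁ y₁) hc hb0 h0 hb'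
      · refine le_trans (le_of_eq ?_) h
        rw [t.avg_add, t.avg_const, Fintype.card_fin]
        congr 1
        simp only [Description.avg, mean_const (t.pV_mem _ _ _ _)]
  set G := prodLaw fun _ : Fin W => treeLaw (W' := Fin W') (K := Fin K) (W'' := Fin W'') E C
  have hG : G ∈ stdSimplex ℝ _ := prodLaw_mem fun _ => treeLaw_mem hC
  set f := Fintype.equivFin
    (Fin W → Tree U A X X₁ Y₁ V (Fin W') (Fin K) (Fin W'') (Fin K'))
  refine ⟨_, G ∘ f.symm, fun i => treeBlock t c₀ c₁ c₂ c₃ c₄ e (f.symm i), comp_equiv_mem f hG,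
    fun w w' w'' k => ⟨?_, ?_⟩⟩
  · have h1 := mean_treeBlock_not_good_le t e hC hCr hCκ hc₀ hc₁ hc₂ hc₃ hc₄ w w' w'' k
    rw [← mean_equiv f] at h1
    simp only [Fintype.card_fin] at h1
    refine h1.trans ?_
    gcongr
  · have h1 := mean_treeBlock_cost_le t (c₀ := c₀) (c₁ := c₁) (c₂ := c₂) (c₃ := c₃) (c₄ := c₄)
      e hC hCκ hδ hδb w w' w'' k
    rw [← mean_equiv f] at h1
    refine h1.trans ?_
    gcongr

end

/-! ### Memoryless extensions -/

lemma mean_prodLaw_prod {ι : Type*} [Fintype ι] [DecidableEq ι] {α : ι → Type*}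
    [∀ i, Fintype (α i)] (p : ∀ i, α i → ℝ) (f : ∀ i, α i → ℝ) :
    mean (prodLaw p) (fun ω => ∏ i, f i (ω i)) = ∏ i, mean (p i) (f i) := by
  simp only [mean, prodLaw, ← Finset.prod_mul_distrib]
  exact sum_pi_prod fun i a => p i a * f i a

lemma mean_prodLaw_pairLaw {ι : Type*} [Fintype ι] [DecidableEq ι] {α β : Type*}
    [Fintype α] [Fintype β] (p : ι → α → ℝ) (q : ι → α → β → ℝ) (F : (ι → α × β) → ℝ) :
    mean (prodLaw fun i => pairLaw (p i) (q i)) F =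
      mean (prodLaw p) fun a => mean (prodLaw fun i => q i (a i)) fun b =>
        F fun i => (a i, b i) := by
  simp only [mean, Finset.mul_sum]
  rw [← Fintype.sum_prod_type']
  refine Fintype.sum_equiv (Equiv.arrowProdEquivProdArrow ι (fun _ => α) (fun _ => β)) _ _
    fun ω => ?_
  simp only [prodLaw, pairLaw, Finset.prod_mul_distrib, Equiv.arrowProdEquivProdArrow_apply,
    mul_assoc]

lemma prod_le_one_of_mean {ι : Type*} [Fintype ι] {s : ι → ℝ} (h0 : ∀ i, 0 ≤ s i)
    (h1 : ∀ i, s i ≤ 1) : ∏ i, s i ≤ 1 := Finset.prod_le_one (fun i _ => h0 i) fun i _ => h1 i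

section Power

variable {U A X X₁ O Y Y₁ V : Type*} [Fintype U] [Fintype A] [Fintype X] [Fintype X₁] [Fintype O]
  [Fintype V]

/-- The memoryless extension of an ensemble to words of length `m`. -/
def Ensemble.pow (E : Ensemble U A X X₁ O Y Y₁) (m : ℕ) :
    Ensemble (Fin m → U) (Fin m → A) (Fin m → X) (Fin m → X₁) (Fin m → O) (Fin m → Y)
      (Fin m → Y₁) where
  pU := prodLaw fun _ => E.pU
  pA u := prodLaw fun i => E.pA (u i)
  pX u a := prodLaw fun i => E.pX (u i) (a i)
  pX₁ u := prodLaw fun i => E.pX₁ (u i)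
  Q x x₁ := prodLaw fun i => E.Q (x i) (x₁ i)
  outY o i := E.outY (o i)
  outY₁ o i := E.outY₁ (o i)
  pU_mem := prodLaw_mem fun _ => E.pU_mem
  pA_mem _ := prodLaw_mem fun _ => E.pA_mem _
  pX_mem _ _ := prodLaw_mem fun _ => E.pX_mem _ _
  pX₁_mem _ := prodLaw_mem fun _ => E.pX₁_mem _
  Q_mem _ _ := prodLaw_mem fun _ => E.Q_mem _ _

variable {E : Ensemble U A X X₁ O Y Y₁}

/-- The memoryless extension of a description; the test functions are products over the letters,
and inherit the bound on their means. -/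
def Description.pow (t : Description E V) (m : ℕ) : Description (E.pow m) (Fin m → V) where
  pV u a x₁ y₁ := prodLaw fun i => t.pV (u i) (a i) (x₁ i) (y₁ i)
  r u a x₁ := prodLaw fun i => t.r (u i) (a i) (x₁ i)
  pV_mem _ _ _ _ := prodLaw_mem fun _ => t.pV_mem _ _ _ _
  r_mem _ _ _ := prodLaw_mem fun _ => t.r_mem _ _ _
  τ₀ u a x₁ y₁ := ∏ i, t.τ₀ (u i) (a i) (x₁ i) (y₁ i)
  τ₁ u a x x₁ v y := ∏ i, t.τ₁ (u i) (a i) (x i) (x₁ i) (v i) (y i)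
  τ₂ u a x x₁ v y := ∏ i, t.τ₂ (u i) (a i) (x i) (x₁ i) (v i) (y i)
  τ₃ u a x x₁ v y := ∏ i, t.τ₃ (u i) (a i) (x i) (x₁ i) (v i) (y i)
  τ₄ u a x x₁ v y := ∏ i, t.τ₄ (u i) (a i) (x i) (x₁ i) (v i) (y i)
  τ₀_nonneg _ _ _ _ := Finset.prod_nonneg fun _ _ => t.τ₀_nonneg _ _ _ _
  τ₁_nonneg _ _ _ _ _ _ := Finset.prod_nonneg fun _ _ => t.τ₁_nonneg _ _ _ _ _ _
  τ₂_nonneg _ _ _ _ _ _ := Finset.prod_nonneg fun _ _ => t.τ₂_nonneg _ _ _ _ _ _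
  τ₃_nonneg _ _ _ _ _ _ := Finset.prod_nonneg fun _ _ => t.τ₃_nonneg _ _ _ _ _ _
  τ₄_nonneg _ _ _ _ _ _ := Finset.prod_nonneg fun _ _ => t.τ₄_nonneg _ _ _ _ _ _
  τ₀_mean u x₁ y₁ := by
    rw [show (E.pow m).pA u = prodLaw fun i => E.pA (u i) from rfl,
      mean_prodLaw_prod _ fun i a => t.τ₀ (u i) a (x₁ i) (y₁ i)]
    exact prod_le_one_of_mean (fun i => mean_nonneg (E.pA_mem _) fun _ => t.τ₀_nonneg _ _ _ _)
      fun i => t.τ₀_mean _ _ _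
  τ₁_mean u a x₁ v y := by
    rw [show (E.pow m).pX u a = prodLaw fun i => E.pX (u i) (a i) from rfl,
      mean_prodLaw_prod _ fun i x => t.τ₁ (u i) (a i) x (x₁ i) (v i) (y i)]
    exact prod_le_one_of_mean (fun i => mean_nonneg (E.pX_mem _ _) fun _ =>
      t.τ₁_nonneg _ _ _ _ _ _) fun i => t.τ₁_mean _ _ _ _ _
  τ₂_mean u a y := by
    have h1 := fun (x : Fin m → X) (x₁ : Fin m → X₁) => mean_prodLaw_prod (fun i => t.r (u i) (a i) (x₁ i))
      fun i v => t.τ₂ (u i) (a i) (x i) (x₁ i) v (y i)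
    simp only [h1]
    have h2 := fun (x : Fin m → X) => mean_prodLaw_prod (fun i => E.pX₁ (u i)) fun i x₁ =>
      mean (t.r (u i) (a i) x₁) fun v => t.τ₂ (u i) (a i) (x i) x₁ v (y i)
    simp only [Ensemble.pow, h2]
    rw [mean_prodLaw_prod (fun i => E.pX (u i) (a i)) fun i x => mean (E.pX₁ (u i)) fun x₁ =>
      mean (t.r (u i) (a i) x₁) fun v => t.τ₂ (u i) (a i) x x₁ v (y i)]
    exact prod_le_one_of_mean (fun i => mean_nonneg (E.pX_mem _ _) fun _ =>
      mean_nonneg (E.pX₁_mem _) fun _ => mean_nonneg (t.r_mem _ _ _) fun _ =>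
        t.τ₂_nonneg _ _ _ _ _ _) fun i => t.τ₂_mean _ _ _
  τ₃_mean u a x y := by
    have h1 := fun (x₁ : Fin m → X₁) => mean_prodLaw_prod (fun i => t.r (u i) (a i) (x₁ i))
      fun i v => t.τ₃ (u i) (a i) (x i) (x₁ i) v (y i)
    simp only [h1]
    rw [show (E.pow m).pX₁ u = prodLaw fun i => E.pX₁ (u i) from rfl,
      mean_prodLaw_prod (fun i => E.pX₁ (u i)) fun i x₁ =>
      mean (t.r (u i) (a i) x₁) fun v => t.τ₃ (u i) (a i) (x i) x₁ v (y i)]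
    exact prod_le_one_of_mean (fun i => mean_nonneg (E.pX₁_mem _) fun _ =>
      mean_nonneg (t.r_mem _ _ _) fun _ => t.τ₃_nonneg _ _ _ _ _ _) fun i => t.τ₃_mean _ _ _ _
  τ₄_mean y := by
    have h1 := fun (u : Fin m → U) (a : Fin m → A) (x : Fin m → X) (x₁ : Fin m → X₁) => mean_prodLaw_prod (fun i => t.r (u i) (a i) (x₁ i))
      fun i v => t.τ₄ (u i) (a i) (x i) (x₁ i) v (y i)
    simp only [h1]
    have h2 := fun (u : Fin m → U) (a : Fin m → A) (x : Fin m → X) => mean_prodLaw_prod (fun i => E.pX₁ (u i)) fun i x₁ =>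
      mean (t.r (u i) (a i) x₁) fun v => t.τ₄ (u i) (a i) (x i) x₁ v (y i)
    simp only [Ensemble.pow, h2]
    have h3 := fun (u : Fin m → U) (a : Fin m → A) => mean_prodLaw_prod (fun i => E.pX (u i) (a i)) fun i x =>
      mean (E.pX₁ (u i)) fun x₁ =>
      mean (t.r (u i) (a i) x₁) fun v => t.τ₄ (u i) (a i) x x₁ v (y i)
    simp only [h3]
    have h4 := fun (u : Fin m → U) => mean_prodLaw_prod (fun i => E.pA (u i)) fun i a =>
      mean (E.pX (u i) a) fun x => mean (E.pX₁ (u i)) fun x₁ =>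
      mean (t.r (u i) a x₁) fun v => t.τ₄ (u i) a x x₁ v (y i)
    simp only [h4]
    rw [mean_prodLaw_prod (fun _ => E.pU) fun i u => mean (E.pA u) fun a =>
      mean (E.pX u a) fun x => mean (E.pX₁ u) fun x₁ =>
      mean (t.r u a x₁) fun v => t.τ₄ u a x x₁ v (y i)]
    exact prod_le_one_of_mean (fun i => mean_nonneg E.pU_mem fun _ => mean_nonneg (E.pA_mem _)
      fun _ => mean_nonneg (E.pX_mem _ _) fun _ =>
      mean_nonneg (E.pX₁_mem _) fun _ => mean_nonneg (t.r_mem _ _ _) fun _ =>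
        t.τ₄_nonneg _ _ _ _ _ _) fun i => t.τ₄_mean _

/-- The joint law of `(U, A, X, X₁, O, V)`. -/
def Description.law (t : Description E V) : U × A × X × X₁ × O × V → ℝ :=
  pairLaw E.pU fun u => pairLaw (E.pA u) fun a => pairLaw (E.pX u a) fun x =>
    pairLaw (E.pX₁ u) fun x₁ => pairLaw (E.Q x x₁) fun o => t.pV u a x₁ (E.outY₁ o)

lemma Description.law_mem (t : Description E V) : t.law ∈ stdSimplex ℝ _ :=
  pairLaw_mem E.pU_mem fun _ => pairLaw_mem (E.pA_mem _) fun _ => pairLaw_mem (E.pX_mem _ _)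
    fun _ => pairLaw_mem (E.pX₁_mem _) fun _ => pairLaw_mem (E.Q_mem _ _) fun _ => t.pV_mem _ _ _ _

/-- A function of six variables as a function on the sample space. -/
def onTuple {R : Type*} (F : U → A → X → X₁ → O → V → R) (ω : U × A × X × X₁ × O × V) : R :=
  F ω.1 ω.2.1 ω.2.2.1 ω.2.2.2.1 ω.2.2.2.2.1 ω.2.2.2.2.2

lemma Description.avg_eq_mean (t : Description E V) (F : U → A → X → X₁ → O → V → ℝ) :
    t.avg F = mean t.law (onTuple F) := by
  simp only [Description.law, mean_pairLaw, Description.avg, onTuple]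

lemma Description.avg_pow (t : Description E V) (m : ℕ)
    (F : (Fin m → U) → (Fin m → A) → (Fin m → X) → (Fin m → X₁) → (Fin m → O) → (Fin m → V) → ℝ) :
    (t.pow m).avg F = mean (prodLaw fun _ : Fin m => t.law) fun ω =>
      F (fun i => (ω i).1) (fun i => (ω i).2.1) (fun i => (ω i).2.2.1) (fun i => (ω i).2.2.2.1)
        (fun i => (ω i).2.2.2.2.1) (fun i => (ω i).2.2.2.2.2) := by
  simp only [Description.law, mean_prodLaw_pairLaw, Description.avg]
  rfl

/-- The mean of a sum over the letters. -/
lemma Description.avg_pow_sum (t : Description E V) (m : ℕ) (f : U → A → X → X₁ → O → V → ℝ) :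
    (t.pow m).avg (fun u a x x₁ o v => ∑ i, f (u i) (a i) (x i) (x₁ i) (o i) (v i)) =
      m * t.avg f := by
  rw [t.avg_pow, mean_sum]
  have : ∀ i : Fin m, mean (prodLaw fun _ : Fin m => t.law) (fun ω => onTuple f (ω i)) =
      mean t.law (onTuple f) := fun i =>
    mean_prodLaw_one (p := fun _ : Fin m => t.law) (fun _ => t.law_mem) i (onTuple f)
  rw [t.avg_eq_mean]
  refine (Finset.sum_congr rfl fun i _ => this i).trans ?_
  simp

end Power

/-! ### Typicality -/

lemma mean_mono_of_pos {α : Type*} [Fintype α] {p f g : α → ℝ} (hp : p ∈ stdSimplex ℝ α)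
    (h : ∀ a, 0 < p a → f a ≤ g a) : mean p f ≤ mean p g := by
  refine Finset.sum_le_sum fun a _ => ?_
  rcases (hp.1 a).eq_or_lt with h0 | h0
  · simp [← h0]
  · exact mul_le_mul_of_nonneg_left (h a h0) h0.le

/-- The product of i.i.d. positive variables `τ` is at least `2 ^ (m * (μ - η))` with high
probability, where `μ` is the mean of the logarithm. -/
lemma exists_prod_tail_bound {β : Type*} [Fintype β] {p : β → ℝ} (hp : p ∈ stdSimplex ℝ β)
    (τ : β → ℝ) (hτ : ∀ b, 0 < p b → 0 < τ b) :
    ∃ C : ℝ, 0 ≤ C ∧ ∀ (m : ℕ) (η : ℝ), 0 < m → 0 < η →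
      mean (prodLaw fun _ : Fin m => p) (fun ω => ind (∏ i, τ (ω i) ≤
        2 ^ (m * (mean p (fun b => Real.logb 2 (τ b)) - η)))) ≤ C / (m * η ^ 2) := by
  obtain ⟨C, hC, h⟩ := exists_tail_bound hp fun b => Real.logb 2 (τ b)
  refine ⟨C, hC, fun m η hm hη => le_trans ?_ (h m η hm hη)⟩
  refine mean_mono_of_pos (prodLaw_mem fun _ => hp) fun ω hω => ind_mono fun hle => ?_
  have hpos : ∀ i, 0 < τ (ω i) := by
    intro i
    refine hτ _ (lt_of_le_of_ne (hp.1 _) fun h0 => hω.ne' ?_)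
    exact Finset.prod_eq_zero (Finset.mem_univ i) h0.symm
  rw [← Real.logb_prod _ _ fun i _ => (hpos i).ne']
  have := Real.logb_le_logb_of_le (b := 2) (by norm_num) (Finset.prod_pos fun i _ => hpos i) hle
  rwa [Real.logb_rpow (by norm_num) (by norm_num)] at this

section Asymptotics

variable {U A X X₁ O Y Y₁ V Shat : Type*}
  [Fintype U] [Fintype A] [Fintype X] [Fintype X₁] [Fintype O] [Fintype V]
  {E : Ensemble U A X X₁ O Y Y₁}

/-- The exponent of the test of `a` at the relay. -/
noncomputable def Description.rate₀ (t : Description E V) : ℝ :=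
  t.avg fun u a _ x₁ o _ => Real.logb 2 (t.τ₀ u a x₁ (E.outY₁ o))

/-- The exponent of the test of `x`. -/
noncomputable def Description.rate₁ (t : Description E V) : ℝ :=
  t.avg fun u a x x₁ o v => Real.logb 2 (t.τ₁ u a x x₁ v (E.outY o))

/-- The exponent of the test of `x, x₁, v`. -/
noncomputable def Description.rate₂ (t : Description E V) : ℝ :=
  t.avg fun u a x x₁ o v => Real.logb 2 (t.τ₂ u a x x₁ v (E.outY o))

/-- The exponent of the test of `x₁, v`. -/
noncomputable def Description.rate₃ (t : Description E V) : ℝ :=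
  t.avg fun u a x x₁ o v => Real.logb 2 (t.τ₃ u a x x₁ v (E.outY o))

/-- The exponent of the test of all the words. -/
noncomputable def Description.rate₄ (t : Description E V) : ℝ :=
  t.avg fun u a x x₁ o v => Real.logb 2 (t.τ₄ u a x x₁ v (E.outY o))

/-- The rate needed to cover the relay's observation by descriptions. -/
noncomputable def Description.rateV (t : Description E V) : ℝ :=
  t.avg fun u a _ x₁ o v => Real.logb 2 (t.pV u a x₁ (E.outY₁ o) v / t.r u a x₁ v)

/-- The test functions, `pV` and `r` are positive on the support of the joint law. -/
structure Description.Regular (t : Description E V) : Prop where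
  pV_pos : ∀ u a x x₁ o v, 0 < t.law (u, a, x, x₁, o, v) → 0 < t.pV u a x₁ (E.outY₁ o) v
  r_pos : ∀ u a x x₁ o v, 0 < t.law (u, a, x, x₁, o, v) → 0 < t.r u a x₁ v
  τ₀_pos : ∀ u a x x₁ o v, 0 < t.law (u, a, x, x₁, o, v) → 0 < t.τ₀ u a x₁ (E.outY₁ o)
  τ₁_pos : ∀ u a x x₁ o v, 0 < t.law (u, a, x, x₁, o, v) → 0 < t.τ₁ u a x x₁ v (E.outY o)
  τ₂_pos : ∀ u a x x₁ o v, 0 < t.law (u, a, x, x₁, o, v) → 0 < t.τ₂ u a x x₁ v (E.outY o)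
  τ₃_pos : ∀ u a x x₁ o v, 0 < t.law (u, a, x, x₁, o, v) → 0 < t.τ₃ u a x x₁ v (E.outY o)
  τ₄_pos : ∀ u a x x₁ o v, 0 < t.law (u, a, x, x₁, o, v) → 0 < t.τ₄ u a x x₁ v (E.outY o)

/-- A letterwise product of positive variables is exponentially large with high probability. -/
lemma Description.exists_avg_pow_tail (t : Description E V) (f : U → A → X → X₁ → O → V → ℝ)
    (hf : ∀ u a x x₁ o v, 0 < t.law (u, a, x, x₁, o, v) → 0 < f u a x x₁ o v) :
    ∃ C : ℝ, 0 ≤ C ∧ ∀ (m : ℕ) (η : ℝ), 0 < m → 0 < η →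
      (t.pow m).avg (fun u a x x₁ o v => ind (∏ i, f (u i) (a i) (x i) (x₁ i) (o i) (v i) ≤
        2 ^ (m * (t.avg (fun u a x x₁ o v => Real.logb 2 (f u a x x₁ o v)) - η)))) ≤
      C / (m * η ^ 2) := by
  obtain ⟨C, hC, h⟩ := exists_prod_tail_bound t.law_mem (onTuple f)
    (fun ω hω => hf _ _ _ _ _ _ hω)
  refine ⟨C, hC, fun m η hm hη => le_trans (le_of_eq ?_) (h m η hm hη)⟩
  rw [t.avg_pow, t.avg_eq_mean]
  rfl

variable [Fintype Y₁]

/-- Good blocks exist if the numbers of messages and states are below the exponents of the tests,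
and the number of descriptions is above the covering rate. -/
theorem eventually_hasBlocks (t : Description E V) (ht : t.Regular)
    (e : U → A → X → X₁ → V → Y → Shat) {δ : O → Shat → ℝ} {b : ℝ} (hb : 0 ≤ b)
    (hδ : ∀ o s, 0 ≤ δ o s) (hδb : ∀ o s, δ o s ≤ b) {η ε : ℝ} (hη : 0 < η) (hε : 0 < ε) :
    ∀ᶠ m : ℕ in atTop, ∀ W K W' K' W'' : ℕ, W ≠ 0 → K ≠ 0 → W' ≠ 0 → K' ≠ 0 → W'' ≠ 0 →
      ((W' - 1 : ℕ) : ℝ) ≤ 2 ^ (m * (t.rate₀ - 2 * η)) →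
      ((W'' - 1 : ℕ) : ℝ) ≤ 2 ^ (m * (t.rate₁ - 2 * η)) →
      ((W'' - 1 : ℕ) : ℝ) * ((K - 1 : ℕ) : ℝ) ≤ 2 ^ (m * (t.rate₂ - 2 * η)) →
      ((K - 1 : ℕ) : ℝ) ≤ 2 ^ (m * (t.rate₃ - 2 * η)) →
      ((W - 1 : ℕ) : ℝ) * W'' * K ≤ 2 ^ (m * (t.rate₄ - 2 * η)) →
      ((∀ u a x₁ y₁, t.pV u a x₁ y₁ = t.r u a x₁) ∨
        (2 : ℝ) ^ (m * (t.rateV + 2 * η)) ≤ K') →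
      HasBlocks (E.pow m).Q (E.pow m).outY (E.pow m).outY₁
        (fun o (s : Fin m → Shat) => ∑ i, δ (o i) (s i))
        (Fin W) (Fin K) (Fin W') (Fin K') (Fin W'') ε
        (m * (t.avg (fun u a x x₁ o v => δ o (e u a x x₁ v (E.outY o))) + ε)) := by
  classical
  obtain ⟨C₀, hC₀, h₀⟩ := t.exists_avg_pow_tail (fun u a x x₁ o v => t.τ₀ u a x₁ (E.outY₁ o))
    ht.τ₀_pos
  obtain ⟨C₁, hC₁, h₁⟩ := t.exists_avg_pow_tail (fun u a x x₁ o v => t.τ₁ u a x x₁ v (E.outY o))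
    ht.τ₁_pos
  obtain ⟨C₂, hC₂, h₂⟩ := t.exists_avg_pow_tail (fun u a x x₁ o v => t.τ₂ u a x x₁ v (E.outY o))
    ht.τ₂_pos
  obtain ⟨C₃, hC₃, h₃⟩ := t.exists_avg_pow_tail (fun u a x x₁ o v => t.τ₃ u a x x₁ v (E.outY o))
    ht.τ₃_pos
  obtain ⟨C₄, hC₄, h₄⟩ := t.exists_avg_pow_tail (fun u a x x₁ o v => t.τ₄ u a x x₁ v (E.outY o))
    ht.τ₄_pos
  -- the upper tail of `pV / r` is the lower tail of `r / pV`
  obtain ⟨C₅, hC₅, h₅⟩ := t.exists_avg_pow_tail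
    (fun u a x x₁ o v => t.r u a x₁ v / t.pV u a x₁ (E.outY₁ o) v)
    (fun u a x x₁ o v h => div_pos (ht.r_pos u a x x₁ o v h) (ht.pV_pos u a x x₁ o v h))
  have hrV : t.avg (fun u a x x₁ o v => Real.logb 2 (t.r u a x₁ v / t.pV u a x₁ (E.outY₁ o) v)) =
      -t.rateV := by
    rw [Description.rateV, ← neg_one_mul, ← t.avg_mul_left]
    congr 1; funext u a x x₁ o v
    rw [← inv_div, Real.logb_inv, neg_one_mul]
  have hlim : Tendsto (fun m : ℕ => (C₀ + C₁ + C₂ + C₃ + C₄ + C₅) / (m * η ^ 2) +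
      5 * (2 : ℝ) ^ (-(m * η)) + √((2 : ℝ) ^ (-(m * η)))) atTop (𝓝 0) := by
    have hm : Tendsto (fun m : ℕ => (m : ℝ) * η ^ 2) atTop atTop :=
      tendsto_natCast_atTop_atTop.atTop_mul_const (by positivity)
    have hm' : Tendsto (fun m : ℕ => (m : ℝ) * η) atTop atTop :=
      tendsto_natCast_atTop_atTop.atTop_mul_const hη
    have h1 := hm.const_div_atTop (C₀ + C₁ + C₂ + C₃ + C₄ + C₅)
    have h2 : Tendsto (fun m : ℕ => (2 : ℝ) ^ (-(m * η))) atTop (𝓝 0) := by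
      refine (tendsto_rpow_atBot_of_base_gt_one 2 (by norm_num)).comp ?_
      exact tendsto_neg_atTop_atBot.comp hm'
    simpa using (h1.add (h2.const_mul 5)).add h2.sqrt
  have hε' : 0 < min ε (ε / (b + 1)) := lt_min hε (by positivity)
  filter_upwards [hlim.eventually_lt_const hε', eventually_gt_atTop 0] with m hm hm0
  intro W K W' K' W'' hW hK hW' hK' hW'' n₀ n₁ n₂ n₃ n₄ hcov
  set D : ℝ := (2 : ℝ) ^ (-(m * η)) with hD
  have hDpos : 0 < D := by positivity
  have hm0' : (0 : ℝ) < m := by exact_mod_cast hm0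
  set κ : ℝ := C₅ / (m * η ^ 2) + √D with hκ
  have hκ0 : 0 ≤ κ := by positivity
  have hsplit : ∀ x : ℝ, (2 : ℝ) ^ (m * (x - 2 * η)) = D * 2 ^ (m * (x - η)) := by
    intro x
    rw [hD, ← Real.rpow_add (by norm_num)]
    congr 1; ring
  have hdiv : ∀ {N x : ℝ}, N ≤ 2 ^ (m * (x - 2 * η)) → N / 2 ^ (m * (x - η)) ≤ D := by
    intro N x h
    rw [div_le_iff₀ (by positivity), ← hsplit]; exact h
  have key := hasBlocks_of_description (t.pow m)
    (fun u a x x₁ v y (i : Fin m) => e (u i) (a i) (x i) (x₁ i) (v i) (y i))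
    (δ := fun o (s : Fin m → Shat) => ∑ i, δ (o i) (s i)) (b := m * b)
    (fun o s => Finset.sum_nonneg fun _ _ => hδ _ _)
    (fun o s => by
      refine (Finset.sum_le_sum fun i _ => hδb (o i) (s i)).trans ?_
      simp)
    (c₀ := 2 ^ (m * (t.rate₀ - η))) (c₁ := 2 ^ (m * (t.rate₁ - η)))
    (c₂ := 2 ^ (m * (t.rate₂ - η))) (c₃ := 2 ^ (m * (t.rate₃ - η)))
    (c₄ := 2 ^ (m * (t.rate₄ - η))) (c := 2 ^ (m * (t.rateV + η))) (κ := κ)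
    (by positivity) (by positivity) (by positivity) (by positivity) (by positivity)
    (by positivity) hκ0 (by positivity) hW hK hW' hK' hW'' (by
      refine hcov.imp (fun h u a x₁ y₁ => ?_) fun h => ?_
      · simp only [Description.pow, h]
      · refine add_le_add ?_ ?_
        · refine le_trans ?_ (h₅ m η hm0 hη)
          rw [hrV, (t.avg_pow m), (t.avg_pow m)]
          refine mean_mono_of_pos (prodLaw_mem fun _ => t.law_mem) fun ω hω =>
            ind_mono fun hle => ?_
          have hpos : ∀ i, 0 < t.law (ω i) := fun i =>
            lt_of_le_of_ne (t.law_mem.1 _) fun h0 => hω.ne'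
              (Finset.prod_eq_zero (Finset.mem_univ i) h0.symm)
          have hp : 0 < ∏ i, t.pV (ω i).1 (ω i).2.1 (ω i).2.2.2.1
              (E.outY₁ (ω i).2.2.2.2.1) (ω i).2.2.2.2.2 :=
            Finset.prod_pos fun i _ => ht.pV_pos _ _ _ _ _ _ (hpos i)
          rw [Finset.prod_div_distrib, div_le_iff₀ hp]
          have hle' := (not_le.1 hle).le
          simp only [Description.pow, Ensemble.pow, prodLaw] at hle'
          rw [show (m : ℝ) * (-t.rateV - η) = -(m * (t.rateV + η)) by ring,
            Real.rpow_neg (by norm_num), ← div_eq_inv_mul, le_div_iff₀ (by positivity), mul_comm]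
          exact hle'
        · apply Real.sqrt_le_sqrt
          have hK0 : (0 : ℝ) < K' := by exact_mod_cast Nat.pos_of_ne_zero hK'
          rw [div_le_iff₀ hK0]
          calc (2 : ℝ) ^ (m * (t.rateV + η)) = D * 2 ^ (m * (t.rateV + 2 * η)) := by
                rw [hD, ← Real.rpow_add (by norm_num)]; congr 1; ring
            _ ≤ D * K' := by gcongr)
  obtain ⟨N, p, B, hp, hB⟩ := key
  have hT : (t.pow m).avg (fun u a x x₁ o v => ind (¬ (2 ^ (m * (t.rate₀ - η)) <
        (t.pow m).τ₀ u a x₁ ((E.pow m).outY₁ o) ∧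
        (t.pow m).Pass (2 ^ (m * (t.rate₁ - η))) (2 ^ (m * (t.rate₂ - η)))
          (2 ^ (m * (t.rate₃ - η))) (2 ^ (m * (t.rate₄ - η))) u a x x₁ v ((E.pow m).outY o)))) ≤
      (C₀ + C₁ + C₂ + C₃ + C₄) / (m * η ^ 2) := by
    have hsum := add_le_add (add_le_add (add_le_add (add_le_add (h₀ m η hm0 hη) (h₁ m η hm0 hη))
      (h₂ m η hm0 hη)) (h₃ m η hm0 hη)) (h₄ m η hm0 hη)
    rw [← Description.avg_add, ← Description.avg_add, ← Description.avg_add,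
      ← Description.avg_add] at hsum
    rw [add_div, add_div, add_div, add_div]
    refine le_trans ((t.pow m).avg_mono fun u a x x₁ o v => ?_) hsum
    unfold Description.Pass
    simp only [not_and_or, not_lt]
    refine (ind_or_le _ _).trans ?_
    rw [add_assoc, add_assoc, add_assoc]
    refine add_le_add le_rfl ((ind_or_le _ _).trans (add_le_add le_rfl ((ind_or_le _ _).trans
      (add_le_add le_rfl (ind_or_le _ _)))))
  refine ⟨N, p, B, hp, fun w w' w'' k => ⟨(hB w w' w'' k).1.trans ?_, (hB w w' w'' k).2.trans ?_⟩⟩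
  · have h1 := hdiv n₀
    have h2 := hdiv n₁
    have h3 := hdiv n₂
    have h4 := hdiv n₃
    have h5 := hdiv n₄
    have h6 := hm.le.trans (min_le_left _ _)
    rw [add_div] at h6
    linarith
  · have h6 := hm.le.trans (min_le_right _ _)
    have h7 : κ ≤ ε / (b + 1) := by
      refine le_trans ?_ h6
      rw [hκ, add_div]
      have : 0 ≤ (C₀ + C₁ + C₂ + C₃ + C₄) / (m * η ^ 2) := by positivity
      linarith
    have h8 : b * κ ≤ ε := by
      calc b * κ ≤ b * (ε / (b + 1)) := by gcongr
        _ = ε * (b / (b + 1)) := by ring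
        _ ≤ ε * 1 := by
            gcongr
            rw [div_le_one (by positivity)]; linarith
        _ = ε := mul_one ε
    have h9 := t.avg_pow_sum m (fun u a x x₁ o v => δ o (e u a x x₁ v (E.outY o)))
    have h10 : (m : ℝ) * b * κ ≤ m * ε := by
      rw [mul_assoc]; gcongr
    exact (add_le_add (le_of_eq h9) h10).trans_eq (mul_add _ _ _).symm

end Asymptotics

/-! ### Concatenation of blocks -/

/-- A code of length `n` that starts with the relay in a state of `W × K`, of which the source
knows the part in `W`; the decoder recovers the message together with the initial state.
`Good` is an event on which it does so. -/
structure Scheme (X X₁ Y Y₁ Shat W K Msg : Type*) (n : ℕ) where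
  enc : W → Msg → Fin n → X
  rel : W → K → (Fin n → Y₁) → Fin n → X₁
  causal : ∀ w k y y' i, (∀ j, j < i → y j = y' j) → rel w k y i = rel w k y' i
  dec : (Fin n → Y) → W × K × Msg
  est : (Fin n → Y) → Fin n → Shat
  Good : W → K → Msg → (Fin n → Y) → (Fin n → Y₁) → Prop
  dec_eq : ∀ w k msg y y₁, Good w k msg y y₁ → dec y = (w, k, msg)

section Schemes

variable {X X₁ O Y Y₁ Shat : Type*} [Fintype O] (Q : X → X₁ → O → ℝ) (outY : O → Y)
  (outY₁ : O → Y₁) (δ : O → Shat → ℝ)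

/-- The law of the channel outputs if the source is in the state `w` and the relay in `(v, k)`. -/
def Scheme.law {W K Msg : Type*} {n : ℕ} (σ : Scheme X X₁ Y Y₁ Shat W K Msg n) (w v : W) (k : K)
    (msg : Msg) (o : Fin n → O) : ℝ :=
  ∏ i, Q (σ.enc w msg i) (σ.rel v k (fun j => outY₁ (o j)) i) (o i)

/-- There is a random scheme of length `n` with probability of failure at most `ε` and cost (the
mean of the total distortion on the good event) at most `c`, for every state and message. -/
def HasSchemes (W K Msg : Type*) (n : ℕ) (ε c : ℝ) : Prop :=
  ∃ (N : ℕ) (p : Fin N → ℝ) (σ : Fin N → Scheme X X₁ Y Y₁ Shat W K Msg n),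
    p ∈ stdSimplex ℝ (Fin N) ∧
    (∀ i w v k msg, (σ i).law Q outY₁ w v k msg ∈ stdSimplex ℝ (Fin n → O)) ∧
    ∀ w k msg,
      mean p (fun i => mean ((σ i).law Q outY₁ w w k msg) fun o =>
        ind (¬ (σ i).Good w k msg (fun j => outY (o j)) (fun j => outY₁ (o j)))) ≤ ε ∧
      mean p (fun i => mean ((σ i).law Q outY₁ w w k msg) fun o =>
        ind ((σ i).Good w k msg (fun j => outY (o j)) (fun j => outY₁ (o j))) *
          ∑ j, δ (o j) ((σ i).est (fun j => outY (o j)) j)) ≤ c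

/-- Block codes for words of length `m`. -/
abbrev HasWordBlocks (m : ℕ) (W K W' K' W'' : Type*) (ε c : ℝ) : Prop :=
  HasBlocks (fun (x : Fin m → X) (x₁ : Fin m → X₁) => prodLaw fun i => Q (x i) (x₁ i))
    (fun o i => outY (o i)) (fun o i => outY₁ (o i))
    (fun o (s : Fin m → Shat) => ∑ i, δ (o i) (s i)) W K W' K' W'' ε c

variable {Q outY outY₁ δ}

/-- A block after which the relay has a single state ends the transmission. -/
lemma HasSchemes.of_block {W K : Type*} {n : ℕ} {ε c : ℝ}
    (hQ : ∀ x x₁, Q x x₁ ∈ stdSimplex ℝ O)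
    (h : HasWordBlocks Q outY outY₁ δ n W K (Fin 1) (Fin 1) (Fin 1) ε c) :
    HasSchemes Q outY outY₁ δ W K Unit n ε c := by
  obtain ⟨N, p, B, hp, hB⟩ := h
  refine ⟨N, p, fun i =>
    { enc := fun w _ => (B i).enc w 0 0
      rel := fun w k _ => (B i).inp w k
      causal := fun _ _ _ _ _ _ => rfl
      dec := fun y => (((B i).dec 0 0 y).1, ((B i).dec 0 0 y).2.2, ())
      est := fun y => (B i).est 0 0 y
      Good := fun w k _ y y₁ => (B i).Good w 0 0 k y y₁
      dec_eq := ?_ }, hp, ?_, ?_⟩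
  · intro w k msg y y₁ hg
    have := hg.2
    rw [Subsingleton.elim ((B i).out w k y₁).2 0] at this
    rw [this]
  · intro i w v k msg
    exact prodLaw_mem fun _ => hQ _ _
  · intro w k msg
    refine ⟨(hB w 0 0 k).1, le_trans (le_of_eq ?_) (hB w 0 0 k).2⟩
    congr 1; funext i
    congr 1; funext o
    rw [Subsingleton.elim ((B i).out w k fun j => outY₁ (o j)).2 0]

variable {W K W' K' W'' Msg : Type*} {m n : ℕ}

/-- The block `B` followed by the scheme `σ`: the scheme is decoded first, and yields the final
state of the block. -/
def Block.concat (B : Block (Fin m → X) (Fin m → X₁) (Fin m → Y) (Fin m → Y₁) (Fin m → Shat)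
    W K W' K' W'') (σ : Scheme X X₁ Y Y₁ Shat W' K' Msg n) :
    Scheme X X₁ Y Y₁ Shat W K (W' × W'' × Msg) (m + n) where
  enc w msg := Fin.append (B.enc w msg.1 msg.2.1) (σ.enc msg.1 msg.2.2)
  rel w k y := Fin.append (B.inp w k) (σ.rel (B.out w k fun i => y (Fin.castAdd n i)).1
    (B.out w k fun i => y (Fin.castAdd n i)).2 fun j => y (Fin.natAdd m j))
  causal w k y y' i h := by
    refine Fin.addCases (fun i h => ?_) (fun j h => ?_) i h
    · simp only [Fin.append_left]
    · have h1 : (fun i => y (Fin.castAdd n i)) = fun i => y' (Fin.castAdd n i) := by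
        funext i
        refine h _ ?_
        rw [Fin.lt_def, Fin.val_castAdd, Fin.val_natAdd]
        omega
      simp only [Fin.append_right, h1]
      refine σ.causal _ _ _ _ _ fun l hl => h _ ?_
      rw [Fin.lt_def, Fin.val_natAdd, Fin.val_natAdd]
      have := Fin.lt_def.1 hl
      omega
  dec y :=
    let a := σ.dec fun j => y (Fin.natAdd m j)
    let b := B.dec a.1 a.2.1 fun i => y (Fin.castAdd n i)
    (b.1, b.2.2, a.1, b.2.1, a.2.2)
  est y :=
    let a := σ.dec fun j => y (Fin.natAdd m j)
    Fin.append (B.est a.1 a.2.1 fun i => y (Fin.castAdd n i)) (σ.est fun j => y (Fin.natAdd m j))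
  Good w k msg y y₁ :=
    B.Good w msg.1 msg.2.1 k (fun i => y (Fin.castAdd n i)) (fun i => y₁ (Fin.castAdd n i)) ∧
    σ.Good msg.1 (B.out w k fun i => y₁ (Fin.castAdd n i)).2 msg.2.2
      (fun j => y (Fin.natAdd m j)) (fun j => y₁ (Fin.natAdd m j))
  dec_eq w k msg y y₁ h := by
    obtain ⟨⟨-, h1⟩, h2⟩ := h
    have h3 := σ.dec_eq _ _ _ _ _ h2
    simp only [h3, h1]

/-- The scheme that follows a block starts from the state that the relay reached in the block. -/
lemma mean_law_concat (B : Block (Fin m → X) (Fin m → X₁) (Fin m → Y) (Fin m → Y₁) (Fin m → Shat)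
    W K W' K' W'') (σ : Scheme X X₁ Y Y₁ Shat W' K' Msg n) (w v : W) (k : K)
    (msg : W' × W'' × Msg) (F : (Fin (m + n) → O) → ℝ) :
    mean ((B.concat σ).law Q outY₁ w v k msg) F =
      mean (prodLaw fun i => Q (B.enc w msg.1 msg.2.1 i) (B.inp v k i)) fun o₁ =>
        mean (σ.law Q outY₁ msg.1 (B.out v k fun i => outY₁ (o₁ i)).1
          (B.out v k fun i => outY₁ (o₁ i)).2 msg.2.2) fun o₂ => F (Fin.append o₁ o₂) := by
  simp only [mean, Finset.mul_sum]
  rw [← Fintype.sum_prod_type']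
  refine (Fintype.sum_equiv (Fin.appendEquiv m n) _ _ fun o => ?_).symm
  simp only [Fin.appendEquiv, Equiv.coe_fn_mk, Scheme.law, Fin.prod_univ_add, Block.concat,
    Fin.append_left, Fin.append_right, prodLaw, mul_assoc]

/-- A block can be put in front of a scheme. -/
lemma HasSchemes.concat {ε c ε' c' : ℝ} (hδ : ∀ o s, 0 ≤ δ o s)
    (hQ : ∀ x x₁, Q x x₁ ∈ stdSimplex ℝ O)
    (hB : HasWordBlocks Q outY outY₁ δ m W K W' K' W'' ε c)
    (hS : HasSchemes Q outY outY₁ δ W' K' Msg n ε' c') :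
    HasSchemes Q outY outY₁ δ W K (W' × W'' × Msg) (m + n) (ε + ε') (c + c') := by
  obtain ⟨N, p, B, hp, hB⟩ := hB
  obtain ⟨N', p', σ, hp', hlaw, hσ⟩ := hS
  set e : Fin N × Fin N' ≃ Fin (N * N') := finProdFinEquiv
  have hq : pairLaw p (fun _ => p') ∈ stdSimplex ℝ (Fin N × Fin N') := pairLaw_mem hp fun _ => hp'
  refine ⟨N * N', pairLaw p (fun _ => p') ∘ e.symm,
    fun i => (B (e.symm i).1).concat (σ (e.symm i).2), comp_equiv_mem e hq, ?_, ?_⟩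
  · intro i w v k msg
    refine ⟨fun o => Finset.prod_nonneg fun _ _ => (hQ _ _).1 _, ?_⟩
    have h1 := mean_law_concat (Q := Q) (outY₁ := outY₁) (B (e.symm i).1) (σ (e.symm i).2) w v k
      msg fun _ => 1
    simp only [mean_const (hlaw _ _ _ _ _), mean_const (prodLaw_mem fun _ => hQ _ _)] at h1
    simpa [mean] using h1
  intro w k msg
  obtain ⟨w', w'', msg⟩ := msg
  have hP : ∀ i, (prodLaw fun j => Q ((B i).enc w w' w'' j) ((B i).inp w k j)) ∈
      stdSimplex ℝ (Fin m → O) := fun i => prodLaw_mem fun _ => hQ _ _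
  have hfun : ∀ F : Fin N × Fin N' → ℝ, mean (pairLaw p (fun _ => p') ∘ e.symm)
      (fun i => F (e.symm i)) = mean p fun i => mean p' fun i' => F (i, i') := fun F =>
    (mean_equiv e _ F).trans (mean_pairLaw _ _ _)
  constructor
  · rw [hfun fun q => mean (((B q.1).concat (σ q.2)).law Q outY₁ w w k (w', w'', msg)) fun o =>
      ind (¬ ((B q.1).concat (σ q.2)).Good w k (w', w'', msg) (fun j => outY (o j))
        (fun j => outY₁ (o j)))]
    calc _ ≤ mean p (fun i => mean (prodLaw fun j => Q ((B i).enc w w' w'' j) ((B i).inp w k j))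
            fun o => ind (¬ (B i).Good w w' w'' k (fun j => outY (o j)) (fun j => outY₁ (o j)))
              + ε') := by
          refine mean_mono hp fun i => ?_
          simp only [mean_law_concat]
          rw [mean_comm]
          refine mean_mono (hP i) fun o => ?_
          simp only [Block.concat, Fin.append_left, Fin.append_right]
          by_cases hg : (B i).Good w w' w'' k (fun j => outY (o j)) (fun j => outY₁ (o j))
          · rw [ind_false (not_not.2 hg), zero_add]
            refine le_trans (le_of_eq ?_)
              (hσ w' ((B i).out w k fun j => outY₁ (o j)).2 msg).1
            congr 1; funext i'
            rw [hg.1]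
            congr 1; funext o₂
            simp only [hg, true_and]
          · rw [ind_true hg]
            have hε' : 0 ≤ ε' := le_trans
              (mean_nonneg hp' fun i' => mean_nonneg (hlaw _ _ _ _ _) fun _ => ind_nonneg _)
              (hσ w' ((B i).out w k fun j => outY₁ (o j)).2 msg).1
            refine (mean_le_const hp' fun i' => mean_le_const (hlaw _ _ _ _ _) fun _ =>
              ind_le_one _).trans ?_
            linarith
      _ ≤ ε + ε' := by
          simp only [mean_add, mean_const (hP _), mean_const hp]
          linarith [(hB w w' w'' k).1]
  · rw [hfun fun q => mean (((B q.1).concat (σ q.2)).law Q outY₁ w w k (w', w'', msg)) fun o =>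
      ind (((B q.1).concat (σ q.2)).Good w k (w', w'', msg) (fun j => outY (o j))
        (fun j => outY₁ (o j))) *
          ∑ j, δ (o j) (((B q.1).concat (σ q.2)).est (fun j => outY (o j)) j)]
    calc _ ≤ mean p (fun i => mean (prodLaw fun j => Q ((B i).enc w w' w'' j) ((B i).inp w k j))
            fun o => ind ((B i).Good w w' w'' k (fun j => outY (o j)) (fun j => outY₁ (o j))) *
              (∑ j, δ (o j) ((B i).est w' ((B i).out w k fun j => outY₁ (o j)).2
                (fun j => outY (o j)) j)) + c') := by
          refine mean_mono hp fun i => ?_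
          simp only [mean_law_concat]
          rw [mean_comm]
          refine mean_mono (hP i) fun o => ?_
          simp only [Block.concat, Fin.append_left, Fin.append_right, Fin.sum_univ_add]
          by_cases hg : (B i).Good w w' w'' k (fun j => outY (o j)) (fun j => outY₁ (o j))
          · rw [ind_true hg, one_mul]
            refine le_trans ?_ (add_le_add le_rfl
              (hσ w' ((B i).out w k fun j => outY₁ (o j)).2 msg).2)
            rw [hg.1]
            rw [← mean_const hp' (∑ j, δ (o j) ((B i).est w' ((B i).out w k fun j =>
              outY₁ (o j)).2 (fun j => outY (o j)) j)), ← mean_add]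
            refine mean_mono hp' fun i' => ?_
            rw [← mean_const (hlaw i' w' w' ((B i).out w k fun j =>
              outY₁ (o j)).2 msg) (∑ j, δ (o j) ((B i).est w' ((B i).out w k fun j =>
              outY₁ (o j)).2 (fun j => outY (o j)) j)), ← mean_add]
            refine mean_mono (hlaw _ _ _ _ _) fun o₂ => ?_
            have hs := Finset.sum_nonneg fun j (_ : j ∈ Finset.univ) => hδ (o j)
              ((B i).est w' ((B i).out w k fun j => outY₁ (o j)).2 (fun j => outY (o j)) j)
            by_cases hg2 : (σ i').Good w' ((B i).out w k fun j => outY₁ (o j)).2 msg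
              (fun j => outY (o₂ j)) (fun j => outY₁ (o₂ j))
            · rw [ind_true ⟨hg, hg2⟩, ind_true hg2, one_mul, one_mul,
                (σ i').dec_eq _ _ _ _ _ hg2]
            · rw [ind_false (fun h => hg2 h.2), ind_false hg2, zero_mul, zero_mul, add_zero]
              exact hs
          · have hc' : 0 ≤ c' := le_trans
              (mean_nonneg hp' fun i' => mean_nonneg (hlaw _ _ _ _ _) fun _ =>
                mul_nonneg (ind_nonneg _) (Finset.sum_nonneg fun _ _ => hδ _ _))
              (hσ w' ((B i).out w k fun j => outY₁ (o j)).2 msg).2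
            rw [ind_false hg, zero_mul, zero_add]
            refine le_trans (le_of_eq ?_) hc'
            have h0 : ∀ (R : Prop) (z : ℝ), ind ((B i).Good w w' w'' k (fun j => outY (o j))
                (fun j => outY₁ (o j)) ∧ R) * z = 0 := fun R z => by
              rw [ind_false (fun h => hg h.1), zero_mul]
            simp only [h0, mean_const (hlaw _ _ _ _ _), mean_const hp']
      _ ≤ c + c' := by
          simp only [mean_add, mean_const (hP _), mean_const hp]
          linarith [(hB w w' w'' k).2]

/-- The messages of `B` blocks. -/
def Messages (W W'' : Type) : ℕ → Type
  | 0 => Unit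
  | B + 1 => W × W'' × Messages W W'' B

/-- Block Markov coding: `B` equal blocks followed by a terminating block. -/
lemma HasSchemes.iterate {W K W'' : Type} {l : ℕ} {ε c ε' c' : ℝ} (hδ : ∀ o s, 0 ≤ δ o s)
    (hQ : ∀ x x₁, Q x x₁ ∈ stdSimplex ℝ O)
    (hB : HasWordBlocks Q outY outY₁ δ m W K W K W'' ε c)
    (hS : HasSchemes Q outY outY₁ δ W K Unit l ε' c') (B : ℕ) :
    HasSchemes Q outY outY₁ δ W K (Messages W W'' B) (B * m + l) (B * ε + ε') (B * c + c') := by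
  induction B with
  | zero => simpa [Messages] using hS
  | succ B ih =>
    have h := HasSchemes.concat hδ hQ hB ih
    have e1 : m + (B * m + l) = (B + 1) * m + l := by ring
    have e2 : ε + (B * ε + ε') = ((B + 1 : ℕ) : ℝ) * ε + ε' := by push_cast; ring
    have e3 : c + (B * c + c') = ((B + 1 : ℕ) : ℝ) * c + c' := by push_cast; ring
    rw [e1, e2, e3] at h
    exact h

noncomputable instance messagesFintype (W W'' : Type) [Fintype W] [Fintype W''] :
    ∀ B, Fintype (Messages W W'' B)
  | 0 => inferInstanceAs (Fintype Unit)
  | B + 1 => by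
    have := messagesFintype W W'' B
    exact inferInstanceAs (Fintype (W × W'' × Messages W W'' B))

lemma card_messages (W W'' : Type) [Fintype W] [Fintype W''] (B : ℕ) :
    Fintype.card (Messages W W'' B) = (Fintype.card W * Fintype.card W'') ^ B := by
  induction B with
  | zero => rfl
  | succ B ih =>
    have : Fintype.card (Messages W W'' (B + 1)) =
        Fintype.card (W × W'' × Messages W W'' B) := rfl
    rw [this, Fintype.card_prod, Fintype.card_prod, ih]
    ring

end Schemes

/-! ### Schemes of every large length -/

section Floor

lemma floor_two_rpow_ne_zero {x : ℝ} (hx : 0 ≤ x) : ⌊(2 : ℝ) ^ x⌋₊ ≠ 0 :=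
  (Nat.floor_pos.2 (Real.one_le_rpow (by norm_num) hx)).ne'

lemma floor_two_rpow_le (x : ℝ) : (⌊(2 : ℝ) ^ x⌋₊ : ℝ) ≤ 2 ^ x := Nat.floor_le (by positivity)

lemma floor_two_rpow_sub_one_le (x : ℝ) : ((⌊(2 : ℝ) ^ x⌋₊ - 1 : ℕ) : ℝ) ≤ 2 ^ x :=
  le_trans (by exact_mod_cast Nat.sub_le _ _) (floor_two_rpow_le x)

lemma two_rpow_sub_one_le_floor {x : ℝ} (hx : 0 ≤ x) : (2 : ℝ) ^ (x - 1) ≤ ⌊(2 : ℝ) ^ x⌋₊ := by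
  have h1 : (1 : ℝ) ≤ ⌊(2 : ℝ) ^ x⌋₊ := by
    exact_mod_cast Nat.one_le_iff_ne_zero.2 (floor_two_rpow_ne_zero hx)
  have h2 := Nat.lt_floor_add_one ((2 : ℝ) ^ x)
  rw [Real.rpow_sub_one (by norm_num)]
  linarith

end Floor

section Rates

variable {U A X X₁ O Y Y₁ V V₀ Shat : Type*}
  [Fintype U] [Fintype A] [Fintype X] [Fintype X₁] [Fintype O] [Fintype V] [Fintype V₀]
  [Fintype Y₁] {E : Ensemble U A X X₁ O Y Y₁}

set_option maxHeartbeats 1000000 in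
/-- Block Markov coding with the rates `r'` of the messages decoded by the relay, `r''` of the
private messages, and `rk` of the descriptions. The terminating block uses the trivial description
`t₀`; its length is a constant multiple of that of the other blocks. -/
theorem eventually_hasSchemes (t : Description E V) (ht : t.Regular) (t₀ : Description E V₀)
    (ht₀ : t₀.Regular) (ht₀' : ∀ u a x₁ y₁, t₀.pV u a x₁ y₁ = t₀.r u a x₁)
    (e : U → A → X → X₁ → V → Y → Shat) (s₀ : Shat) {δ : O → Shat → ℝ} {b : ℝ} (hb : 0 ≤ b)
    (hδ : ∀ o s, 0 ≤ δ o s) (hδb : ∀ o s, δ o s ≤ b) {r' r'' rk η R : ℝ} (hη : 0 < η)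
    (hr' : 0 ≤ r') (hr'' : 0 ≤ r'') (hrk : 0 ≤ rk) (hR0 : 0 ≤ R)
    (h0 : r' = 0 ∨ r' ≤ t.rate₀ - 2 * η) (h1 : r'' = 0 ∨ r'' ≤ t.rate₁ - 2 * η)
    (h2 : r'' = 0 ∨ rk = 0 ∨ r'' + rk ≤ t.rate₂ - 2 * η) (h3 : rk = 0 ∨ rk ≤ t.rate₃ - 2 * η)
    (h4 : r' = 0 ∨ r' + r'' + rk ≤ t.rate₄ - 2 * η)
    (hV : (∀ u a x₁ y₁, t.pV u a x₁ y₁ = t.r u a x₁) ∨ t.rateV + 3 * η ≤ rk)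
    (h3' : rk = 0 ∨ 2 * η < t₀.rate₃) (h4' : r' = 0 ∨ 2 * η < t₀.rate₄)
    (hR : R = 0 ∨ R < r' + r'') {ε : ℝ} (hε : 0 < ε) :
    ∀ᶠ n : ℕ in atTop, ∃ (W K W'' B : ℕ), W ≠ 0 ∧ K ≠ 0 ∧
      2 ^ ⌈(n : ℝ) * R⌉₊ ≤ Fintype.card (Messages (Fin W) (Fin W'') B) ∧
      HasSchemes E.Q E.outY E.outY₁ δ (Fin W) (Fin K) (Messages (Fin W) (Fin W'') B) n ε
        (n * (t.avg (fun u a x x₁ o v => δ o (e u a x x₁ v (E.outY o))) + ε)) := by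
  set Δ := t.avg (fun u a x x₁ o v => δ o (e u a x x₁ v (E.outY o))) with hΔ
  have hΔ0 : 0 ≤ Δ := by
    rw [← t.avg_const 0]; exact t.avg_mono fun _ _ _ _ _ _ => hδ _ _
  -- the relative length `L` of the terminating block
  obtain ⟨L, hL1, hL3, hL4⟩ : ∃ L : ℕ, 1 ≤ L ∧ (rk = 0 ∨ rk ≤ L * (t₀.rate₃ - 2 * η)) ∧
      (r' = 0 ∨ r' + rk ≤ L * (t₀.rate₄ - 2 * η)) := by
    have key : ∀ (z g : ℝ) (P : Prop), (P ∨ 2 * η < g) →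
        ∃ L : ℕ, ∀ L' : ℕ, L ≤ L' → P ∨ z ≤ L' * (g - 2 * η) := by
      intro z g P h
      rcases h with h | h
      · exact ⟨0, fun _ _ => Or.inl h⟩
      · obtain ⟨L, hL⟩ := exists_nat_ge (z / (g - 2 * η))
        refine ⟨L, fun L' hL' => Or.inr ?_⟩
        have : (L : ℝ) ≤ L' := by exact_mod_cast hL'
        rw [← div_le_iff₀ (by linarith)]
        linarith
    obtain ⟨La, hLa⟩ := key rk t₀.rate₃ (rk = 0) h3'
    obtain ⟨Lb, hLb⟩ := key (r' + rk) t₀.rate₄ (r' = 0) h4'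
    exact ⟨max 1 (max La Lb), le_max_left _ _, hLa _ (by simp), hLb _ (by simp)⟩
  -- the number `B` of blocks
  obtain ⟨B, hB1, hBR, hBε⟩ : ∃ B : ℕ, 1 ≤ B ∧ (R = 0 ∨ (B + L) * R < B * (r' + r'')) ∧
      4 * (L * b) ≤ B * ε := by
    obtain ⟨B₁, hB₁⟩ := exists_nat_ge (4 * (L * b) / ε)
    rw [div_le_iff₀ hε] at hB₁
    rcases hR with hR | hR
    · refine ⟨max 1 B₁, le_max_left _ _, Or.inl hR, hB₁.trans ?_⟩
      have : (B₁ : ℝ) ≤ (max 1 B₁ : ℕ) := by exact_mod_cast le_max_right _ _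
      gcongr
    · obtain ⟨B₂, hB₂⟩ := exists_nat_gt (L * R / (r' + r'' - R))
      rw [div_lt_iff₀ (by linarith)] at hB₂
      have e1 : (B₁ : ℝ) ≤ (max 1 (max B₁ B₂) : ℕ) := by exact_mod_cast by simp
      have e2 : (B₂ : ℝ) ≤ (max 1 (max B₁ B₂) : ℕ) := by exact_mod_cast by simp
      refine ⟨max 1 (max B₁ B₂), le_max_left _ _, Or.inr ?_, hB₁.trans (by gcongr)⟩
      have := mul_le_mul_of_nonneg_right e2 (by linarith : 0 ≤ r' + r'' - R)
      linarith
  set ε₁ := ε / (2 * (B + 1)) with hε₁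
  have hε₁0 : 0 < ε₁ := by positivity
  have hε₁le : ε₁ ≤ ε / 2 := by
    rw [hε₁]
    have : (0 : ℝ) ≤ B := by positivity
    gcongr
    linarith
  obtain ⟨m₁, hm₁⟩ := eventually_atTop.1 (eventually_hasBlocks t ht e hb hδ hδb hη hε₁0)
  obtain ⟨m₂, hm₂⟩ := eventually_atTop.1 (eventually_hasBlocks t₀ ht₀
    (fun _ _ _ _ _ _ => s₀) hb hδ hδb hη (half_pos hε))
  obtain ⟨m₃, hm₃⟩ := exists_nat_ge (1 / η)
  obtain ⟨m₄, hm₄⟩ : ∃ m₄ : ℕ, ∀ m : ℕ, m₄ ≤ m →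
      R = 0 ∨ (B + L) * (m + 1) * R + 1 ≤ B * (m * (r' + r'') - 2) := by
    rcases hBR with h | h
    · exact ⟨0, fun _ _ => Or.inl h⟩
    · obtain ⟨m₄, hm₄⟩ := exists_nat_ge (((B + L) * R + 1 + 2 * B) /
        (B * (r' + r'') - (B + L) * R))
      refine ⟨m₄, fun m hm => Or.inr ?_⟩
      have : (m₄ : ℝ) ≤ m := by exact_mod_cast hm
      have h5 := hm₄.trans this
      rw [div_le_iff₀ (by linarith)] at h5
      linarith
  obtain ⟨m₅, hm₅⟩ := exists_nat_ge (4 * b / ε)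
  set M := m₁ + m₂ + m₃ + m₄ + m₅ with hM
  filter_upwards [eventually_ge_atTop (M * (B + L)), eventually_gt_atTop 0] with n hn hn0
  set m := n / (B + L) with hm
  have hBL : 0 < B + L := by omega
  have hMm : M ≤ m := (Nat.le_div_iff_mul_le hBL).2 hn
  have hlow : m * (B + L) ≤ n := Nat.div_mul_le_self n (B + L)
  have hhigh : n < (m + 1) * (B + L) := by
    rw [hm, mul_comm]; exact Nat.lt_mul_div_succ n hBL
  obtain ⟨l, hl⟩ : ∃ l, n = B * m + l := ⟨n - B * m, by
    have : B * m ≤ m * (B + L) := by rw [mul_comm]; gcongr; omega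
    omega⟩
  have hlL : L * m ≤ l := by
    have : m * (B + L) = B * m + L * m := by ring
    omega
  have hlm : m ≤ l := le_trans (Nat.le_mul_of_pos_left m hL1) hlL
  have hlL' : (L : ℝ) * m ≤ l := by exact_mod_cast hlL
  have hm0 : (0 : ℝ) ≤ m := by positivity
  set W := ⌊(2 : ℝ) ^ (m * r')⌋₊ with hW
  set K := ⌊(2 : ℝ) ^ (m * rk)⌋₊ with hK
  set W'' := ⌊(2 : ℝ) ^ (m * r'')⌋₊ with hW''
  have hWne : W ≠ 0 := floor_two_rpow_ne_zero (by positivity)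
  have hKne : K ≠ 0 := floor_two_rpow_ne_zero (by positivity)
  have hW''ne : W'' ≠ 0 := floor_two_rpow_ne_zero (by positivity)
  have hW1 : r' = 0 → W = 1 := fun h => by simp [hW, h]
  have hK1 : rk = 0 → K = 1 := fun h => by simp [hK, h]
  have hW''1 : r'' = 0 → W'' = 1 := fun h => by simp [hW'', h]
  have hWle : ((W - 1 : ℕ) : ℝ) ≤ 2 ^ (m * r') := floor_two_rpow_sub_one_le _
  have hKle : ((K - 1 : ℕ) : ℝ) ≤ 2 ^ (m * rk) := floor_two_rpow_sub_one_le _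
  have hKle' : (K : ℝ) ≤ 2 ^ (m * rk) := floor_two_rpow_le _
  have hW''le : ((W'' - 1 : ℕ) : ℝ) ≤ 2 ^ (m * r'') := floor_two_rpow_sub_one_le _
  have hW''le' : (W'' : ℝ) ≤ 2 ^ (m * r'') := floor_two_rpow_le _
  have hmono : ∀ {x y : ℝ}, x ≤ y → (2 : ℝ) ^ x ≤ 2 ^ y := fun h =>
    Real.rpow_le_rpow_of_exponent_le (by norm_num) h
  have hblock := hm₁ m (by omega) W K W K W'' hWne hKne hWne hKne hW''ne
    (by
      rcases h0 with h | h
      · simp [hW1 h]; positivity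
      · exact hWle.trans (hmono (by gcongr)))
    (by
      rcases h1 with h | h
      · simp [hW''1 h]; positivity
      · exact hW''le.trans (hmono (by gcongr)))
    (by
      rcases h2 with h | h | h
      · simp [hW''1 h]; positivity
      · simp [hK1 h]; positivity
      · calc ((W'' - 1 : ℕ) : ℝ) * ((K - 1 : ℕ) : ℝ) ≤ 2 ^ (m * r'') * 2 ^ (m * rk) := by gcongr
          _ = 2 ^ (m * (r'' + rk)) := by rw [← Real.rpow_add (by norm_num), mul_add]
          _ ≤ _ := hmono (by gcongr))
    (by
      rcases h3 with h | h
      · simp [hK1 h]; positivity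
      · exact hKle.trans (hmono (by gcongr)))
    (by
      rcases h4 with h | h
      · simp [hW1 h]; positivity
      · calc ((W - 1 : ℕ) : ℝ) * W'' * K ≤ 2 ^ (m * r') * 2 ^ (m * r'') * 2 ^ (m * rk) := by
              gcongr
          _ = 2 ^ (m * (r' + r'' + rk)) := by
              rw [← Real.rpow_add (by norm_num), ← Real.rpow_add (by norm_num), mul_add, mul_add]
          _ ≤ _ := hmono (by gcongr))
    (hV.imp id fun h => by
      refine le_trans (hmono ?_) (two_rpow_sub_one_le_floor (x := m * rk) (by positivity))
      have h5 : (1 : ℝ) ≤ m * η := by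
        have : (m₃ : ℝ) ≤ m := by exact_mod_cast (by omega : m₃ ≤ m)
        rw [← div_le_iff₀ hη]; linarith
      have := mul_le_mul_of_nonneg_left h hm0
      linarith)
  have hterm := hm₂ l (by omega) W K 1 1 1 hWne hKne one_ne_zero one_ne_zero one_ne_zero
    (by simp; positivity) (by simp; positivity) (by simp; positivity)
    (by
      rcases hL3 with h | h
      · simp [hK1 h]; positivity
      · refine hKle.trans (hmono ?_)
        have h6 : 0 ≤ t₀.rate₃ - 2 * η := by
          by_contra hneg
          have : (L : ℝ) * (t₀.rate₃ - 2 * η) < 0 :=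
            mul_neg_of_pos_of_neg (by exact_mod_cast hL1) (not_le.1 hneg)
          linarith
        calc (m : ℝ) * rk ≤ m * (L * (t₀.rate₃ - 2 * η)) := by gcongr
          _ = L * m * (t₀.rate₃ - 2 * η) := by ring
          _ ≤ _ := by gcongr)
    (by
      rcases hL4 with h | h
      · simp [hW1 h]; positivity
      · have h6 : 0 ≤ t₀.rate₄ - 2 * η := by
          by_contra hneg
          have : (L : ℝ) * (t₀.rate₄ - 2 * η) < 0 :=
            mul_neg_of_pos_of_neg (by exact_mod_cast hL1) (not_le.1 hneg)
          linarith
        calc ((W - 1 : ℕ) : ℝ) * (1 : ℕ) * K ≤ 2 ^ (m * r') * (1 : ℕ) * 2 ^ (m * rk) := by gcongr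
          _ = 2 ^ (m * (r' + rk)) := by
              rw [Nat.cast_one, mul_one, ← Real.rpow_add (by norm_num), mul_add]
          _ ≤ _ := hmono (by
            calc (m : ℝ) * (r' + rk) ≤ m * (L * (t₀.rate₄ - 2 * η)) := by gcongr
              _ = L * m * (t₀.rate₄ - 2 * η) := by ring
              _ ≤ _ := by gcongr))
    (Or.inl ht₀')
  refine ⟨W, K, W'', B, hWne, hKne, ?_, ?_⟩
  · rw [card_messages, Fintype.card_fin, Fintype.card_fin]
    rcases hm₄ m (by omega) with h | h
    · simp only [h, mul_zero, Nat.ceil_zero, pow_zero]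
      exact Nat.one_le_iff_ne_zero.2 (pow_ne_zero _ (mul_ne_zero hWne hW''ne))
    have hceil : (⌈(n : ℝ) * R⌉₊ : ℝ) ≤ B * (m * (r' + r'') - 2) := by
      have h5 := (Nat.ceil_lt_add_one (by positivity : 0 ≤ (n : ℝ) * R)).le
      have h6 : (n : ℝ) ≤ (B + L) * (m + 1) := by
        have : n ≤ (B + L) * (m + 1) := by rw [mul_comm]; exact hhigh.le
        exact_mod_cast this
      have h7 := mul_le_mul_of_nonneg_right h6 hR0
      linarith
    have hpow : ((2 ^ ⌈(n : ℝ) * R⌉₊ : ℕ) : ℝ) ≤ (((W * W'') ^ B : ℕ) : ℝ) := by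
      push_cast
      rw [← Real.rpow_natCast]
      refine (hmono hceil).trans ?_
      rw [mul_comm, Real.rpow_mul (by norm_num), Real.rpow_natCast]
      gcongr
      calc (2 : ℝ) ^ (m * (r' + r'') - 2) = 2 ^ (m * r' - 1) * 2 ^ (m * r'' - 1) := by
            rw [← Real.rpow_add (by norm_num)]; congr 1; ring
        _ ≤ W * W'' := by
            gcongr
            · exact two_rpow_sub_one_le_floor (by positivity)
            · exact two_rpow_sub_one_le_floor (by positivity)
    exact_mod_cast hpow
  · have hS := HasSchemes.iterate hδ E.Q_mem hblock (HasSchemes.of_block E.Q_mem hterm) B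
    rw [← hl] at hS
    obtain ⟨N, p, σ, hp, hlaw, hσ⟩ := hS
    refine ⟨N, p, σ, hp, hlaw, fun w k msg => ⟨(hσ w k msg).1.trans ?_, (hσ w k msg).2.trans ?_⟩⟩
    · have : B * ε₁ ≤ ε / 2 := by
        rw [hε₁, mul_div_assoc', div_le_div_iff₀ (by positivity) (by norm_num)]
        linarith
      linarith
    · have hΔ₀ : t₀.avg (fun u a x x₁ o v => δ o s₀) ≤ b := by
        rw [← t₀.avg_const b]; exact t₀.avg_mono fun _ _ _ _ _ _ => hδb _ _
      have hn' : (n : ℝ) = B * m + l := by exact_mod_cast hl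
      have hl' : (l : ℝ) ≤ L * m + (B + L) := by
        have h5 : (m + 1) * (B + L) = B * m + L * m + (B + L) := by ring
        have : l ≤ L * m + (B + L) := by omega
        exact_mod_cast this
      have hlb : (l : ℝ) * b ≤ n * (ε / 2) := by
        have e1 : (L : ℝ) * m * b ≤ B * m * (ε / 4) := by
          linarith [mul_le_mul_of_nonneg_left hBε hm0]
        have e2 : ((B : ℝ) + L) * b ≤ (B + L) * m * (ε / 4) := by
          have : (m₅ : ℝ) ≤ m := by exact_mod_cast (by omega : m₅ ≤ m)
          have h5 := hm₅.trans this
          rw [div_le_iff₀ hε] at h5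
          have : 0 ≤ (B : ℝ) + L := by positivity
          linarith [mul_le_mul_of_nonneg_left h5 this]
        have e3 : ((B : ℝ) + L) * m ≤ n := by
          have : (B + L) * m ≤ n := by rw [mul_comm]; exact hlow
          exact_mod_cast this
        have e4 : (B : ℝ) * m ≤ n := by rw [hn']; linarith [(Nat.cast_nonneg l : (0 : ℝ) ≤ l)]
        calc (l : ℝ) * b ≤ (L * m + (B + L)) * b := by gcongr
          _ = L * m * b + (B + L) * b := by ring
          _ ≤ B * m * (ε / 4) + (B + L) * m * (ε / 4) := add_le_add e1 e2
          _ ≤ n * (ε / 4) + n * (ε / 4) := by gcongr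
          _ = n * (ε / 2) := by ring
      have hl0 : (0 : ℝ) ≤ l := Nat.cast_nonneg l
      calc B * (m * (Δ + ε₁)) + l * (t₀.avg (fun u a x x₁ o v => δ o s₀) + ε / 2)
          ≤ B * (m * (Δ + ε / 2)) + l * (b + ε / 2) := by gcongr
        _ = (B * m) * Δ + (B * m + l) * (ε / 2) + l * b := by ring
        _ ≤ n * Δ + n * (ε / 2) + n * (ε / 2) := by
            rw [← hn']
            have : (B : ℝ) * m ≤ n := by rw [hn']; linarith
            gcongr
        _ = n * (Δ + ε) := by ring

end Rates

/-! ### From random schemes to codes -/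

lemma pmf_mem {α : Type*} [Fintype α] (p : PMF α) : (fun a => (p a).toReal) ∈ stdSimplex ℝ α := by
  refine ⟨fun a => ENNReal.toReal_nonneg, ?_⟩
  have h := p.tsum_coe
  rw [tsum_fintype] at h
  rw [← ENNReal.toReal_sum fun a _ => p.apply_ne_top a, h, ENNReal.toReal_one]

section Channel

variable {X X₁ S Sd Y Y₁ Shat : Type*} [Fintype S] [Fintype Sd] [Fintype Y] [Fintype Y₁]

/-- The law of `(S, S_d, Y, Y₁)` for given inputs. -/
noncomputable def channelLaw (ch : Channel X X₁ S Sd Y Y₁) (x : X) (x₁ : X₁)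
    (o : S × Sd × Y × Y₁) : ℝ :=
  (ch.state (o.1, o.2.1)).toReal * (ch.output x x₁ o.1 (o.2.2.1, o.2.2.2)).toReal

lemma channelLaw_mem (ch : Channel X X₁ S Sd Y Y₁) (x : X) (x₁ : X₁) :
    channelLaw ch x x₁ ∈ stdSimplex ℝ (S × Sd × Y × Y₁) := by
  refine ⟨fun o => mul_nonneg ENNReal.toReal_nonneg ENNReal.toReal_nonneg, ?_⟩
  have h1 := fun s => (pmf_mem (ch.output x x₁ s)).2
  have h2 := (pmf_mem ch.state).2
  simp only [Fintype.sum_prod_type] at h1 h2 ⊢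
  simp only [channelLaw, ← Finset.mul_sum, h1, mul_one, h2]

lemma sum_arrow_prod {ι α β : Type*} [Fintype ι] [DecidableEq ι] [Fintype α] [Fintype β]
    (G : (ι → α × β) → ℝ) : ∑ f, G f = ∑ a : ι → α, ∑ b : ι → β, G fun i => (a i, b i) := by
  rw [← Fintype.sum_prod_type']
  exact Fintype.sum_equiv (Equiv.arrowProdEquivProdArrow ι (fun _ => α) (fun _ => β)) _ _
    fun ω => rfl

/-- The code obtained from a scheme by fixing the initial state and labelling the messages. -/
noncomputable def Scheme.toCode {W K Msg : Type*} {M n : ℕ} [Nonempty Y₁] [Nonempty (Fin M)]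
    (σ : Scheme X X₁ Y Y₁ Shat W K Msg n) (w : W) (k : K) (f : Fin M → Msg) :
    Code X X₁ Y Y₁ Shat M n where
  enc j := σ.enc w (f j)
  relay i h := σ.rel w k
    (fun j => if hj : j < i then h ⟨j, hj⟩ else Classical.arbitrary Y₁) i
  dec y := Function.invFun f (σ.dec y).2.2
  est y := σ.est y

omit [Fintype Y] [Fintype Y₁] in
lemma Scheme.relayInput_toCode {W K Msg : Type*} {M n : ℕ} [Nonempty Y₁] [Nonempty (Fin M)]
    (σ : Scheme X X₁ Y Y₁ Shat W K Msg n) (w : W) (k : K) (f : Fin M → Msg) (y₁ : Fin n → Y₁)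
    (i : Fin n) : (σ.toCode w k f).relayInput y₁ i = σ.rel w k y₁ i := by
  refine σ.causal _ _ _ _ _ fun j hj => ?_
  rw [dif_pos hj]
  rfl

/-- Sums over the block law are means under the law of the scheme. -/
lemma sum_blockLaw_toCode {W K Msg : Type*} {M n : ℕ} [Nonempty Y₁] [Nonempty (Fin M)]
    (ch : Channel X X₁ S Sd Y Y₁) (σ : Scheme X X₁ Y Y₁ Shat W K Msg n) (w : W) (k : K)
    (f : Fin M → Msg) (F : Fin M → (Fin n → S × Sd × Y × Y₁) → ℝ) :
    ∑ j : Fin M, ∑ s : Fin n → S, ∑ sd : Fin n → Sd, ∑ y : Fin n → Y, ∑ y₁ : Fin n → Y₁,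
      blockLaw ch (σ.toCode w k f) j s sd y y₁ * F j (fun i => (s i, sd i, y i, y₁ i)) =
    1 / M * ∑ j, mean (σ.law (channelLaw ch) (fun o => o.2.2.2) w w k (f j)) (F j) := by
  rw [Finset.mul_sum]
  refine Finset.sum_congr rfl fun j _ => ?_
  simp only [mean, sum_arrow_prod, Finset.mul_sum]
  refine Finset.sum_congr rfl fun s _ => Finset.sum_congr rfl fun sd _ =>
    Finset.sum_congr rfl fun y _ => Finset.sum_congr rfl fun y₁ _ => ?_
  simp only [blockLaw, Scheme.law, channelLaw, Scheme.relayInput_toCode, mul_assoc]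
  rfl

variable {ch : Channel X X₁ S Sd Y Y₁} {d : Sd → Shat → ℝ}

/-- A single member of a random scheme has small error probability and distortion: it minimizes
a weighted sum of both. -/
lemma exists_code_of_hasSchemes {W K Msg : Type*} [Fintype Msg] {M n : ℕ} [Nonempty Y₁]
    (hM : M ≠ 0) (hn : 0 < n) (w : W) (k : K)
    (hcard : M ≤ Fintype.card Msg) {b ε c lam : ℝ} (hd : ∀ s s', 0 ≤ d s s')
    (hdb : ∀ s s', d s s' ≤ b) (hb : 0 ≤ b) (hlam : 0 < lam)
    (h : HasSchemes (channelLaw ch) (fun o => o.2.2.1) (fun o => o.2.2.2)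
      (fun o (s : Shat) => d o.2.1 s) W K Msg n ε c) :
    ∃ code : Code X X₁ Y Y₁ Shat M n,
      errorProb ch code ≤ ε + (c / n + b * ε) / lam ∧
      avgDistortion ch d code ≤ c / n + b * ε + lam * ε := by
  have hMne : Nonempty (Fin M) := ⟨⟨0, Nat.pos_of_ne_zero hM⟩⟩
  have hM0 : (0 : ℝ) < M := by exact_mod_cast Nat.pos_of_ne_zero hM
  have hn0 : (0 : ℝ) < n := by exact_mod_cast hn
  obtain ⟨f⟩ : Nonempty (Fin M ↪ Msg) := by
    rw [Function.Embedding.nonempty_iff_card_le, Fintype.card_fin]; exact hcard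
  obtain ⟨N, p, σ, hp, hlaw, hσ⟩ := h
  set P := fun i j => (σ i).law (channelLaw ch) (fun o : S × Sd × Y × Y₁ => o.2.2.2) w w k (f j)
    with hP
  set fl : Fin N → Fin M → ℝ := fun i j => mean (P i j) fun o =>
    ind (¬ (σ i).Good w k (f j) (fun l => (o l).2.2.1) (fun l => (o l).2.2.2)) with hfl
  set co : Fin N → Fin M → ℝ := fun i j => mean (P i j) fun o =>
    ind ((σ i).Good w k (f j) (fun l => (o l).2.2.1) (fun l => (o l).2.2.2)) *
      ∑ l, d (o l).2.1 ((σ i).est (fun l => (o l).2.2.1) l) with hco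
  have hfl0 : ∀ i j, 0 ≤ fl i j := fun i j => mean_nonneg (hlaw _ _ _ _ _) fun _ => ind_nonneg _
  have hco0 : ∀ i j, 0 ≤ co i j := fun i j => mean_nonneg (hlaw _ _ _ _ _) fun _ =>
    mul_nonneg (ind_nonneg _) (Finset.sum_nonneg fun _ _ => hd _ _)
  have herr : ∀ i, errorProb ch ((σ i).toCode w k f) ≤ 1 / M * ∑ j, fl i j := by
    intro i
    have h1 := sum_blockLaw_toCode ch (σ i) w k f fun j o =>
      ind (((σ i).toCode w k f).dec (fun l => (o l).2.2.1) ≠ j)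
    have h2 : errorProb ch ((σ i).toCode w k f) = _ := Eq.trans (by
      unfold errorProb
      refine Finset.sum_congr rfl fun j _ => Finset.sum_congr rfl fun s _ =>
        Finset.sum_congr rfl fun sd _ => Finset.sum_congr rfl fun y _ =>
        Finset.sum_congr rfl fun y₁ _ => ?_
      by_cases hne : ((σ i).toCode w k f).dec y ≠ j
      · rw [if_pos hne, ind_true hne, mul_one]
      · rw [if_neg hne, ind_false hne, mul_zero]) h1
    rw [h2]
    gcongr with j _
    refine mean_mono (hlaw _ _ _ _ _) fun o => ind_mono fun hne hg => hne ?_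
    simp only [Scheme.toCode, (σ i).dec_eq _ _ _ _ _ hg]
    exact Function.leftInverse_invFun f.injective j
  have hdist : ∀ i, avgDistortion ch d ((σ i).toCode w k f) ≤
      1 / M * ∑ j, (co i j / n + b * fl i j) := by
    intro i
    have h1 := sum_blockLaw_toCode ch (σ i) w k f fun _ o =>
      1 / (n : ℝ) * ∑ l, d (o l).2.1 ((σ i).est (fun l => (o l).2.2.1) l)
    have h2 : avgDistortion ch d ((σ i).toCode w k f) = _ := h1
    rw [h2]
    gcongr with j _
    rw [hco, hfl, ← mean_div, ← mean_mul_left, ← mean_add]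
    refine mean_mono (hlaw _ _ _ _ _) fun o => ?_
    by_cases hg : (σ i).Good w k (f j) (fun l => (o l).2.2.1) (fun l => (o l).2.2.2)
    · rw [ind_true hg, ind_false (not_not.2 hg)]
      apply le_of_eq; ring
    · rw [ind_false hg, ind_true hg]
      have h3 : ∑ l, d (o l).2.1 ((σ i).est (fun l => (o l).2.2.1) l) ≤ n * b := by
        refine (Finset.sum_le_sum fun l _ => hdb _ _).trans ?_
        simp
      rw [zero_mul, zero_div, zero_add, mul_one, one_div, inv_mul_le_iff₀ hn0]
      exact h3
  -- the means of the averages over the messages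
  have hmean : ∀ (F : Fin N → Fin M → ℝ) (z : ℝ), (∀ j, mean p (fun i => F i j) ≤ z) →
      mean p (fun i => 1 / M * ∑ j, F i j) ≤ z := by
    intro F z hz
    rw [mean_mul_left, mean_sum, one_div, inv_mul_le_iff₀ hM0]
    refine (Finset.sum_le_sum fun j _ => hz j).trans ?_
    simp
  have hm1 := hmean fl ε fun j => (hσ w k (f j)).1
  have hm2 := hmean (fun i j => co i j / n + b * fl i j) (c / n + b * ε) fun j => by
    rw [mean_add, mean_div, mean_mul_left]
    have h1 := (hσ w k (f j)).1
    have h2 := (hσ w k (f j)).2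
    gcongr
  have hNne : Nonempty (Fin N) := by
    by_contra hne
    have h1 := hp.2
    have : IsEmpty (Fin N) := not_nonempty_iff.1 hne
    simp at h1
  obtain ⟨i, hi⟩ := exists_le_mean hp fun i => lam * (1 / M * ∑ j, fl i j) +
    1 / M * ∑ j, (co i j / n + b * fl i j)
  rw [mean_add, mean_mul_left] at hi
  have hi' := hi.trans (add_le_add (mul_le_mul_of_nonneg_left hm1 hlam.le) hm2)
  have n1 : 0 ≤ 1 / (M : ℝ) * ∑ j, fl i j :=
    mul_nonneg (by positivity) (Finset.sum_nonneg fun j _ => hfl0 i j)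
  have n2 : 0 ≤ 1 / (M : ℝ) * ∑ j, (co i j / n + b * fl i j) :=
    mul_nonneg (by positivity) (Finset.sum_nonneg fun j _ =>
      add_nonneg (div_nonneg (hco0 i j) hn0.le) (mul_nonneg hb (hfl0 i j)))
  refine ⟨(σ i).toCode w k f, (herr i).trans ?_, (hdist i).trans ?_⟩
  · rw [← sub_le_iff_le_add', le_div_iff₀ hlam]
    linarith
  · linarith [mul_nonneg hlam.le n1]

lemma errorProb_nonneg {M n : ℕ} (code : Code X X₁ Y Y₁ Shat M n) : 0 ≤ errorProb ch code := by
  unfold errorProb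
  refine Finset.sum_nonneg fun _ _ => Finset.sum_nonneg fun _ _ => Finset.sum_nonneg fun _ _ =>
    Finset.sum_nonneg fun _ _ => Finset.sum_nonneg fun _ _ => ?_
  split_ifs
  · unfold blockLaw; positivity
  · exact le_rfl

lemma avgDistortion_nonneg {M n : ℕ} (hd : ∀ s s', 0 ≤ d s s') (code : Code X X₁ Y Y₁ Shat M n) :
    0 ≤ avgDistortion ch d code := by
  unfold avgDistortion
  refine Finset.sum_nonneg fun _ _ => Finset.sum_nonneg fun _ _ => Finset.sum_nonneg fun _ _ =>
    Finset.sum_nonneg fun _ _ => Finset.sum_nonneg fun _ _ => mul_nonneg ?_ ?_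
  · unfold blockLaw; positivity
  · exact mul_nonneg (by positivity) (Finset.sum_nonneg fun _ _ => hd _ _)

/-- Achievability from codes that are good up to every `ε`. -/
lemma achievable_of_forall_eventually [Nonempty X] [Nonempty X₁] [Nonempty Shat] {R D : ℝ}
    (hd : ∀ s s', 0 ≤ d s s')
    (h : ∀ ε : ℝ, 0 < ε → ∀ᶠ n : ℕ in atTop, ∃ code : Code X X₁ Y Y₁ Shat (numMessages R n) n,
      errorProb ch code ≤ ε ∧ avgDistortion ch d code ≤ D + ε) : Achievable ch d R D := by
  classical
  -- for every length the code minimizes the larger of the two excesses, up to `1 / (n + 1)`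
  let g : (n : ℕ) → Code X X₁ Y Y₁ Shat (numMessages R n) n → ℝ := fun n code =>
    max (errorProb ch code) (avgDistortion ch d code - D)
  have hg0 : ∀ n code, 0 ≤ g n code := fun n code => le_max_of_le_left (errorProb_nonneg code)
  have hbdd : ∀ n, BddBelow (Set.range (g n)) := fun n => ⟨0, by rintro _ ⟨c, rfl⟩; exact hg0 n c⟩
  have hne : ∀ n, Nonempty (Code X X₁ Y Y₁ Shat (numMessages R n) n) := fun n =>
    ⟨{ enc := fun _ _ => Classical.arbitrary X
       relay := fun _ _ => Classical.arbitrary X₁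
       dec := fun _ => ⟨0, by unfold numMessages; positivity⟩
       est := fun _ _ => Classical.arbitrary Shat }⟩
  have hex : ∀ n : ℕ, ∃ code, g n code < (⨅ c, g n c) + 1 / ((n : ℝ) + 1) := fun n => by
    have := hne n
    exact exists_lt_of_ciInf_lt (lt_add_of_pos_right _ (by positivity))
  choose code hcode using hex
  have hlim : ∀ ε : ℝ, 0 < ε → ∀ᶠ n in atTop, g n (code n) < ε := by
    intro ε hε
    have h1 := h (ε / 2) (half_pos hε)
    have h2 : ∀ᶠ n : ℕ in atTop, 1 / ((n : ℝ) + 1) < ε / 2 :=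
      tendsto_one_div_add_atTop_nhds_zero_nat.eventually_lt_const (half_pos hε)
    filter_upwards [h1, h2] with n ⟨c, hc1, hc2⟩ hn
    have h3 : g n c ≤ ε / 2 := max_le hc1 (by linarith)
    have h4 := ciInf_le (hbdd n) c
    linarith [hcode n]
  refine ⟨code, ?_, ?_⟩
  · rw [Metric.tendsto_atTop]
    intro ε hε
    obtain ⟨N, hN⟩ := eventually_atTop.1 (hlim ε hε)
    refine ⟨N, fun n hn => ?_⟩
    rw [Real.dist_0_eq_abs, abs_of_nonneg (errorProb_nonneg _)]
    exact (le_max_left _ _).trans_lt (hN n hn)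
  · refine le_of_forall_pos_le_add fun ε hε => ?_
    refine limsup_le_of_le ?_ ?_
    · exact isCoboundedUnder_le_of_le atTop (x := 0) fun n => avgDistortion_nonneg hd _
    · filter_upwards [hlim ε hε] with n hn
      have := (le_max_right _ _).trans hn.le
      linarith

end Channel

/-! ### Entropies as means of log-likelihoods -/

section Entropy

variable {Ω α β γ : Type*} [Fintype Ω] [Fintype α] [Fintype β] [Fintype γ] {p : Ω → ℝ}

omit [Fintype α] in
lemma marg_nonneg (hp : ∀ ω, 0 ≤ p ω) (f : Ω → α) (a : α) : 0 ≤ marg p f a :=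
  Finset.sum_nonneg fun ω _ => by split_ifs <;> simp [hp]

omit [Fintype α] in
lemma le_marg (hp : ∀ ω, 0 ≤ p ω) (f : Ω → α) (ω : Ω) : p ω ≤ marg p f (f ω) := by
  classical
  unfold marg
  refine le_trans ?_ (Finset.single_le_sum (f := fun ω' => if f ω' = f ω then p ω' else 0)
    (fun ω' _ => ?_) (Finset.mem_univ ω))
  · simp
  · split_ifs <;> simp [hp]

/-- Change of variables for a random variable. -/
lemma sum_marg_mul (p : Ω → ℝ) (f : Ω → α) (F : α → ℝ) :
    ∑ a, marg p f a * F a = ∑ ω, p ω * F (f ω) := by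
  classical
  simp only [marg, Finset.sum_mul, ite_mul, zero_mul]
  rw [Finset.sum_comm]
  simp

lemma sum_marg (p : Ω → ℝ) (f : Ω → α) : ∑ a, marg p f a = ∑ ω, p ω := by
  simpa using sum_marg_mul p f fun _ => 1

omit [Fintype β] in
lemma marg_marg (p : Ω → ℝ) (f : Ω → α) (g : α → β) :
    marg (marg p f) g = marg p fun ω => g (f ω) := by
  classical
  funext b
  have := sum_marg_mul p f fun a => if g a = b then 1 else 0
  simp only [mul_ite, mul_one, mul_zero] at this
  exact this

omit [Fintype β] in
lemma sum_marg_prod (p : Ω → ℝ) (f : Ω → α) (g : Ω → β) (b : β) :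
    ∑ a, marg p (fun ω => (f ω, g ω)) (a, b) = marg p g b := by
  classical
  simp only [marg, Prod.mk.injEq]
  rw [Finset.sum_comm]
  refine Finset.sum_congr rfl fun ω _ => ?_
  by_cases h : g ω = b <;> simp [h]

omit [Fintype α] [Fintype β] in
lemma marg_congr {f : Ω → α} {g : Ω → β} {a : α} {b : β} (h : ∀ ω, f ω = a ↔ g ω = b) :
    marg p f a = marg p g b := by
  unfold marg
  refine Finset.sum_congr rfl fun ω _ => ?_
  by_cases hg : g ω = b
  · rw [if_pos hg, if_pos ((h ω).2 hg)]
  · rw [if_neg hg, if_neg (mt (h ω).1 hg)]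

/-- The mean log-likelihood of a random variable, `-H(f)`. -/
noncomputable def meanLog (p : Ω → ℝ) (f : Ω → α) : ℝ :=
  mean p fun ω => Real.logb 2 (marg p f (f ω))

lemma entropy_eq (p : Ω → ℝ) (f : Ω → α) : entropy p f = -meanLog p f := by
  rw [entropy, meanLog, mean, sum_marg_mul p f fun a => Real.logb 2 (marg p f a)]

/-- The mean log-likelihood depends only on the partition that the random variable induces. -/
lemma meanLog_congr {f : Ω → α} {g : Ω → β} (h : ∀ ω ω', f ω = f ω' ↔ g ω = g ω') :
    meanLog p f = meanLog p g := by
  unfold meanLog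
  congr 1
  funext ω
  rw [marg_congr fun ω' => h ω' ω]

lemma meanLog_marg (p : Ω → ℝ) (f : Ω → α) (g : α → β) :
    meanLog (marg p f) g = meanLog p fun ω => g (f ω) := by
  simp only [meanLog, mean, marg_marg]
  exact sum_marg_mul p f fun a => Real.logb 2 (marg p (fun ω => g (f ω)) (g a))

lemma condMutualInfo_eq (p : Ω → ℝ) (f : Ω → α) (g : Ω → β) (h : Ω → γ) :
    condMutualInfo p f g h = meanLog p (fun ω => (f ω, g ω, h ω)) + meanLog p h -
      meanLog p (fun ω => (f ω, h ω)) - meanLog p (fun ω => (g ω, h ω)) := by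
  simp only [condMutualInfo, condEntropy, entropy_eq]
  ring

lemma mutualInfo_eq (p : Ω → ℝ) (f : Ω → α) (g : Ω → β) :
    mutualInfo p f g = meanLog p (fun ω => (f ω, g ω)) - meanLog p f - meanLog p g := by
  simp only [mutualInfo, condEntropy, entropy_eq]
  ring

/-- The conditionally independent coupling of `(f, h)` and `(g, h)`. -/
noncomputable def condProd (p : Ω → ℝ) (f : Ω → α) (g : Ω → β) (h : Ω → γ) (i : α × β × γ) : ℝ :=
  marg p (fun ω => (f ω, h ω)) (i.1, i.2.2) * marg p (fun ω => (g ω, h ω)) i.2 / marg p h i.2.2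

variable (f : Ω → α) (g : Ω → β) (h : Ω → γ)

lemma condProd_nonneg (hp : ∀ ω, 0 ≤ p ω) (i : α × β × γ) : 0 ≤ condProd p f g h i :=
  div_nonneg (mul_nonneg (marg_nonneg hp _ _) (marg_nonneg hp _ _)) (marg_nonneg hp _ _)

lemma sum_condProd : ∑ i, condProd p f g h i = ∑ ω, p ω := by
  simp only [condProd, Fintype.sum_prod_type_right]
  have h1 : ∀ (b : β) (c : γ), ∑ a, marg p (fun ω => (f ω, h ω)) (a, c) *
      marg p (fun ω => (g ω, h ω)) (b, c) / marg p h c =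
      marg p h c * marg p (fun ω => (g ω, h ω)) (b, c) / marg p h c := fun b c => by
    rw [← Finset.sum_div, ← Finset.sum_mul, sum_marg_prod p f h]
  simp only [h1]
  rw [← sum_marg p h]
  refine Finset.sum_congr rfl fun c _ => ?_
  rw [← Finset.sum_div, ← Finset.mul_sum, sum_marg_prod p g h, mul_self_div_self]

lemma pos_of_marg_pos (hp : ∀ ω, 0 ≤ p ω) {i : α × β × γ}
    (hi : 0 < marg p (fun ω => (f ω, g ω, h ω)) i) :
    0 < marg p (fun ω => (f ω, h ω)) (i.1, i.2.2) ∧ 0 < marg p (fun ω => (g ω, h ω)) i.2 ∧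
      0 < marg p h i.2.2 := by
  classical
  obtain ⟨ω, -, hω⟩ := Finset.exists_ne_zero_of_sum_ne_zero hi.ne'
  have hfi : (f ω, g ω, h ω) = i := by
    by_contra hne; exact hω (if_neg hne)
  rw [if_pos hfi] at hω
  subst hfi
  have hpos := lt_of_le_of_ne (hp ω) hω.symm
  exact ⟨hpos.trans_le (le_marg hp (fun ω => (f ω, h ω)) ω),
    hpos.trans_le (le_marg hp (fun ω => (g ω, h ω)) ω), hpos.trans_le (le_marg hp h ω)⟩

/-- Conditional mutual information is a relative entropy. -/
lemma condMutualInfo_eq_sum (hp : p ∈ stdSimplex ℝ Ω) :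
    condMutualInfo p f g h * Real.log 2 = ∑ i, condProd p f g h i *
      InformationTheory.klFun (marg p (fun ω => (f ω, g ω, h ω)) i / condProd p f g h i) := by
  have hterm : ∀ i, condProd p f g h i *
      InformationTheory.klFun (marg p (fun ω => (f ω, g ω, h ω)) i / condProd p f g h i) =
      marg p (fun ω => (f ω, g ω, h ω)) i * (Real.log (marg p (fun ω => (f ω, g ω, h ω)) i) +
        Real.log (marg p h i.2.2) - Real.log (marg p (fun ω => (f ω, h ω)) (i.1, i.2.2)) -
        Real.log (marg p (fun ω => (g ω, h ω)) i.2)) + condProd p f g h i -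
        marg p (fun ω => (f ω, g ω, h ω)) i := by
    intro i
    rcases (marg_nonneg hp.1 (fun ω => (f ω, g ω, h ω)) i).eq_or_lt with h0 | hpos
    · rw [← h0]
      simp [InformationTheory.klFun]
    · obtain ⟨h1, h2, h3⟩ := pos_of_marg_pos f g h hp.1 hpos
      have h4 : 0 < condProd p f g h i := div_pos (mul_pos h1 h2) h3
      rw [InformationTheory.klFun, Real.log_div hpos.ne' h4.ne', condProd,
        Real.log_div (mul_pos h1 h2).ne' h3.ne', Real.log_mul h1.ne' h2.ne']
      field_simp
      ring
  simp only [hterm]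
  rw [Finset.sum_sub_distrib, Finset.sum_add_distrib, sum_condProd, sum_marg,
    sum_marg_mul p (fun ω => (f ω, g ω, h ω)) fun i =>
      Real.log (marg p (fun ω => (f ω, g ω, h ω)) i) +
        Real.log (marg p h i.2.2) - Real.log (marg p (fun ω => (f ω, h ω)) (i.1, i.2.2)) -
        Real.log (marg p (fun ω => (g ω, h ω)) i.2), add_sub_cancel_right, condMutualInfo_eq]
  have hlog : Real.log 2 ≠ 0 := (Real.log_pos one_lt_two).ne'
  simp only [meanLog, mean, Real.logb, ← Finset.sum_add_distrib, ← Finset.sum_sub_distrib,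
    Finset.sum_mul]
  refine Finset.sum_congr rfl fun ω _ => ?_
  field_simp

lemma condMutualInfo_nonneg (hp : p ∈ stdSimplex ℝ Ω) : 0 ≤ condMutualInfo p f g h := by
  have h1 := condMutualInfo_eq_sum f g h hp
  have h2 : 0 ≤ condMutualInfo p f g h * Real.log 2 := by
    rw [h1]
    exact Finset.sum_nonneg fun i _ => mul_nonneg (condProd_nonneg f g h hp.1 i)
      (InformationTheory.klFun_nonneg (div_nonneg (marg_nonneg hp.1 _ _)
        (condProd_nonneg f g h hp.1 i)))
  exact nonneg_of_mul_nonneg_left h2 (Real.log_pos one_lt_two)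

/-- If the conditional mutual information vanishes, then the joint law is the conditionally
independent coupling. -/
lemma marg_eq_condProd (hp : p ∈ stdSimplex ℝ Ω) (h0 : condMutualInfo p f g h = 0)
    (i : α × β × γ) : marg p (fun ω => (f ω, g ω, h ω)) i = condProd p f g h i := by
  have h1 := condMutualInfo_eq_sum f g h hp
  rw [h0, zero_mul, eq_comm, Finset.sum_eq_zero_iff_of_nonneg fun i _ =>
    mul_nonneg (condProd_nonneg f g h hp.1 i) (InformationTheory.klFun_nonneg
      (div_nonneg (marg_nonneg hp.1 _ _) (condProd_nonneg f g h hp.1 i)))] at h1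
  rcases mul_eq_zero.1 (h1 i (Finset.mem_univ i)) with h2 | h2
  · rcases (marg_nonneg hp.1 (fun ω => (f ω, g ω, h ω)) i).eq_or_lt with h3 | hpos
    · rw [h2, ← h3]
    · obtain ⟨h4, h5, h6⟩ := pos_of_marg_pos f g h hp.1 hpos
      exact absurd h2 (div_pos (mul_pos h4 h5) h6).ne'
  · rw [InformationTheory.klFun_eq_zero_iff (div_nonneg (marg_nonneg hp.1 _ _)
      (condProd_nonneg f g h hp.1 i))] at h2
    exact eq_of_div_eq_one h2

end Entropy

/-! ### The description of a choice of distributions -/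

section Likelihood

variable {Ω α β γ : Type*} [Fintype Ω] [Fintype α] [Fintype β] [Fintype γ] {p : Ω → ℝ}

lemma condProb_nonneg (hp : ∀ ω, 0 ≤ p ω) (f : Ω → α) (g : Ω → β) (a : α) (b : β) :
    0 ≤ condProb p f g a b := div_nonneg (marg_nonneg hp _ _) (marg_nonneg hp _ _)

lemma sum_condProb_le (p : Ω → ℝ) (f : Ω → α) (g : Ω → β) (b : β) :
    ∑ a, condProb p f g a b ≤ 1 := by
  simp only [condProb]
  rw [← Finset.sum_div, sum_marg_prod]
  exact div_self_le_one _

lemma condProb_pos (hp : ∀ ω, 0 ≤ p ω) (f : Ω → α) (g : Ω → β) {ω : Ω} (hω : 0 < p ω) :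
    0 < condProb p f g (f ω) (g ω) :=
  div_pos (hω.trans_le (le_marg hp (fun ω => (f ω, g ω)) ω)) (hω.trans_le (le_marg hp g ω))

/-- A likelihood ratio has mean at most one under its denominator. -/
lemma mean_condProb_div_le (hp : ∀ ω, 0 ≤ p ω) (f : Ω → α) (g : Ω → β) (P : α → ℝ) (b : β) :
    mean P (fun a => condProb p f g a b / P a) ≤ 1 := by
  refine le_trans (Finset.sum_le_sum fun a _ => ?_) (sum_condProb_le p f g b)
  by_cases h : P a = 0
  · simp [h, condProb_nonneg hp]
  · rw [mul_div_cancel₀ _ h]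

lemma mean_congr_of_pos (hp : ∀ ω, 0 ≤ p ω) {f g : Ω → ℝ} (h : ∀ ω, 0 < p ω → f ω = g ω) :
    mean p f = mean p g := by
  refine Finset.sum_congr rfl fun ω _ => ?_
  rcases (hp ω).eq_or_lt with h0 | h0
  · rw [← h0, zero_mul, zero_mul]
  · rw [h ω h0]

lemma mean_logb_mul (hp : ∀ ω, 0 ≤ p ω) {f g : Ω → ℝ} (hf : ∀ ω, 0 < p ω → 0 < f ω)
    (hg : ∀ ω, 0 < p ω → 0 < g ω) : mean p (fun ω => Real.logb 2 (f ω * g ω)) =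
      mean p (fun ω => Real.logb 2 (f ω)) + mean p fun ω => Real.logb 2 (g ω) := by
  rw [← mean_add]
  exact mean_congr_of_pos hp fun ω hω => Real.logb_mul (hf ω hω).ne' (hg ω hω).ne'

lemma mean_logb_div (hp : ∀ ω, 0 ≤ p ω) {f g : Ω → ℝ} (hf : ∀ ω, 0 < p ω → 0 < f ω)
    (hg : ∀ ω, 0 < p ω → 0 < g ω) : mean p (fun ω => Real.logb 2 (f ω / g ω)) =
      mean p (fun ω => Real.logb 2 (f ω)) - mean p fun ω => Real.logb 2 (g ω) := by
  rw [← mean_sub]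
  exact mean_congr_of_pos hp fun ω hω => Real.logb_div (hf ω hω).ne' (hg ω hω).ne'

lemma mean_logb_condProb_div (hp : ∀ ω, 0 ≤ p ω) (f : Ω → α) (g : Ω → β) {k : Ω → ℝ}
    (hk : ∀ ω, 0 < p ω → 0 < k ω) :
    mean p (fun ω => Real.logb 2 (condProb p f g (f ω) (g ω) / k ω)) =
      meanLog p (fun ω => (f ω, g ω)) - meanLog p g - mean p fun ω => Real.logb 2 (k ω) := by
  rw [mean_logb_div hp (fun ω hω => condProb_pos hp f g hω) hk]
  congr 1
  exact mean_logb_div hp (fun ω hω => hω.trans_le (le_marg hp (fun ω => (f ω, g ω)) ω))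
    fun ω hω => hω.trans_le (le_marg hp g ω)

omit [Fintype α] in
/-- Chain rule for a factorization of a law. -/
lemma meanLog_eq_add (hp : ∀ ω, 0 ≤ p ω) {f : Ω → α} {g : Ω → β} {k : Ω → ℝ}
    (hk : ∀ ω, 0 < p ω → 0 < k ω) (h : ∀ ω, marg p f (f ω) = marg p g (g ω) * k ω) :
    meanLog p f = meanLog p g + mean p fun ω => Real.logb 2 (k ω) := by
  simp only [meanLog, h]
  exact mean_logb_mul hp (fun ω hω => hω.trans_le (le_marg hp g ω)) hk

end Likelihood

section Choice

variable {U A X X₁ S Sd Y Y₁ V : Type*} [Fintype U] [Fintype A] [Fintype X] [Fintype X₁]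
  [Fintype S] [Fintype Sd] [Fintype Y] [Fintype Y₁] [Fintype V]
  (ch : Channel X X₁ S Sd Y Y₁) (q : Choice U A X X₁ Y₁ V)

/-- The law of the codewords, together with the channel. -/
noncomputable def Choice.ensemble : Ensemble U A X X₁ (S × Sd × Y × Y₁) Y Y₁ where
  pU u := (q.pU u).toReal
  pA u a := (q.pA u a).toReal
  pX u a x := (q.pX u a x).toReal
  pX₁ u x₁ := (q.pX₁ u x₁).toReal
  Q := channelLaw ch
  outY o := o.2.2.1
  outY₁ o := o.2.2.2
  pU_mem := pmf_mem _
  pA_mem _ := pmf_mem _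
  pX_mem _ _ := pmf_mem _
  pX₁_mem _ := pmf_mem _
  Q_mem := channelLaw_mem ch

omit [Fintype U] [Fintype A] [Fintype X] [Fintype X₁] [Fintype S] [Fintype Sd] [Fintype Y]
  [Fintype Y₁] [Fintype V] in
lemma jointLaw_nonneg (ω : Sample U A X X₁ S Sd Y Y₁ V) : 0 ≤ jointLaw ch q ω := by
  unfold jointLaw
  positivity

/-- The law of `V` given `U, A, X₁`. -/
noncomputable def Choice.condV (u : U) (a : A) (x₁ : X₁) (v : V) : ℝ :=
  mean (fun x => (q.pX u a x).toReal) fun x => mean (channelLaw ch x x₁) fun o =>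
    (q.pV u a x₁ o.2.2.2 v).toReal

omit [Fintype U] [Fintype A] [Fintype X₁] in
lemma Choice.condV_mem (u : U) (a : A) (x₁ : X₁) : q.condV ch u a x₁ ∈ stdSimplex ℝ V := by
  refine ⟨fun v => mean_nonneg (pmf_mem _) fun x => mean_nonneg (channelLaw_mem ch _ _) fun o =>
    ENNReal.toReal_nonneg, ?_⟩
  have h : ∀ y₁, ∑ v, (q.pV u a x₁ y₁ v).toReal = 1 := fun y₁ => (pmf_mem _).2
  simp only [Choice.condV]
  rw [← mean_sum]
  simp only [← mean_sum, h, mean_const (channelLaw_mem ch _ _), mean_const (pmf_mem (q.pX u a))]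

/-- The description `V` of a choice of distributions. The test functions are the likelihood ratios
of the true law of the tested words given what the decoder knows, and of the law from which
independent codewords are drawn. -/
noncomputable def Choice.description : Description (q.ensemble ch) V where
  pV u a x₁ y₁ v := (q.pV u a x₁ y₁ v).toReal
  r := q.condV ch
  pV_mem _ _ _ _ := pmf_mem _
  r_mem := q.condV_mem ch
  τ₀ u a x₁ y₁ := condProb (jointLaw ch q) rA (fun ω => (rU ω, rX₁ ω, rY₁ ω)) a (u, x₁, y₁) /
    (q.pA u a).toReal
  τ₁ u a x x₁ v y := condProb (jointLaw ch q) rX (fun ω => (rU ω, rA ω, rX₁ ω, rV ω, rY ω)) x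
    (u, a, x₁, v, y) / (q.pX u a x).toReal
  τ₂ u a x x₁ v y := condProb (jointLaw ch q) (fun ω => (rX ω, rX₁ ω, rV ω))
    (fun ω => (rU ω, rA ω, rY ω)) (x, x₁, v) (u, a, y) /
    ((q.pX u a x).toReal * ((q.pX₁ u x₁).toReal * q.condV ch u a x₁ v))
  τ₃ u a x x₁ v y := condProb (jointLaw ch q) (fun ω => (rX₁ ω, rV ω))
    (fun ω => (rU ω, rA ω, rX ω, rY ω)) (x₁, v) (u, a, x, y) /
    ((q.pX₁ u x₁).toReal * q.condV ch u a x₁ v)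
  τ₄ u a x x₁ v y := condProb (jointLaw ch q) (fun ω => (rU ω, rA ω, rX ω, rX₁ ω, rV ω)) rY
    (u, a, x, x₁, v) y / ((q.pU u).toReal * ((q.pA u a).toReal * ((q.pX u a x).toReal *
      ((q.pX₁ u x₁).toReal * q.condV ch u a x₁ v))))
  τ₀_nonneg u a x₁ y₁ := div_nonneg (condProb_nonneg (jointLaw_nonneg ch q) _ _ _ _)
    ENNReal.toReal_nonneg
  τ₁_nonneg u a x x₁ v y := div_nonneg (condProb_nonneg (jointLaw_nonneg ch q) _ _ _ _)
    ENNReal.toReal_nonneg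
  τ₂_nonneg u a x x₁ v y := by
    have := (q.condV_mem ch u a x₁).1 v
    have := condProb_nonneg (jointLaw_nonneg ch q) (fun ω => (rX ω, rX₁ ω, rV ω))
      (fun ω => (rU ω, rA ω, rY ω)) (x, x₁, v) (u, a, y)
    positivity
  τ₃_nonneg u a x x₁ v y := by
    have := (q.condV_mem ch u a x₁).1 v
    have := condProb_nonneg (jointLaw_nonneg ch q) (fun ω => (rX₁ ω, rV ω))
      (fun ω => (rU ω, rA ω, rX ω, rY ω)) (x₁, v) (u, a, x, y)
    positivity
  τ₄_nonneg u a x x₁ v y := by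
    have := (q.condV_mem ch u a x₁).1 v
    have := condProb_nonneg (jointLaw_nonneg ch q) (fun ω => (rU ω, rA ω, rX ω, rX₁ ω, rV ω)) rY
      (u, a, x, x₁, v) y
    positivity
  τ₀_mean u x₁ y₁ := mean_condProb_div_le (jointLaw_nonneg ch q) _ _ _ _
  τ₁_mean u a x₁ v y := mean_condProb_div_le (jointLaw_nonneg ch q) _ _ _ _
  τ₂_mean u a y := by
    have h := mean_condProb_div_le (jointLaw_nonneg ch q) (fun ω => (rX ω, rX₁ ω, rV ω))
      (fun ω => (rU ω, rA ω, rY ω)) (pairLaw (fun x => (q.pX u a x).toReal) fun _ =>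
        pairLaw (fun x₁ => (q.pX₁ u x₁).toReal) fun x₁ => q.condV ch u a x₁) (u, a, y)
    rw [mean_pairLaw] at h
    simp only [mean_pairLaw] at h
    exact h
  τ₃_mean u a x y := by
    have h := mean_condProb_div_le (jointLaw_nonneg ch q) (fun ω => (rX₁ ω, rV ω))
      (fun ω => (rU ω, rA ω, rX ω, rY ω)) (pairLaw (fun x₁ => (q.pX₁ u x₁).toReal) fun x₁ =>
        q.condV ch u a x₁) (u, a, x, y)
    rw [mean_pairLaw] at h
    exact h
  τ₄_mean y := by
    have h := mean_condProb_div_le (jointLaw_nonneg ch q)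
      (fun ω => (rU ω, rA ω, rX ω, rX₁ ω, rV ω)) rY (pairLaw (fun u => (q.pU u).toReal) fun u =>
        pairLaw (fun a => (q.pA u a).toReal) fun a => pairLaw (fun x => (q.pX u a x).toReal)
        fun _ => pairLaw (fun x₁ => (q.pX₁ u x₁).toReal) fun x₁ => q.condV ch u a x₁) y
    rw [mean_pairLaw] at h
    simp only [mean_pairLaw] at h
    exact h

lemma law_description (ω : Sample U A X X₁ S Sd Y Y₁ V) : (q.description ch).law
    (rU ω, rA ω, rX ω, rX₁ ω, (rS ω, rSd ω, rY ω, rY₁ ω), rV ω) = jointLaw ch q ω := by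
  simp only [Description.law, pairLaw, jointLaw, Choice.description, Choice.ensemble, channelLaw,
    mul_assoc]

lemma avg_description (F : U → A → X → X₁ → S × Sd × Y × Y₁ → V → ℝ) :
    (q.description ch).avg F = mean (jointLaw ch q) fun ω =>
      F (rU ω) (rA ω) (rX ω) (rX₁ ω) (rS ω, rSd ω, rY ω, rY₁ ω) (rV ω) := by
  let e : Sample U A X X₁ S Sd Y Y₁ V ≃ U × A × X × X₁ × (S × Sd × Y × Y₁) × V :=
    { toFun := fun ω => (rU ω, rA ω, rX ω, rX₁ ω, (rS ω, rSd ω, rY ω, rY₁ ω), rV ω)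
      invFun := fun ω => (ω.1, ω.2.1, ω.2.2.1, ω.2.2.2.1, ω.2.2.2.2.1.1, ω.2.2.2.2.1.2.1,
        ω.2.2.2.2.1.2.2.1, ω.2.2.2.2.1.2.2.2, ω.2.2.2.2.2)
      left_inv := fun _ => rfl
      right_inv := fun _ => rfl }
  rw [Description.avg_eq_mean]
  refine (Fintype.sum_equiv e _ _ fun ω => ?_).symm
  rw [← law_description]
  rfl

lemma jointLaw_mem : jointLaw ch q ∈ stdSimplex ℝ (Sample U A X X₁ S Sd Y Y₁ V) := by
  refine ⟨jointLaw_nonneg ch q, ?_⟩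
  have h := avg_description ch q fun _ _ _ _ _ _ => 1
  rw [Description.avg_const] at h
  simpa [mean] using h.symm

section Marginals

variable (u : U) (a : A) (x : X) (x₁ : X₁) (y : Y) (y₁ : Y₁) (v : V)

lemma sum_toReal {α : Type*} [Fintype α] (p : PMF α) : ∑ a, (p a).toReal = 1 := (pmf_mem p).2

lemma marg_UAXX₁ : marg (jointLaw ch q) (fun ω => (rU ω, rA ω, rX ω, rX₁ ω)) (u, a, x, x₁) =
    (q.pU u).toReal * (q.pA u a).toReal * (q.pX u a x).toReal * (q.pX₁ u x₁).toReal := by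
  classical
  have h1 := fun x x₁ s => sum_toReal (ch.output x x₁ s)
  have h2 := sum_toReal ch.state
  simp only [Fintype.sum_prod_type] at h1 h2
  simp only [marg, rU, rA, rX, rX₁, jointLaw, rS, rSd, rY, rY₁, rV, Fintype.sum_prod_type,
    Prod.mk.injEq, ite_and, Finset.sum_ite_irrel, Finset.sum_const_zero, Finset.sum_ite_eq',
    Finset.mem_univ, if_true, ← Finset.mul_sum, sum_toReal, mul_one]
  simp only [mul_assoc, ← Finset.mul_sum, h1, h2, mul_one]

lemma marg_UAX : marg (jointLaw ch q) (fun ω => (rU ω, rA ω, rX ω)) (u, a, x) =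
    (q.pU u).toReal * (q.pA u a).toReal * (q.pX u a x).toReal := by
  classical
  have h := marg_marg (jointLaw ch q) (fun ω => (rU ω, rA ω, rX ω, rX₁ ω))
    (fun i => (i.1, i.2.1, i.2.2.1))
  rw [← h]
  simp only [marg.eq_1 (marg _ _), Fintype.sum_prod_type, marg_UAXX₁, Prod.mk.injEq, ite_and,
    Finset.sum_ite_irrel, Finset.sum_const_zero, Finset.sum_ite_eq', Finset.mem_univ, if_true,
    ← Finset.mul_sum, sum_toReal, mul_one]

lemma marg_UAX₁ : marg (jointLaw ch q) (fun ω => (rU ω, rA ω, rX₁ ω)) (u, a, x₁) =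
    (q.pU u).toReal * (q.pA u a).toReal * (q.pX₁ u x₁).toReal := by
  classical
  have h := marg_marg (jointLaw ch q) (fun ω => (rU ω, rA ω, rX ω, rX₁ ω))
    (fun i => (i.1, i.2.1, i.2.2.2))
  rw [← h]
  simp only [marg.eq_1 (marg _ _), Fintype.sum_prod_type, marg_UAXX₁, Prod.mk.injEq, ite_and,
    Finset.sum_ite_irrel, Finset.sum_const_zero, Finset.sum_ite_eq', Finset.mem_univ, if_true,
    ← Finset.mul_sum, ← Finset.sum_mul, sum_toReal, mul_one]

lemma marg_UA : marg (jointLaw ch q) (fun ω => (rU ω, rA ω)) (u, a) =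
    (q.pU u).toReal * (q.pA u a).toReal := by
  classical
  have h := marg_marg (jointLaw ch q) (fun ω => (rU ω, rA ω, rX ω)) (fun i => (i.1, i.2.1))
  rw [← h]
  simp only [marg.eq_1 (marg _ _), Fintype.sum_prod_type, marg_UAX, Prod.mk.injEq, ite_and,
    Finset.sum_ite_irrel, Finset.sum_const_zero, Finset.sum_ite_eq', Finset.mem_univ, if_true,
    ← Finset.mul_sum, sum_toReal, mul_one]

lemma marg_UX₁ : marg (jointLaw ch q) (fun ω => (rU ω, rX₁ ω)) (u, x₁) =
    (q.pU u).toReal * (q.pX₁ u x₁).toReal := by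
  classical
  have h := marg_marg (jointLaw ch q) (fun ω => (rU ω, rA ω, rX₁ ω)) (fun i => (i.1, i.2.2))
  rw [← h]
  simp only [marg.eq_1 (marg _ _), Fintype.sum_prod_type, marg_UAX₁, Prod.mk.injEq, ite_and,
    Finset.sum_ite_irrel, Finset.sum_const_zero, Finset.sum_ite_eq', Finset.mem_univ, if_true,
    ← Finset.mul_sum, ← Finset.sum_mul, sum_toReal, mul_one]

lemma marg_UAX₁V : marg (jointLaw ch q) (fun ω => (rU ω, rA ω, rX₁ ω, rV ω)) (u, a, x₁, v) =
    marg (jointLaw ch q) (fun ω => (rU ω, rA ω, rX₁ ω)) (u, a, x₁) * q.condV ch u a x₁ v := by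
  classical
  rw [marg_UAX₁]
  simp only [marg, rU, rA, rX, rX₁, jointLaw, rS, rSd, rY, rY₁, rV, Fintype.sum_prod_type,
    Prod.mk.injEq, ite_and, Finset.sum_ite_irrel, Finset.sum_const_zero, Finset.sum_ite_eq',
    Finset.mem_univ, if_true, Finset.mul_sum, channelLaw, Choice.condV, mean]
  refine Finset.sum_congr rfl fun x _ => Finset.sum_congr rfl fun s _ =>
    Finset.sum_congr rfl fun sd _ => Finset.sum_congr rfl fun y _ =>
    Finset.sum_congr rfl fun y₁ _ => ?_
  ring

lemma marg_UAX₁Y₁V :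
    marg (jointLaw ch q) (fun ω => (rU ω, rA ω, rX₁ ω, rY₁ ω, rV ω)) (u, a, x₁, y₁, v) =
    marg (jointLaw ch q) (fun ω => (rU ω, rA ω, rX₁ ω, rY₁ ω)) (u, a, x₁, y₁) *
      (q.pV u a x₁ y₁ v).toReal := by
  classical
  simp only [marg, rU, rA, rX, rX₁, jointLaw, rS, rSd, rY, rY₁, rV, Fintype.sum_prod_type,
    Prod.mk.injEq, ite_and, Finset.sum_ite_irrel, Finset.sum_const_zero, Finset.sum_ite_eq',
    Finset.mem_univ, if_true, ← Finset.mul_sum, ← Finset.sum_mul, sum_toReal, mul_one]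

lemma marg_UAXX₁YY₁V : marg (jointLaw ch q)
      (fun ω => (rU ω, rA ω, rX ω, rX₁ ω, rY ω, rY₁ ω, rV ω)) (u, a, x, x₁, y, y₁, v) =
    marg (jointLaw ch q) (fun ω => (rU ω, rA ω, rX ω, rX₁ ω, rY ω, rY₁ ω))
      (u, a, x, x₁, y, y₁) * (q.pV u a x₁ y₁ v).toReal := by
  classical
  simp only [marg, rU, rA, rX, rX₁, jointLaw, rS, rSd, rY, rY₁, rV, Fintype.sum_prod_type,
    Prod.mk.injEq, ite_and, Finset.sum_ite_irrel, Finset.sum_const_zero, Finset.sum_ite_eq',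
    Finset.mem_univ, if_true, ← Finset.mul_sum, ← Finset.sum_mul, sum_toReal, mul_one]

end Marginals

end Choice

/-! ### The rates of the description are information quantities -/

section Rates

variable {U A X X₁ S Sd Y Y₁ V : Type*} [Fintype U] [Fintype A] [Fintype X] [Fintype X₁]
  [Fintype S] [Fintype Sd] [Fintype Y] [Fintype Y₁] [Fintype V]
  (ch : Channel X X₁ S Sd Y Y₁) (q : Choice U A X X₁ Y₁ V)

lemma pos_of_jointLaw_pos {ω : Sample U A X X₁ S Sd Y Y₁ V} (hω : 0 < jointLaw ch q ω) :
    0 < (q.pU (rU ω)).toReal ∧ 0 < (q.pA (rU ω) (rA ω)).toReal ∧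
    0 < (q.pX (rU ω) (rA ω) (rX ω)).toReal ∧ 0 < (q.pX₁ (rU ω) (rX₁ ω)).toReal ∧
    0 < (q.pV (rU ω) (rA ω) (rX₁ ω) (rY₁ ω) (rV ω)).toReal ∧
    0 < q.condV ch (rU ω) (rA ω) (rX₁ ω) (rV ω) := by
  have h1 := hω.trans_le (le_marg (jointLaw_nonneg ch q)
    (fun ω => (rU ω, rA ω, rX₁ ω, rV ω)) ω)
  rw [marg_UAX₁V] at h1
  have h2 : q.condV ch (rU ω) (rA ω) (rX₁ ω) (rV ω) ≠ 0 := right_ne_zero_of_mul h1.ne'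
  have h3 := hω.ne'
  simp only [jointLaw, mul_ne_zero_iff] at h3
  obtain ⟨⟨⟨⟨⟨⟨h4, h5⟩, h6⟩, h7⟩, -⟩, -⟩, h8⟩ := h3
  exact ⟨lt_of_le_of_ne ENNReal.toReal_nonneg h4.symm,
    lt_of_le_of_ne ENNReal.toReal_nonneg h5.symm, lt_of_le_of_ne ENNReal.toReal_nonneg h6.symm,
    lt_of_le_of_ne ENNReal.toReal_nonneg h7.symm, lt_of_le_of_ne ENNReal.toReal_nonneg h8.symm,
    lt_of_le_of_ne ((q.condV_mem ch _ _ _).1 _) h2.symm⟩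

lemma regular_description : (q.description ch).Regular := by
  have key : ∀ (u : U) (a : A) (x : X) (x₁ : X₁) (o : S × Sd × Y × Y₁) (v : V)
      {P : Prop}, (∀ ω : Sample U A X X₁ S Sd Y Y₁ V,
        ω = (u, a, x, x₁, o.1, o.2.1, o.2.2.1, o.2.2.2, v) → 0 < jointLaw ch q ω → P) →
      0 < (q.description ch).law (u, a, x, x₁, o, v) → P := fun u a x x₁ o v P h hpos =>
    h _ rfl (by rw [← law_description]; exact hpos)
  constructor <;> intro u a x x₁ o v <;> refine key u a x x₁ o v fun ω hω hpos => ?_ <;>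
    obtain ⟨h1, h2, h3, h4, h5, h6⟩ := pos_of_jointLaw_pos ch q hpos
  · subst hω; exact h5
  · subst hω; exact h6
  · have := condProb_pos (jointLaw_nonneg ch q) rA (fun ω => (rU ω, rX₁ ω, rY₁ ω)) hpos
    subst hω; exact div_pos this h2
  · have := condProb_pos (jointLaw_nonneg ch q) rX (fun ω => (rU ω, rA ω, rX₁ ω, rV ω, rY ω)) hpos
    subst hω; exact div_pos this h3
  · have := condProb_pos (jointLaw_nonneg ch q) (fun ω => (rX ω, rX₁ ω, rV ω))
      (fun ω => (rU ω, rA ω, rY ω)) hpos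
    subst hω; exact div_pos this (mul_pos h3 (mul_pos h4 h6))
  · have := condProb_pos (jointLaw_nonneg ch q) (fun ω => (rX₁ ω, rV ω))
      (fun ω => (rU ω, rA ω, rX ω, rY ω)) hpos
    subst hω; exact div_pos this (mul_pos h4 h6)
  · have := condProb_pos (jointLaw_nonneg ch q) (fun ω => (rU ω, rA ω, rX ω, rX₁ ω, rV ω)) rY hpos
    subst hω; exact div_pos this (mul_pos h1 (mul_pos h2 (mul_pos h3 (mul_pos h4 h6))))

lemma meanLog_UAX₁ : meanLog (jointLaw ch q) (fun ω => (rU ω, rA ω, rX₁ ω)) =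
    meanLog (jointLaw ch q) (fun ω => (rU ω, rX₁ ω)) +
      mean (jointLaw ch q) fun ω => Real.logb 2 (q.pA (rU ω) (rA ω)).toReal :=
  meanLog_eq_add (jointLaw_nonneg ch q) (fun _ h => (pos_of_jointLaw_pos ch q h).2.1) fun ω => by
    rw [marg_UAX₁, marg_UX₁]; ring

lemma meanLog_UAXX₁ : meanLog (jointLaw ch q) (fun ω => (rU ω, rA ω, rX ω, rX₁ ω)) =
    meanLog (jointLaw ch q) (fun ω => (rU ω, rA ω, rX₁ ω)) +
      mean (jointLaw ch q) fun ω => Real.logb 2 (q.pX (rU ω) (rA ω) (rX ω)).toReal :=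
  meanLog_eq_add (jointLaw_nonneg ch q) (fun _ h => (pos_of_jointLaw_pos ch q h).2.2.1) fun ω => by
    rw [marg_UAXX₁, marg_UAX₁]; ring

lemma meanLog_UAXX₁' : meanLog (jointLaw ch q) (fun ω => (rU ω, rA ω, rX ω, rX₁ ω)) =
    meanLog (jointLaw ch q) (fun ω => (rU ω, rA ω, rX ω)) +
      mean (jointLaw ch q) fun ω => Real.logb 2 (q.pX₁ (rU ω) (rX₁ ω)).toReal :=
  meanLog_eq_add (jointLaw_nonneg ch q) (fun _ h => (pos_of_jointLaw_pos ch q h).2.2.2.1)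
    fun ω => by rw [marg_UAXX₁, marg_UAX]

lemma meanLog_UAX : meanLog (jointLaw ch q) (fun ω => (rU ω, rA ω, rX ω)) =
    meanLog (jointLaw ch q) (fun ω => (rU ω, rA ω)) +
      mean (jointLaw ch q) fun ω => Real.logb 2 (q.pX (rU ω) (rA ω) (rX ω)).toReal :=
  meanLog_eq_add (jointLaw_nonneg ch q) (fun _ h => (pos_of_jointLaw_pos ch q h).2.2.1) fun ω => by
    rw [marg_UAX, marg_UA]

lemma meanLog_UA : meanLog (jointLaw ch q) (fun ω => (rU ω, rA ω)) =
    mean (jointLaw ch q) (fun ω => Real.logb 2 (q.pU (rU ω)).toReal) +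
      mean (jointLaw ch q) fun ω => Real.logb 2 (q.pA (rU ω) (rA ω)).toReal := by
  simp only [meanLog, marg_UA]
  exact mean_logb_mul (jointLaw_nonneg ch q) (fun _ h => (pos_of_jointLaw_pos ch q h).1)
    fun _ h => (pos_of_jointLaw_pos ch q h).2.1

lemma meanLog_UAX₁V : meanLog (jointLaw ch q) (fun ω => (rU ω, rA ω, rX₁ ω, rV ω)) =
    meanLog (jointLaw ch q) (fun ω => (rU ω, rA ω, rX₁ ω)) +
      mean (jointLaw ch q) fun ω => Real.logb 2 (q.condV ch (rU ω) (rA ω) (rX₁ ω) (rV ω)) :=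
  meanLog_eq_add (jointLaw_nonneg ch q) (fun _ h => (pos_of_jointLaw_pos ch q h).2.2.2.2.2)
    fun _ => marg_UAX₁V ch q _ _ _ _

lemma meanLog_UAX₁Y₁V : meanLog (jointLaw ch q) (fun ω => (rU ω, rA ω, rX₁ ω, rY₁ ω, rV ω)) =
    meanLog (jointLaw ch q) (fun ω => (rU ω, rA ω, rX₁ ω, rY₁ ω)) + mean (jointLaw ch q)
      fun ω => Real.logb 2 (q.pV (rU ω) (rA ω) (rX₁ ω) (rY₁ ω) (rV ω)).toReal :=
  meanLog_eq_add (jointLaw_nonneg ch q) (fun _ h => (pos_of_jointLaw_pos ch q h).2.2.2.2.1)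
    fun _ => marg_UAX₁Y₁V ch q _ _ _ _ _

lemma meanLog_UAXX₁YY₁V :
    meanLog (jointLaw ch q) (fun ω => (rU ω, rA ω, rX ω, rX₁ ω, rY ω, rY₁ ω, rV ω)) =
    meanLog (jointLaw ch q) (fun ω => (rU ω, rA ω, rX ω, rX₁ ω, rY ω, rY₁ ω)) +
      mean (jointLaw ch q)
        fun ω => Real.logb 2 (q.pV (rU ω) (rA ω) (rX₁ ω) (rY₁ ω) (rV ω)).toReal :=
  meanLog_eq_add (jointLaw_nonneg ch q) (fun _ h => (pos_of_jointLaw_pos ch q h).2.2.2.2.1)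
    fun _ => marg_UAXX₁YY₁V ch q _ _ _ _ _ _ _

lemma rateV_description : (q.description ch).rateV =
    mean (jointLaw ch q)
      (fun ω => Real.logb 2 (q.pV (rU ω) (rA ω) (rX₁ ω) (rY₁ ω) (rV ω)).toReal) -
    mean (jointLaw ch q) fun ω => Real.logb 2 (q.condV ch (rU ω) (rA ω) (rX₁ ω) (rV ω)) := by
  rw [Description.rateV, avg_description]
  exact mean_logb_div (jointLaw_nonneg ch q) (fun _ h => (pos_of_jointLaw_pos ch q h).2.2.2.2.1)
    fun _ h => (pos_of_jointLaw_pos ch q h).2.2.2.2.2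

/-- `I(A ; Y₁ | U X₁)`. -/
lemma rate₀_description : (q.description ch).rate₀ =
    condMutualInfo (jointLaw ch q) rA rY₁ (fun ω => (rU ω, rX₁ ω)) := by
  have h1 : (q.description ch).rate₀ = _ := (avg_description ch q _).trans
    (mean_logb_condProb_div (jointLaw_nonneg ch q) rA (fun ω => (rU ω, rX₁ ω, rY₁ ω))
      fun _ h => (pos_of_jointLaw_pos ch q h).2.1)
  rw [h1, condMutualInfo_eq]
  have e1 : meanLog (jointLaw ch q) (fun ω => (rA ω, rY₁ ω, rU ω, rX₁ ω)) =
      meanLog (jointLaw ch q) (fun ω => (rA ω, rU ω, rX₁ ω, rY₁ ω)) :=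
    meanLog_congr fun ω ω' => by simp only [Prod.mk.injEq]; tauto
  have e2 : meanLog (jointLaw ch q) (fun ω => (rY₁ ω, rU ω, rX₁ ω)) =
      meanLog (jointLaw ch q) (fun ω => (rU ω, rX₁ ω, rY₁ ω)) :=
    meanLog_congr fun ω ω' => by simp only [Prod.mk.injEq]; tauto
  have e3 : meanLog (jointLaw ch q) (fun ω => (rA ω, rU ω, rX₁ ω)) =
      meanLog (jointLaw ch q) (fun ω => (rU ω, rA ω, rX₁ ω)) :=
    meanLog_congr fun ω ω' => by simp only [Prod.mk.injEq]; tauto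
  rw [e1, e2, e3, meanLog_UAX₁]
  ring

/-- `I(X ; V Y | U A X₁)`. -/
lemma rate₁_description : (q.description ch).rate₁ =
    condMutualInfo (jointLaw ch q) rX (fun ω => (rV ω, rY ω)) (fun ω => (rU ω, rA ω, rX₁ ω)) := by
  have h1 : (q.description ch).rate₁ = _ := (avg_description ch q _).trans
    (mean_logb_condProb_div (jointLaw_nonneg ch q) rX (fun ω => (rU ω, rA ω, rX₁ ω, rV ω, rY ω))
      fun _ h => (pos_of_jointLaw_pos ch q h).2.2.1)
  rw [h1, condMutualInfo_eq]
  have e1 : meanLog (jointLaw ch q) (fun ω => (rX ω, (rV ω, rY ω), rU ω, rA ω, rX₁ ω)) =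
      meanLog (jointLaw ch q) (fun ω => (rX ω, rU ω, rA ω, rX₁ ω, rV ω, rY ω)) :=
    meanLog_congr fun ω ω' => by simp only [Prod.mk.injEq]; tauto
  have e2 : meanLog (jointLaw ch q) (fun ω => ((rV ω, rY ω), rU ω, rA ω, rX₁ ω)) =
      meanLog (jointLaw ch q) (fun ω => (rU ω, rA ω, rX₁ ω, rV ω, rY ω)) :=
    meanLog_congr fun ω ω' => by simp only [Prod.mk.injEq]; tauto
  have e3 : meanLog (jointLaw ch q) (fun ω => (rX ω, rU ω, rA ω, rX₁ ω)) =
      meanLog (jointLaw ch q) (fun ω => (rU ω, rA ω, rX ω, rX₁ ω)) :=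
    meanLog_congr fun ω ω' => by simp only [Prod.mk.injEq]; tauto
  rw [e1, e2, e3, meanLog_UAXX₁]
  ring

/-- `I(V ; Y₁ | U A X X₁ Y)`, the part of the description that the channel output does not
reveal to the decoder, in terms of likelihoods. -/
lemma condMutualInfo_V : condMutualInfo (jointLaw ch q) rV rY₁
      (fun ω => (rU ω, rA ω, rX ω, rX₁ ω, rY ω)) =
    mean (jointLaw ch q)
      (fun ω => Real.logb 2 (q.pV (rU ω) (rA ω) (rX₁ ω) (rY₁ ω) (rV ω)).toReal) +
    meanLog (jointLaw ch q) (fun ω => (rU ω, rA ω, rX ω, rX₁ ω, rY ω)) -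
    meanLog (jointLaw ch q) (fun ω => (rU ω, rA ω, rX ω, rX₁ ω, rV ω, rY ω)) := by
  rw [condMutualInfo_eq]
  have e1 : meanLog (jointLaw ch q) (fun ω => (rV ω, rY₁ ω, rU ω, rA ω, rX ω, rX₁ ω, rY ω)) =
      meanLog (jointLaw ch q) (fun ω => (rU ω, rA ω, rX ω, rX₁ ω, rY ω, rY₁ ω, rV ω)) :=
    meanLog_congr fun ω ω' => by simp only [Prod.mk.injEq]; tauto
  have e2 : meanLog (jointLaw ch q) (fun ω => (rV ω, rU ω, rA ω, rX ω, rX₁ ω, rY ω)) =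
      meanLog (jointLaw ch q) (fun ω => (rU ω, rA ω, rX ω, rX₁ ω, rV ω, rY ω)) :=
    meanLog_congr fun ω ω' => by simp only [Prod.mk.injEq]; tauto
  have e3 : meanLog (jointLaw ch q) (fun ω => (rY₁ ω, rU ω, rA ω, rX ω, rX₁ ω, rY ω)) =
      meanLog (jointLaw ch q) (fun ω => (rU ω, rA ω, rX ω, rX₁ ω, rY ω, rY₁ ω)) :=
    meanLog_congr fun ω ω' => by simp only [Prod.mk.injEq]; tauto
  rw [e1, e2, e3, meanLog_UAXX₁YY₁V]
  ring

/-- The test also profits from what the tested words reveal about the description. -/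
lemma rate₂_description : (q.description ch).rate₂ =
    condMutualInfo (jointLaw ch q) (fun ω => (rX ω, rX₁ ω)) rY (fun ω => (rU ω, rA ω)) +
      ((q.description ch).rateV -
        condMutualInfo (jointLaw ch q) rV rY₁ (fun ω => (rU ω, rA ω, rX ω, rX₁ ω, rY ω))) := by
  have h1 : (q.description ch).rate₂ = _ := (avg_description ch q _).trans
    (mean_logb_condProb_div (jointLaw_nonneg ch q) (fun ω => (rX ω, rX₁ ω, rV ω)) (fun ω => (rU ω, rA ω, rY ω))
      fun _ h => mul_pos (pos_of_jointLaw_pos ch q h).2.2.1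
        (mul_pos (pos_of_jointLaw_pos ch q h).2.2.2.1 (pos_of_jointLaw_pos ch q h).2.2.2.2.2))
  rw [h1, mean_logb_mul (jointLaw_nonneg ch q) (fun _ h => (pos_of_jointLaw_pos ch q h).2.2.1)
      fun _ h => mul_pos (pos_of_jointLaw_pos ch q h).2.2.2.1
        (pos_of_jointLaw_pos ch q h).2.2.2.2.2,
    mean_logb_mul (jointLaw_nonneg ch q) (fun _ h => (pos_of_jointLaw_pos ch q h).2.2.2.1)
      fun _ h => (pos_of_jointLaw_pos ch q h).2.2.2.2.2,
    rateV_description, condMutualInfo_V, condMutualInfo_eq]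
  have e1 : meanLog (jointLaw ch q) (fun ω => ((rX ω, rX₁ ω, rV ω), rU ω, rA ω, rY ω)) =
      meanLog (jointLaw ch q) (fun ω => (rU ω, rA ω, rX ω, rX₁ ω, rV ω, rY ω)) :=
    meanLog_congr fun ω ω' => by simp only [Prod.mk.injEq]; tauto
  have e2 : meanLog (jointLaw ch q) (fun ω => ((rX ω, rX₁ ω), rY ω, rU ω, rA ω)) =
      meanLog (jointLaw ch q) (fun ω => (rU ω, rA ω, rX ω, rX₁ ω, rY ω)) :=
    meanLog_congr fun ω ω' => by simp only [Prod.mk.injEq]; tauto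
  have e3 : meanLog (jointLaw ch q) (fun ω => ((rX ω, rX₁ ω), rU ω, rA ω)) =
      meanLog (jointLaw ch q) (fun ω => (rU ω, rA ω, rX ω, rX₁ ω)) :=
    meanLog_congr fun ω ω' => by simp only [Prod.mk.injEq]; tauto
  have e4 : meanLog (jointLaw ch q) (fun ω => (rY ω, rU ω, rA ω)) =
      meanLog (jointLaw ch q) (fun ω => (rU ω, rA ω, rY ω)) :=
    meanLog_congr fun ω ω' => by simp only [Prod.mk.injEq]; tauto
  rw [e1, e2, e3, e4, meanLog_UAXX₁', meanLog_UAX]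
  ring

lemma rate₃_description : (q.description ch).rate₃ =
    condMutualInfo (jointLaw ch q) rX₁ rY (fun ω => (rU ω, rA ω, rX ω)) +
      ((q.description ch).rateV -
        condMutualInfo (jointLaw ch q) rV rY₁ (fun ω => (rU ω, rA ω, rX ω, rX₁ ω, rY ω))) := by
  have h1 : (q.description ch).rate₃ = _ := (avg_description ch q _).trans
    (mean_logb_condProb_div (jointLaw_nonneg ch q) (fun ω => (rX₁ ω, rV ω)) (fun ω => (rU ω, rA ω, rX ω, rY ω))
      fun _ h => mul_pos (pos_of_jointLaw_pos ch q h).2.2.2.1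
        (pos_of_jointLaw_pos ch q h).2.2.2.2.2)
  rw [h1, mean_logb_mul (jointLaw_nonneg ch q) (fun _ h => (pos_of_jointLaw_pos ch q h).2.2.2.1)
      fun _ h => (pos_of_jointLaw_pos ch q h).2.2.2.2.2,
    rateV_description, condMutualInfo_V, condMutualInfo_eq]
  have e1 : meanLog (jointLaw ch q) (fun ω => ((rX₁ ω, rV ω), rU ω, rA ω, rX ω, rY ω)) =
      meanLog (jointLaw ch q) (fun ω => (rU ω, rA ω, rX ω, rX₁ ω, rV ω, rY ω)) :=
    meanLog_congr fun ω ω' => by simp only [Prod.mk.injEq]; tauto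
  have e2 : meanLog (jointLaw ch q) (fun ω => (rX₁ ω, rY ω, rU ω, rA ω, rX ω)) =
      meanLog (jointLaw ch q) (fun ω => (rU ω, rA ω, rX ω, rX₁ ω, rY ω)) :=
    meanLog_congr fun ω ω' => by simp only [Prod.mk.injEq]; tauto
  have e3 : meanLog (jointLaw ch q) (fun ω => (rX₁ ω, rU ω, rA ω, rX ω)) =
      meanLog (jointLaw ch q) (fun ω => (rU ω, rA ω, rX ω, rX₁ ω)) :=
    meanLog_congr fun ω ω' => by simp only [Prod.mk.injEq]; tauto
  have e4 : meanLog (jointLaw ch q) (fun ω => (rY ω, rU ω, rA ω, rX ω)) =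
      meanLog (jointLaw ch q) (fun ω => (rU ω, rA ω, rX ω, rY ω)) :=
    meanLog_congr fun ω ω' => by simp only [Prod.mk.injEq]; tauto
  rw [e1, e2, e3, e4, meanLog_UAXX₁']
  ring

/-- The fourth rate is `I(U A X X₁ ; Y) + I(V ; Y₁ | U A X₁) - I(V ; Y₁ | U A X X₁ Y)`, and the
first summand is at least `I(X X₁ ; Y)`. -/
lemma le_rate₄_description : mutualInfo (jointLaw ch q) (fun ω => (rX ω, rX₁ ω)) rY +
      ((q.description ch).rateV -
        condMutualInfo (jointLaw ch q) rV rY₁ (fun ω => (rU ω, rA ω, rX ω, rX₁ ω, rY ω))) ≤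
    (q.description ch).rate₄ := by
  have h1 : (q.description ch).rate₄ = _ := (avg_description ch q _).trans
    (mean_logb_condProb_div (jointLaw_nonneg ch q) (fun ω => (rU ω, rA ω, rX ω, rX₁ ω, rV ω)) rY
      fun _ h => mul_pos (pos_of_jointLaw_pos ch q h).1 (mul_pos (pos_of_jointLaw_pos ch q h).2.1
        (mul_pos (pos_of_jointLaw_pos ch q h).2.2.1 (mul_pos (pos_of_jointLaw_pos ch q h).2.2.2.1
          (pos_of_jointLaw_pos ch q h).2.2.2.2.2))))
  rw [h1, mean_logb_mul (jointLaw_nonneg ch q) (fun _ h => (pos_of_jointLaw_pos ch q h).1)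
      fun _ h => mul_pos (pos_of_jointLaw_pos ch q h).2.1
        (mul_pos (pos_of_jointLaw_pos ch q h).2.2.1 (mul_pos (pos_of_jointLaw_pos ch q h).2.2.2.1
          (pos_of_jointLaw_pos ch q h).2.2.2.2.2)),
    mean_logb_mul (jointLaw_nonneg ch q) (fun _ h => (pos_of_jointLaw_pos ch q h).2.1)
      fun _ h => mul_pos (pos_of_jointLaw_pos ch q h).2.2.1
        (mul_pos (pos_of_jointLaw_pos ch q h).2.2.2.1 (pos_of_jointLaw_pos ch q h).2.2.2.2.2),
    mean_logb_mul (jointLaw_nonneg ch q) (fun _ h => (pos_of_jointLaw_pos ch q h).2.2.1)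
      fun _ h => mul_pos (pos_of_jointLaw_pos ch q h).2.2.2.1
        (pos_of_jointLaw_pos ch q h).2.2.2.2.2,
    mean_logb_mul (jointLaw_nonneg ch q) (fun _ h => (pos_of_jointLaw_pos ch q h).2.2.2.1)
      fun _ h => (pos_of_jointLaw_pos ch q h).2.2.2.2.2,
    rateV_description, condMutualInfo_V, mutualInfo_eq]
  have e1 : meanLog (jointLaw ch q) (fun ω => ((rU ω, rA ω, rX ω, rX₁ ω, rV ω), rY ω)) =
      meanLog (jointLaw ch q) (fun ω => (rU ω, rA ω, rX ω, rX₁ ω, rV ω, rY ω)) :=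
    meanLog_congr fun ω ω' => by simp only [Prod.mk.injEq]; tauto
  have e2 : meanLog (jointLaw ch q) (fun ω => ((rU ω, rA ω), rY ω, rX ω, rX₁ ω)) =
      meanLog (jointLaw ch q) (fun ω => (rU ω, rA ω, rX ω, rX₁ ω, rY ω)) :=
    meanLog_congr fun ω ω' => by simp only [Prod.mk.injEq]; tauto
  have e3 : meanLog (jointLaw ch q) (fun ω => ((rU ω, rA ω), rX ω, rX₁ ω)) =
      meanLog (jointLaw ch q) (fun ω => (rU ω, rA ω, rX ω, rX₁ ω)) :=
    meanLog_congr fun ω ω' => by simp only [Prod.mk.injEq]; tauto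
  have e4 : meanLog (jointLaw ch q) (fun ω => (rY ω, rX ω, rX₁ ω)) =
      meanLog (jointLaw ch q) (fun ω => ((rX ω, rX₁ ω), rY ω)) :=
    meanLog_congr fun ω ω' => by simp only [Prod.mk.injEq]; tauto
  have hnn := condMutualInfo_nonneg (fun ω => (rU ω, rA ω)) rY (fun ω => (rX ω, rX₁ ω))
    (jointLaw_mem ch q)
  rw [condMutualInfo_eq, e2, e3, e4] at hnn
  rw [e1]
  have h2 := meanLog_UAXX₁' ch q
  have h3 := meanLog_UAX ch q
  have h4 := meanLog_UA ch q
  linarith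

end Rates

/-! ### Mixtures of descriptions -/

section Mix

variable {α β : Type*} [Fintype α] [Fintype β]

/-- The mixture, with weights `1 - l` and `l`, of laws on the two parts of a disjoint union. -/
def mixLaw (l : ℝ) (p : α → ℝ) (p' : β → ℝ) : α ⊕ β → ℝ :=
  Sum.elim (fun a => (1 - l) * p a) (fun b => l * p' b)

lemma mean_mixLaw (l : ℝ) (p : α → ℝ) (p' : β → ℝ) (f : α ⊕ β → ℝ) :
    mean (mixLaw l p p') f =
      (1 - l) * mean p (fun a => f (.inl a)) + l * mean p' (fun b => f (.inr b)) := by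
  simp only [mean, Fintype.sum_sum_type, mixLaw, Sum.elim_inl, Sum.elim_inr, Finset.mul_sum,
    mul_assoc]

lemma mixLaw_mem {l : ℝ} (hl : 0 ≤ l) (hl' : l ≤ 1) {p : α → ℝ} {p' : β → ℝ}
    (hp : p ∈ stdSimplex ℝ α) (hp' : p' ∈ stdSimplex ℝ β) :
    mixLaw l p p' ∈ stdSimplex ℝ (α ⊕ β) := by
  refine ⟨?_, ?_⟩
  · rintro (a | b)
    · exact mul_nonneg (sub_nonneg.2 hl') (hp.1 a)
    · exact mul_nonneg hl (hp'.1 b)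
  · have h := mean_mixLaw l p p' fun _ => 1
    rw [mean_const hp, mean_const hp'] at h
    simpa [mean] using h

variable {U A X X₁ O Y Y₁ V V' : Type*} [Fintype U] [Fintype A] [Fintype X] [Fintype X₁]
  [Fintype O] [Fintype V] [Fintype V'] {E : Ensemble U A X X₁ O Y Y₁}

lemma mix_le_one {l x y : ℝ} (hl : 0 ≤ l) (hl' : l ≤ 1) (hx : x ≤ 1) (hy : y ≤ 1) :
    (1 - l) * x + l * y ≤ 1 := by
  nlinarith [mul_nonneg hl (sub_nonneg.2 hy), mul_nonneg (sub_nonneg.2 hl') (sub_nonneg.2 hx)]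

/-- Time sharing between two descriptions, where the description reveals which one is used. -/
def Description.mix (t : Description E V) (t' : Description E V') (l : ℝ) (hl : 0 ≤ l)
    (hl' : l ≤ 1) : Description E (V ⊕ V') where
  pV u a x₁ y₁ := mixLaw l (t.pV u a x₁ y₁) (t'.pV u a x₁ y₁)
  r u a x₁ := mixLaw l (t.r u a x₁) (t'.r u a x₁)
  pV_mem _ _ _ _ := mixLaw_mem hl hl' (t.pV_mem _ _ _ _) (t'.pV_mem _ _ _ _)
  r_mem _ _ _ := mixLaw_mem hl hl' (t.r_mem _ _ _) (t'.r_mem _ _ _)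
  τ₀ := t.τ₀
  τ₁ u a x x₁ v y := v.elim (fun v => t.τ₁ u a x x₁ v y) (fun v => t'.τ₁ u a x x₁ v y)
  τ₂ u a x x₁ v y := v.elim (fun v => t.τ₂ u a x x₁ v y) (fun v => t'.τ₂ u a x x₁ v y)
  τ₃ u a x x₁ v y := v.elim (fun v => t.τ₃ u a x x₁ v y) (fun v => t'.τ₃ u a x x₁ v y)
  τ₄ u a x x₁ v y := v.elim (fun v => t.τ₄ u a x x₁ v y) (fun v => t'.τ₄ u a x x₁ v y)
  τ₀_nonneg := t.τ₀_nonneg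
  τ₁_nonneg := by
    rintro u a x x₁ (v | v) y
    exacts [t.τ₁_nonneg u a x x₁ v y, t'.τ₁_nonneg u a x x₁ v y]
  τ₂_nonneg := by
    rintro u a x x₁ (v | v) y
    exacts [t.τ₂_nonneg u a x x₁ v y, t'.τ₂_nonneg u a x x₁ v y]
  τ₃_nonneg := by
    rintro u a x x₁ (v | v) y
    exacts [t.τ₃_nonneg u a x x₁ v y, t'.τ₃_nonneg u a x x₁ v y]
  τ₄_nonneg := by
    rintro u a x x₁ (v | v) y
    exacts [t.τ₄_nonneg u a x x₁ v y, t'.τ₄_nonneg u a x x₁ v y]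
  τ₀_mean := t.τ₀_mean
  τ₁_mean := by
    rintro u a x₁ (v | v) y
    exacts [t.τ₁_mean u a x₁ v y, t'.τ₁_mean u a x₁ v y]
  τ₂_mean u a y := by
    simp only [mean_mixLaw, Sum.elim_inl, Sum.elim_inr, mean_add, mean_mul_left]
    exact mix_le_one hl hl' (t.τ₂_mean u a y) (t'.τ₂_mean u a y)
  τ₃_mean u a x y := by
    simp only [mean_mixLaw, Sum.elim_inl, Sum.elim_inr, mean_add, mean_mul_left]
    exact mix_le_one hl hl' (t.τ₃_mean u a x y) (t'.τ₃_mean u a x y)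
  τ₄_mean y := by
    simp only [mean_mixLaw, Sum.elim_inl, Sum.elim_inr, mean_add, mean_mul_left]
    exact mix_le_one hl hl' (t.τ₄_mean y) (t'.τ₄_mean y)

variable (t : Description E V) (t' : Description E V') {l : ℝ} (hl : 0 ≤ l) (hl' : l ≤ 1)

lemma Description.avg_mix (F : U → A → X → X₁ → O → V ⊕ V' → ℝ) :
    (t.mix t' l hl hl').avg F = (1 - l) * t.avg (fun u a x x₁ o v => F u a x x₁ o (.inl v)) +
      l * t'.avg (fun u a x x₁ o v => F u a x x₁ o (.inr v)) := by
  simp only [Description.avg, Description.mix, mean_mixLaw, mean_add, mean_mul_left]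

lemma Description.rate₀_mix (h : t'.rate₀ = t.rate₀) (hτ : t'.τ₀ = t.τ₀) :
    (t.mix t' l hl hl').rate₀ = t.rate₀ := by
  have h1 : (t.mix t' l hl hl').rate₀ = (1 - l) * t.rate₀ + l * t'.rate₀ := by
    refine (t.avg_mix t' hl hl' _).trans ?_
    simp only [Description.rate₀, hτ]
    rfl
  rw [h1, h]; ring

lemma Description.rate₁_mix : (t.mix t' l hl hl').rate₁ = (1 - l) * t.rate₁ + l * t'.rate₁ :=
  t.avg_mix t' hl hl' _

lemma Description.rate₂_mix : (t.mix t' l hl hl').rate₂ = (1 - l) * t.rate₂ + l * t'.rate₂ :=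
  t.avg_mix t' hl hl' _

lemma Description.rate₃_mix : (t.mix t' l hl hl').rate₃ = (1 - l) * t.rate₃ + l * t'.rate₃ :=
  t.avg_mix t' hl hl' _

lemma Description.rate₄_mix : (t.mix t' l hl hl').rate₄ = (1 - l) * t.rate₄ + l * t'.rate₄ :=
  t.avg_mix t' hl hl' _

/-- The weights cancel in the ratio of `pV` and `r`, unless they vanish. -/
lemma Description.rateV_mix (h0 : l ≠ 0) (h1 : l ≠ 1) :
    (t.mix t' l hl hl').rateV = (1 - l) * t.rateV + l * t'.rateV := by
  refine (t.avg_mix t' hl hl' _).trans ?_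
  simp only [Description.rateV, Description.mix, mixLaw, Sum.elim_inl, Sum.elim_inr,
    mul_div_mul_left _ _ (sub_ne_zero.2 h1.symm), mul_div_mul_left _ _ h0]

lemma Description.Regular.mix {t : Description E V} {t' : Description E V'} (ht : t.Regular)
    (ht' : t'.Regular) (h0 : 0 < l) (h1 : l < 1)
    (hτ : ∀ u a x x₁ o v, 0 < t'.law (u, a, x, x₁, o, v) → 0 < t.τ₀ u a x₁ (E.outY₁ o)) :
    (t.mix t' l h0.le h1.le).Regular := by
  have h1' : 0 < 1 - l := sub_pos.2 h1
  have hlaw : ∀ u a x x₁ o v, 0 < (t.mix t' l h0.le h1.le).law (u, a, x, x₁, o, .inl v) →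
      0 < t.law (u, a, x, x₁, o, v) := by
    intro u a x x₁ o v h
    have : (t.mix t' l h0.le h1.le).law (u, a, x, x₁, o, .inl v) =
        (1 - l) * t.law (u, a, x, x₁, o, v) := by
      simp only [Description.law, pairLaw, Description.mix, mixLaw, Sum.elim_inl]
      ring
    rw [this] at h
    exact (mul_pos_iff_of_pos_left h1').1 h
  have hlaw' : ∀ u a x x₁ o v, 0 < (t.mix t' l h0.le h1.le).law (u, a, x, x₁, o, .inr v) →
      0 < t'.law (u, a, x, x₁, o, v) := by
    intro u a x x₁ o v h
    have : (t.mix t' l h0.le h1.le).law (u, a, x, x₁, o, .inr v) =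
        l * t'.law (u, a, x, x₁, o, v) := by
      simp only [Description.law, pairLaw, Description.mix, mixLaw, Sum.elim_inr]
      ring
    rw [this] at h
    exact (mul_pos_iff_of_pos_left h0).1 h
  constructor <;> rintro u a x x₁ o (v | v) h
  · exact mul_pos h1' (ht.pV_pos u a x x₁ o v (hlaw _ _ _ _ _ _ h))
  · exact mul_pos h0 (ht'.pV_pos u a x x₁ o v (hlaw' _ _ _ _ _ _ h))
  · exact mul_pos h1' (ht.r_pos u a x x₁ o v (hlaw _ _ _ _ _ _ h))
  · exact mul_pos h0 (ht'.r_pos u a x x₁ o v (hlaw' _ _ _ _ _ _ h))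
  · exact ht.τ₀_pos u a x x₁ o v (hlaw _ _ _ _ _ _ h)
  · exact hτ u a x x₁ o v (hlaw' _ _ _ _ _ _ h)
  · exact ht.τ₁_pos u a x x₁ o v (hlaw _ _ _ _ _ _ h)
  · exact ht'.τ₁_pos u a x x₁ o v (hlaw' _ _ _ _ _ _ h)
  · exact ht.τ₂_pos u a x x₁ o v (hlaw _ _ _ _ _ _ h)
  · exact ht'.τ₂_pos u a x x₁ o v (hlaw' _ _ _ _ _ _ h)
  · exact ht.τ₃_pos u a x x₁ o v (hlaw _ _ _ _ _ _ h)
  · exact ht'.τ₃_pos u a x x₁ o v (hlaw' _ _ _ _ _ _ h)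
  · exact ht.τ₄_pos u a x x₁ o v (hlaw _ _ _ _ _ _ h)
  · exact ht'.τ₄_pos u a x x₁ o v (hlaw' _ _ _ _ _ _ h)

end Mix

/-! ### The empty description -/

section Erase

lemma condMutualInfo_marg {Ω Ω' α β γ : Type*} [Fintype Ω] [Fintype Ω'] [Fintype α] [Fintype β]
    [Fintype γ] (p : Ω → ℝ) (π : Ω → Ω') (f : Ω' → α) (g : Ω' → β) (h : Ω' → γ) :
    condMutualInfo (marg p π) f g h =
      condMutualInfo p (fun ω => f (π ω)) (fun ω => g (π ω)) fun ω => h (π ω) := by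
  simp only [condMutualInfo_eq, meanLog_marg]

variable {U A X X₁ S Sd Y Y₁ V : Type*} [Fintype U] [Fintype A] [Fintype X] [Fintype X₁]
  [Fintype S] [Fintype Sd] [Fintype Y] [Fintype Y₁] [Fintype V]
  (ch : Channel X X₁ S Sd Y Y₁) (q : Choice U A X X₁ Y₁ V)

/-- The same codewords with a constant description. -/
noncomputable def Choice.erase : Choice U A X X₁ Y₁ Unit where
  pU := q.pU
  pA := q.pA
  pX := q.pX
  pX₁ := q.pX₁
  pV _ _ _ _ := PMF.pure ()

/-- The empty description of the relay's observation. -/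
noncomputable def Choice.erased : Description (q.ensemble ch) Unit := q.erase.description ch

/-- Forgetting the value of `V`. -/
def dropV (ω : Sample U A X X₁ S Sd Y Y₁ V) : Sample U A X X₁ S Sd Y Y₁ Unit :=
  (rU ω, rA ω, rX ω, rX₁ ω, rS ω, rSd ω, rY ω, rY₁ ω, ())

omit [Fintype U] [Fintype A] [Fintype X] [Fintype X₁] [Fintype S] [Fintype Sd] [Fintype Y]
  [Fintype Y₁] [Fintype V] in
lemma jointLaw_eq_erase_mul (ω : Sample U A X X₁ S Sd Y Y₁ V) : jointLaw ch q ω =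
    jointLaw ch q.erase (dropV ω) * (q.pV (rU ω) (rA ω) (rX₁ ω) (rY₁ ω) (rV ω)).toReal := by
  simp [jointLaw, Choice.erase, dropV, rU, rA, rX, rX₁, rS, rSd, rY, rY₁, rV]

/-- Summation over `V` first. -/
lemma sum_sample (F : Sample U A X X₁ S Sd Y Y₁ V → ℝ) : ∑ ω, F ω =
    ∑ ω : Sample U A X X₁ S Sd Y Y₁ Unit, ∑ v, F (rU ω, rA ω, rX ω, rX₁ ω, rS ω, rSd ω, rY ω,
      rY₁ ω, v) := by
  simp only [Fintype.sum_prod_type, Finset.univ_unique, Finset.sum_singleton, rU, rA, rX, rX₁, rS,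
    rSd, rY, rY₁]

lemma jointLaw_erase : jointLaw ch q.erase = marg (jointLaw ch q) dropV := by
  classical
  funext ω₀
  rw [marg, sum_sample]
  simp only [jointLaw_eq_erase_mul ch q]
  have h : ∀ ω : Sample U A X X₁ S Sd Y Y₁ Unit, (∑ v : V,
      if dropV (rU ω, rA ω, rX ω, rX₁ ω, rS ω, rSd ω, rY ω, rY₁ ω, v) = ω₀ then
        jointLaw ch q.erase (dropV (rU ω, rA ω, rX ω, rX₁ ω, rS ω, rSd ω, rY ω, rY₁ ω, v)) *
          (q.pV (rU ω) (rA ω) (rX₁ ω) (rY₁ ω) v).toReal else 0) =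
      if ω = ω₀ then jointLaw ch q.erase ω else 0 := by
    intro ω
    by_cases hω : ω = ω₀
    · have h1 : ∀ v : V, dropV (rU ω, rA ω, rX ω, rX₁ ω, rS ω, rSd ω, rY ω, rY₁ ω, v) = ω :=
        fun v => rfl
      simp only [h1, if_pos hω, ← Finset.mul_sum, sum_toReal, mul_one]
    · exact (Finset.sum_eq_zero fun v _ => if_neg hω).trans (if_neg hω).symm
  refine Eq.trans ?_ (Finset.sum_congr rfl fun ω _ => (h ω).symm)
  simp

omit [Fintype V] in
lemma erased_pV (u : U) (a : A) (x₁ : X₁) (y₁ : Y₁) :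
    (q.erased ch).pV u a x₁ y₁ = (q.erased ch).r u a x₁ := by
  have h1 := ((q.erased ch).pV_mem u a x₁ y₁).2
  have h2 := ((q.erased ch).r_mem u a x₁).2
  funext v
  simp only [Finset.univ_unique, Finset.sum_singleton] at h1 h2
  exact h1.trans h2.symm

lemma rateV_erased : (q.erased ch).rateV = 0 := by
  have h : ∀ (u : U) (a : A) (x₁ : X₁) (y₁ : Y₁) (v : Unit), Real.logb 2
      ((q.erased ch).pV u a x₁ y₁ v / (q.erased ch).r u a x₁ v) = 0 := fun u a x₁ y₁ v => by
    rw [erased_pV]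
    rcases eq_or_ne ((q.erased ch).r u a x₁ v) 0 with h0 | h0
    · rw [h0, div_zero, Real.logb_zero]
    · rw [div_self h0, Real.logb_one]
  simp only [Description.rateV, h]
  exact (q.erased ch).avg_const 0

omit [Fintype V] in
lemma condMutualInfo_V_erase : condMutualInfo (jointLaw ch q.erase) rV rY₁
    (fun ω => (rU ω, rA ω, rX ω, rX₁ ω, rY ω)) = 0 := by
  rw [condMutualInfo_eq]
  have e1 : meanLog (jointLaw ch q.erase) (fun ω => (rV ω, rY₁ ω, rU ω, rA ω, rX ω, rX₁ ω, rY ω)) =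
      meanLog (jointLaw ch q.erase) (fun ω => (rY₁ ω, rU ω, rA ω, rX ω, rX₁ ω, rY ω)) :=
    meanLog_congr fun ω ω' => by simp only [Prod.mk.injEq, true_and]
  have e2 : meanLog (jointLaw ch q.erase) (fun ω => (rV ω, rU ω, rA ω, rX ω, rX₁ ω, rY ω)) =
      meanLog (jointLaw ch q.erase) (fun ω => (rU ω, rA ω, rX ω, rX₁ ω, rY ω)) :=
    meanLog_congr fun ω ω' => by simp only [Prod.mk.injEq, true_and]
  rw [e1, e2]
  ring

lemma τ₀_erased : (q.erased ch).τ₀ = (q.description ch).τ₀ := by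
  simp only [Choice.erased, Choice.description, condProb, jointLaw_erase, marg_marg]
  rfl

lemma rate₀_erased : (q.erased ch).rate₀ = (q.description ch).rate₀ := by
  rw [rate₀_description]
  refine (rate₀_description ch q.erase).trans ?_
  rw [jointLaw_erase, condMutualInfo_marg]
  rfl

lemma rate₁_erased : (q.erased ch).rate₁ =
    condMutualInfo (jointLaw ch q) rX rY (fun ω => (rU ω, rA ω, rX₁ ω)) := by
  refine (rate₁_description ch q.erase).trans ?_
  rw [jointLaw_erase, condMutualInfo_marg, condMutualInfo_eq, condMutualInfo_eq]
  congr 1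
  · congr 1
    congr 1
    exact meanLog_congr fun ω ω' => by simp only [Prod.mk.injEq, true_and]; rfl
  · exact meanLog_congr fun ω ω' => by simp only [Prod.mk.injEq, true_and]; rfl

lemma rate₂_erased : (q.erased ch).rate₂ =
    condMutualInfo (jointLaw ch q) (fun ω => (rX ω, rX₁ ω)) rY (fun ω => (rU ω, rA ω)) := by
  refine (rate₂_description ch q.erase).trans ?_
  have hV : (q.erase.description ch).rateV = 0 := rateV_erased ch q
  rw [hV, condMutualInfo_V_erase, sub_zero, add_zero, jointLaw_erase, condMutualInfo_marg]
  rfl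

lemma rate₃_erased : (q.erased ch).rate₃ =
    condMutualInfo (jointLaw ch q) rX₁ rY (fun ω => (rU ω, rA ω, rX ω)) := by
  refine (rate₃_description ch q.erase).trans ?_
  have hV : (q.erase.description ch).rateV = 0 := rateV_erased ch q
  rw [hV, condMutualInfo_V_erase, sub_zero, add_zero, jointLaw_erase, condMutualInfo_marg]
  rfl

lemma le_rate₄_erased : mutualInfo (jointLaw ch q) (fun ω => (rX ω, rX₁ ω)) rY ≤
    (q.erased ch).rate₄ := by
  have h := le_rate₄_description ch q.erase
  have hV : (q.erase.description ch).rateV = 0 := rateV_erased ch q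
  rw [hV, condMutualInfo_V_erase, sub_zero, add_zero, jointLaw_erase, mutualInfo_eq] at h
  simp only [meanLog_marg] at h
  rw [mutualInfo_eq]
  exact h

end Erase

/-! ### The choice of rates -/

section Split

/-- Splitting a rate into the part that the relay decodes and the rest. Here `P` says that no
description is sent. -/
lemma exists_rate_split {R m₀ m₁ m₂ m₄ ρ : ℝ} {P : Prop} (hR0 : 0 ≤ R) (hm₀ : 0 ≤ m₀)
    (h : R = 0 ∨ R < m₀ + m₁ ∧ (P ∨ R + ρ < m₀ + m₂) ∧ R + ρ < m₄) :
    ∃ γ r' r'' : ℝ, 0 < γ ∧ 0 ≤ r' ∧ 0 ≤ r'' ∧ (R = 0 ∨ R < r' + r'') ∧ (R = 0 → r' = 0) ∧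
      (r' = 0 ∨ r' + γ ≤ m₀) ∧ (r'' = 0 ∨ r'' + γ ≤ m₁) ∧
      (r'' = 0 ∨ P ∨ r'' + ρ + γ ≤ m₂) ∧ (r' = 0 ∨ r' + r'' + ρ + γ ≤ m₄) := by
  rcases h with h | ⟨h1, h2, h4⟩
  · exact ⟨1, 0, 0, one_pos, le_rfl, le_rfl, Or.inl h, fun _ => rfl, Or.inl rfl, Or.inl rfl,
      Or.inl rfl, Or.inl rfl⟩
  rcases hR0.eq_or_lt with hR | hR
  · exact ⟨1, 0, 0, one_pos, le_rfl, le_rfl, Or.inl hR.symm, fun _ => rfl, Or.inl rfl, Or.inl rfl,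
      Or.inl rfl, Or.inl rfl⟩
  obtain ⟨g, hg, hg1, hg2, hg4⟩ : ∃ g : ℝ, 0 < g ∧ R + 4 * g ≤ m₀ + m₁ ∧
      (P ∨ R + ρ + 4 * g ≤ m₀ + m₂) ∧ R + ρ + 4 * g ≤ m₄ := by
    by_cases hP : P
    · refine ⟨min (m₀ + m₁ - R) (m₄ - (R + ρ)) / 4, ?_, ?_, Or.inl hP, ?_⟩
      · exact div_pos (lt_min (by linarith) (by linarith)) (by norm_num)
      · linarith [min_le_left (m₀ + m₁ - R) (m₄ - (R + ρ))]
      · linarith [min_le_right (m₀ + m₁ - R) (m₄ - (R + ρ))]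
    · have h2' := h2.resolve_left hP
      refine ⟨min (m₀ + m₁ - R) (min (m₀ + m₂ - (R + ρ)) (m₄ - (R + ρ))) / 4, ?_, ?_,
        Or.inr ?_, ?_⟩
      · exact div_pos (lt_min (by linarith) (lt_min (by linarith) (by linarith))) (by norm_num)
      · linarith [min_le_left (m₀ + m₁ - R) (min (m₀ + m₂ - (R + ρ)) (m₄ - (R + ρ)))]
      · linarith [min_le_right (m₀ + m₁ - R) (min (m₀ + m₂ - (R + ρ)) (m₄ - (R + ρ))),
          min_le_left (m₀ + m₂ - (R + ρ)) (m₄ - (R + ρ))]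
      · linarith [min_le_right (m₀ + m₁ - R) (min (m₀ + m₂ - (R + ρ)) (m₄ - (R + ρ))),
          min_le_right (m₀ + m₂ - (R + ρ)) (m₄ - (R + ρ))]
  -- the rate `R + g` is split
  rcases lt_or_ge (R + g) m₀ with hlt | hge
  · refine ⟨min g (m₀ - (R + g)), R + g, 0, lt_min hg (by linarith), by linarith, le_rfl,
      Or.inr (by linarith), fun h => absurd h hR.ne', Or.inr ?_, Or.inl rfl, Or.inl rfl, Or.inr ?_⟩
    · linarith [min_le_right g (m₀ - (R + g))]
    · linarith [min_le_left g (m₀ - (R + g))]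
  · rcases hm₀.eq_or_lt with h0 | h0
    · refine ⟨g, 0, R + g, hg, le_rfl, by linarith, Or.inr (by linarith),
        fun _ => rfl, Or.inl rfl, Or.inr (by linarith), Or.inr (hg2.imp id fun h => by linarith),
        Or.inl rfl⟩
    · have hc0 : 0 < min g m₀ := lt_min hg h0
      have hc1 := min_le_left g m₀
      have hc2 := min_le_right g m₀
      refine ⟨min g m₀, m₀ - min g m₀, R + g - m₀ + min g m₀, hc0, by linarith, by linarith,
        Or.inr (by linarith), fun h => absurd h hR.ne', Or.inr (by linarith),
        Or.inr (by linarith), Or.inr (hg2.imp id fun h => by linarith), Or.inr (by linarith)⟩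

end Split

/-! ### Selecting the description at the decoder -/

section Selection

variable {Ω ζ V : Type*} [Fintype Ω] [Fintype ζ] [Fintype V]

/-- If a random choice `V` depends, given `Z`, on nothing else, then a function of `Z` does at
least as well on average. -/
lemma exists_selection [Nonempty V] {p : Ω → ℝ} (hp : ∀ ω, 0 ≤ p ω) {k : Ω → V → ℝ}
    (hk : ∀ ω, k ω ∈ stdSimplex ℝ V) (Z : Ω → ζ) (κ : ζ → V → ℝ)
    (h : ∀ ω, 0 < p ω → k ω = κ (Z ω)) (c : Ω → V → ℝ) :
    ∃ s : ζ → V, mean p (fun ω => c ω (s (Z ω))) ≤ mean p fun ω => mean (k ω) (c ω) := by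
  classical
  let G : ζ → V → ℝ := fun z v => ∑ ω, if Z ω = z then p ω * c ω v else 0
  have hex : ∀ z, ∃ v, G z v ≤ mean (κ z) (G z) := by
    intro z
    by_cases hz : ∃ ω, 0 < p ω ∧ Z ω = z
    · obtain ⟨ω, hω, rfl⟩ := hz
      exact exists_le_mean (h ω hω ▸ hk ω) _
    · have hG : ∀ v, G z v = 0 := fun v => Finset.sum_eq_zero fun ω _ => by
        split_ifs with hω
        · rw [le_antisymm (not_lt.1 fun h0 => hz ⟨ω, h0, hω⟩) (hp ω), zero_mul]
        · rfl
      refine ⟨Classical.arbitrary V, le_of_eq ?_⟩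
      simp only [mean, hG, mul_zero, Finset.sum_const_zero]
  choose s hs using hex
  refine ⟨s, ?_⟩
  have h1 : mean p (fun ω => c ω (s (Z ω))) = ∑ z, G z (s z) := by
    simp only [G]
    rw [Finset.sum_comm]
    simp [mean]
  have h2 : mean p (fun ω => mean (k ω) (c ω)) = ∑ z, mean (κ z) (G z) := by
    simp only [G, mean_sum]
    rw [Finset.sum_comm]
    refine Finset.sum_congr rfl fun ω _ => ?_
    rw [Finset.sum_eq_single (Z ω) (fun z _ hz => by simp [mean, hz.symm]) (by simp)]
    simp only [if_true, mean_mul_left]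
    rcases (hp ω).eq_or_lt with h0 | h0
    · rw [← h0, zero_mul, zero_mul]
    · rw [h ω h0]
  rw [h1, h2]
  exact Finset.sum_le_sum fun z _ => hs z

end Selection

section Choice

variable {U A X X₁ S Sd Y Y₁ V Shat : Type*} [Fintype U] [Fintype A] [Fintype X] [Fintype X₁]
  [Fintype S] [Fintype Sd] [Fintype Y] [Fintype Y₁] [Fintype V]
  {ch : Channel X X₁ S Sd Y Y₁} {q : Choice U A X X₁ Y₁ V} {d : Sd → Shat → ℝ}

/-- If `I(V ; Y₁ | U A X X₁ Y) = 0`, then the decoder can choose the description by itself. -/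
lemma exists_erased_estimator (est : X → X₁ → Y → V → Shat)
    (h0 : condMutualInfo (jointLaw ch q) rV rY₁ (fun ω => (rU ω, rA ω, rX ω, rX₁ ω, rY ω)) = 0) :
    ∃ s : U × A × X × X₁ × Y → V, (q.erased ch).avg (fun u a x x₁ o _ =>
      d o.2.1 (est x x₁ o.2.2.1 (s (u, a, x, x₁, o.2.2.1)))) ≤ expDistortion ch q d est := by
  have hV : Nonempty V := by
    obtain ⟨u, -⟩ := q.pU.support_nonempty
    obtain ⟨a, -⟩ := (q.pA u).support_nonempty
    obtain ⟨x, -⟩ := (q.pX u a).support_nonempty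
    obtain ⟨x₁, -⟩ := (q.pX₁ u).support_nonempty
    obtain ⟨s, -⟩ := ch.state.support_nonempty
    obtain ⟨o, -⟩ := (ch.output x x₁ s.1).support_nonempty
    obtain ⟨v, -⟩ := (q.pV u a x₁ o.2).support_nonempty
    exact ⟨v⟩
  obtain ⟨s, hs⟩ := exists_selection (jointLaw_nonneg ch q.erase)
    (k := fun ω v => (q.pV (rU ω) (rA ω) (rX₁ ω) (rY₁ ω) v).toReal) (fun ω => pmf_mem _)
    (fun ω => (rU ω, rA ω, rX ω, rX₁ ω, rY ω))
    (fun z v => marg (jointLaw ch q) (fun ω => (rV ω, rU ω, rA ω, rX ω, rX₁ ω, rY ω)) (v, z) /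
      marg (jointLaw ch q) (fun ω => (rU ω, rA ω, rX ω, rX₁ ω, rY ω)) z)
    (fun ω hω => funext fun v => by
      have h1 := marg_eq_condProd rV rY₁ (fun ω => (rU ω, rA ω, rX ω, rX₁ ω, rY ω))
        (jointLaw_mem ch q) h0 (v, rY₁ ω, rU ω, rA ω, rX ω, rX₁ ω, rY ω)
      have h2 := hω.trans_le (le_marg (jointLaw_nonneg ch q.erase)
        (fun ω => (rY₁ ω, rU ω, rA ω, rX ω, rX₁ ω, rY ω)) ω)
      rw [jointLaw_erase, marg_marg] at h2
      change 0 < marg (jointLaw ch q) (fun ω => (rY₁ ω, rU ω, rA ω, rX ω, rX₁ ω, rY ω)) _ at h2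
      have h3 := marg_UAXX₁YY₁V ch q (rU ω) (rA ω) (rX ω) (rX₁ ω) (rY ω) (rY₁ ω) v
      rw [← marg_congr (f := fun ω : Sample U A X X₁ S Sd Y Y₁ V =>
          (rV ω, rY₁ ω, rU ω, rA ω, rX ω, rX₁ ω, rY ω))
          (a := (v, rY₁ ω, rU ω, rA ω, rX ω, rX₁ ω, rY ω))
          (fun ω' => by simp only [Prod.mk.injEq]; tauto), h1,
        ← marg_congr (f := fun ω : Sample U A X X₁ S Sd Y Y₁ V =>
          (rY₁ ω, rU ω, rA ω, rX ω, rX₁ ω, rY ω))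
          (a := (rY₁ ω, rU ω, rA ω, rX ω, rX₁ ω, rY ω))
          (fun ω' => by simp only [Prod.mk.injEq]; tauto), condProd] at h3
      dsimp only at h3
      have h4 := h2.ne'
      rw [mul_div_right_comm, mul_comm] at h3
      exact (mul_left_cancel₀ h4 h3).symm)
    fun ω v => d (rSd ω) (est (rX ω) (rX₁ ω) (rY ω) v)
  refine ⟨s, ?_⟩
  have h1 : expDistortion ch q d est = mean (jointLaw ch q.erase) fun ω =>
      mean (fun v => (q.pV (rU ω) (rA ω) (rX₁ ω) (rY₁ ω) v).toReal) fun v =>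
        d (rSd ω) (est (rX ω) (rX₁ ω) (rY ω) v) := by
    rw [expDistortion, sum_sample]
    refine Finset.sum_congr rfl fun ω _ => ?_
    simp only [mean, Finset.mul_sum]
    refine Finset.sum_congr rfl fun v _ => ?_
    rw [jointLaw_eq_erase_mul, mul_assoc]
    rfl
  rw [h1]
  exact (avg_description ch q.erase _).trans_le hs

/-- A description whose rates leave room gives good codes of all large lengths. -/
lemma eventually_exists_code {W : Type*} [Fintype W] (t : Description (q.ensemble ch) W)
    (ht : t.Regular) (e : U → A → X → X₁ → W → Y → Shat) (s₀ : Shat) {b : ℝ} (hb : 0 ≤ b)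
    (hd : ∀ s s', 0 ≤ d s s') (hdb : ∀ s s', d s s' ≤ b) [Nonempty Y₁]
    {r' r'' rk η R : ℝ} (hη : 0 < η)
    (hr' : 0 ≤ r') (hr'' : 0 ≤ r'') (hrk : 0 ≤ rk) (hR0 : 0 ≤ R)
    (h0 : r' = 0 ∨ r' ≤ t.rate₀ - 2 * η) (h1 : r'' = 0 ∨ r'' ≤ t.rate₁ - 2 * η)
    (h2 : r'' = 0 ∨ rk = 0 ∨ r'' + rk ≤ t.rate₂ - 2 * η) (h3 : rk = 0 ∨ rk ≤ t.rate₃ - 2 * η)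
    (h4 : r' = 0 ∨ r' + r'' + rk ≤ t.rate₄ - 2 * η)
    (hV : (∀ u a x₁ y₁, t.pV u a x₁ y₁ = t.r u a x₁) ∨ t.rateV + 3 * η ≤ rk)
    (h3' : rk = 0 ∨ 2 * η < (q.erased ch).rate₃) (h4' : r' = 0 ∨ 2 * η < (q.erased ch).rate₄)
    (hR : R = 0 ∨ R < r' + r'') {z : ℝ} (hz : 0 < z) :
    ∀ᶠ n : ℕ in atTop, ∃ code : Code X X₁ Y Y₁ Shat (numMessages R n) n,
      errorProb ch code ≤ z ∧ avgDistortion ch d code ≤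
        t.avg (fun u a x x₁ o w => d o.2.1 (e u a x x₁ w o.2.2.1)) + z := by
  set Δ := t.avg (fun u a x x₁ o w => d o.2.1 (e u a x x₁ w o.2.2.1)) with hΔ
  have hΔ0 : 0 ≤ Δ := by
    rw [← t.avg_const 0]; exact t.avg_mono fun _ _ _ _ _ _ => hd _ _
  -- the weight of the error probability
  set lam := 2 * (Δ + 1 + b) / z with hlam
  have hlam0 : 0 < lam := by positivity
  set ε := min 1 (z / (2 * (1 + b + lam))) with hε
  have hε0 : 0 < ε := lt_min one_pos (by positivity)
  have hε1 : ε ≤ 1 := min_le_left _ _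
  have hε2 : ε * (2 * (1 + b + lam)) ≤ z := by
    rw [← le_div_iff₀ (by positivity)]; exact min_le_right _ _
  have hschemes := eventually_hasSchemes t ht (q.erased ch) (regular_description ch q.erase)
    (erased_pV ch q) e s₀ hb (δ := fun o s => d o.2.1 s) (fun _ _ => hd _ _) (fun _ _ => hdb _ _)
    hη hr' hr'' hrk hR0 h0 h1 h2 h3 h4 hV h3' h4' hR hε0
  filter_upwards [hschemes, eventually_gt_atTop 0] with n ⟨Wn, K, W'', B, hW, hK, hcard, hS⟩ hn
  have hn0 : (n : ℝ) ≠ 0 := by exact_mod_cast hn.ne'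
  obtain ⟨code, hc1, hc2⟩ := exists_code_of_hasSchemes (M := numMessages R n)
    (by unfold numMessages; positivity) hn
    ⟨0, Nat.pos_of_ne_zero hW⟩ ⟨0, Nat.pos_of_ne_zero hK⟩ hcard hd hdb hb hlam0 hS
  rw [mul_div_cancel_left₀ _ hn0] at hc1 hc2
  refine ⟨code, hc1.trans ?_, hc2.trans ?_⟩
  · have h5 : (Δ + ε + b * ε) / lam ≤ z / 2 := by
      rw [div_le_iff₀ hlam0, hlam]
      have : z / 2 * (2 * (Δ + 1 + b) / z) = Δ + 1 + b := by field_simp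
      rw [this]
      nlinarith
    have h6 : ε ≤ z / 2 := by nlinarith [mul_pos hε0 hlam0, mul_nonneg hε0.le hb]
    change ε + (Δ + ε + b * ε) / lam ≤ z
    linarith
  · change Δ + ε + b * ε + lam * ε ≤ Δ + z
    nlinarith [mul_pos hε0 hlam0, mul_nonneg hε0.le hb]

end Choice

/-! ### Achievability -/

section Achievability

variable {U A X X₁ S Sd Y Y₁ V Shat : Type*} [Fintype U] [Fintype A] [Fintype X] [Fintype X₁]
  [Fintype S] [Fintype Sd] [Fintype Y] [Fintype Y₁] [Fintype V]
  {ch : Channel X X₁ S Sd Y Y₁} {q : Choice U A X X₁ Y₁ V} {d : Sd → Shat → ℝ}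

lemma rateV_description_nonneg : 0 ≤ (q.description ch).rateV := by
  have h := condMutualInfo_nonneg rV rY₁ (fun ω => (rU ω, rA ω, rX₁ ω)) (jointLaw_mem ch q)
  rw [condMutualInfo_eq] at h
  have e1 : meanLog (jointLaw ch q) (fun ω => (rV ω, rY₁ ω, rU ω, rA ω, rX₁ ω)) =
      meanLog (jointLaw ch q) (fun ω => (rU ω, rA ω, rX₁ ω, rY₁ ω, rV ω)) :=
    meanLog_congr fun ω ω' => by simp only [Prod.mk.injEq]; tauto
  have e2 : meanLog (jointLaw ch q) (fun ω => (rV ω, rU ω, rA ω, rX₁ ω)) =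
      meanLog (jointLaw ch q) (fun ω => (rU ω, rA ω, rX₁ ω, rV ω)) :=
    meanLog_congr fun ω ω' => by simp only [Prod.mk.injEq]; tauto
  have e3 : meanLog (jointLaw ch q) (fun ω => (rY₁ ω, rU ω, rA ω, rX₁ ω)) =
      meanLog (jointLaw ch q) (fun ω => (rU ω, rA ω, rX₁ ω, rY₁ ω)) :=
    meanLog_congr fun ω ω' => by simp only [Prod.mk.injEq]; tauto
  rw [e1, e2, e3, meanLog_UAX₁Y₁V, meanLog_UAX₁V] at h
  rw [rateV_description]
  linarith

/-- `I(X X₁ ; Y | U A) ≤ I(X ; Y | U A X₁) + I(X₁ ; Y | U A X)`, because `X` and `X₁` are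
independent given `U, A`. -/
lemma condMutualInfo_XX₁_le : condMutualInfo (jointLaw ch q) (fun ω => (rX ω, rX₁ ω)) rY
      (fun ω => (rU ω, rA ω)) ≤
    condMutualInfo (jointLaw ch q) rX rY (fun ω => (rU ω, rA ω, rX₁ ω)) +
      condMutualInfo (jointLaw ch q) rX₁ rY (fun ω => (rU ω, rA ω, rX ω)) := by
  have h := condMutualInfo_nonneg rX rX₁ (fun ω => (rU ω, rA ω, rY ω)) (jointLaw_mem ch q)
  rw [condMutualInfo_eq] at h
  rw [condMutualInfo_eq, condMutualInfo_eq, condMutualInfo_eq]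
  have e1 : meanLog (jointLaw ch q) (fun ω => ((rX ω, rX₁ ω), rY ω, rU ω, rA ω)) =
      meanLog (jointLaw ch q) (fun ω => (rX ω, rX₁ ω, rU ω, rA ω, rY ω)) :=
    meanLog_congr fun ω ω' => by simp only [Prod.mk.injEq]; tauto
  have e2 : meanLog (jointLaw ch q) (fun ω => ((rX ω, rX₁ ω), rU ω, rA ω)) =
      meanLog (jointLaw ch q) (fun ω => (rU ω, rA ω, rX ω, rX₁ ω)) :=
    meanLog_congr fun ω ω' => by simp only [Prod.mk.injEq]; tauto
  have e3 : meanLog (jointLaw ch q) (fun ω => (rY ω, rU ω, rA ω)) =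
      meanLog (jointLaw ch q) (fun ω => (rU ω, rA ω, rY ω)) :=
    meanLog_congr fun ω ω' => by simp only [Prod.mk.injEq]; tauto
  have e4 : meanLog (jointLaw ch q) (fun ω => (rX ω, rY ω, rU ω, rA ω, rX₁ ω)) =
      meanLog (jointLaw ch q) (fun ω => (rX ω, rX₁ ω, rU ω, rA ω, rY ω)) :=
    meanLog_congr fun ω ω' => by simp only [Prod.mk.injEq]; tauto
  have e5 : meanLog (jointLaw ch q) (fun ω => (rX ω, rU ω, rA ω, rX₁ ω)) =
      meanLog (jointLaw ch q) (fun ω => (rU ω, rA ω, rX ω, rX₁ ω)) :=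
    meanLog_congr fun ω ω' => by simp only [Prod.mk.injEq]; tauto
  have e6 : meanLog (jointLaw ch q) (fun ω => (rY ω, rU ω, rA ω, rX₁ ω)) =
      meanLog (jointLaw ch q) (fun ω => (rX₁ ω, rU ω, rA ω, rY ω)) :=
    meanLog_congr fun ω ω' => by simp only [Prod.mk.injEq]; tauto
  have e7 : meanLog (jointLaw ch q) (fun ω => (rX₁ ω, rY ω, rU ω, rA ω, rX ω)) =
      meanLog (jointLaw ch q) (fun ω => (rX ω, rX₁ ω, rU ω, rA ω, rY ω)) :=
    meanLog_congr fun ω ω' => by simp only [Prod.mk.injEq]; tauto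
  have e8 : meanLog (jointLaw ch q) (fun ω => (rX₁ ω, rU ω, rA ω, rX ω)) =
      meanLog (jointLaw ch q) (fun ω => (rU ω, rA ω, rX ω, rX₁ ω)) :=
    meanLog_congr fun ω ω' => by simp only [Prod.mk.injEq]; tauto
  have e9 : meanLog (jointLaw ch q) (fun ω => (rY ω, rU ω, rA ω, rX ω)) =
      meanLog (jointLaw ch q) (fun ω => (rX ω, rU ω, rA ω, rY ω)) :=
    meanLog_congr fun ω ω' => by simp only [Prod.mk.injEq]; tauto
  rw [e1, e2, e3, e4, e5, e6, e7, e8, e9]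
  linarith [meanLog_UAXX₁ ch q, meanLog_UAX ch q]

lemma expDistortion_nonneg (hd : ∀ s s', 0 ≤ d s s') (est : X → X₁ → Y → V → Shat) :
    0 ≤ expDistortion ch q d est :=
  Finset.sum_nonneg fun ω _ => mul_nonneg (jointLaw_nonneg ch q ω) (hd _ _)

set_option maxHeartbeats 1000000 in
/-- Codes of rate `R` and distortion `D` up to `z`, under the hypotheses of the theorem with strict
inequalities for `R` unless `R = 0`. -/
lemma eventually_exists_code_of_lt [Nonempty Y₁] [Nonempty Shat] (est : X → X₁ → Y → V → Shat)
    {b : ℝ} (hb : 0 ≤ b) (hd : ∀ s s', 0 ≤ d s s') (hdb : ∀ s s', d s s' ≤ b) {R : ℝ} (hR0 : 0 ≤ R)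
    (hR : R = 0 ∨ R < condMutualInfo (jointLaw ch q) rA rY₁ (fun ω => (rU ω, rX₁ ω))
        + condMutualInfo (jointLaw ch q) rX (fun ω => (rV ω, rY ω))
          (fun ω => (rU ω, rA ω, rX₁ ω)) ∧
      R < condMutualInfo (jointLaw ch q) rA rY₁ (fun ω => (rU ω, rX₁ ω))
        + condMutualInfo (jointLaw ch q) (fun ω => (rX ω, rX₁ ω)) rY (fun ω => (rU ω, rA ω))
        - condMutualInfo (jointLaw ch q) rV rY₁ (fun ω => (rU ω, rA ω, rX ω, rX₁ ω, rY ω)) ∧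
      R < mutualInfo (jointLaw ch q) (fun ω => (rX ω, rX₁ ω)) rY
        - condMutualInfo (jointLaw ch q) rV rY₁ (fun ω => (rU ω, rA ω, rX ω, rX₁ ω, rY ω)))
    (h₄ : condMutualInfo (jointLaw ch q) rV rY₁ (fun ω => (rU ω, rA ω, rX ω, rX₁ ω, rY ω)) ≤
      condMutualInfo (jointLaw ch q) rX₁ rY (fun ω => (rU ω, rA ω, rX ω)))
    {z : ℝ} (hz : 0 < z) :
    ∀ᶠ n : ℕ in atTop, ∃ code : Code X X₁ Y Y₁ Shat (numMessages R n) n,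
      errorProb ch code ≤ z ∧ avgDistortion ch d code ≤ expDistortion ch q d est + z := by
  have hI0 := condMutualInfo_nonneg rA rY₁ (fun ω => (rU ω, rX₁ ω)) (jointLaw_mem ch q)
  have hI1 := condMutualInfo_nonneg rX (fun ω => (rV ω, rY ω)) (fun ω => (rU ω, rA ω, rX₁ ω))
    (jointLaw_mem ch q)
  have hJ1 := condMutualInfo_nonneg rX rY (fun ω => (rU ω, rA ω, rX₁ ω)) (jointLaw_mem ch q)
  have hJ3 := condMutualInfo_nonneg rX₁ rY (fun ω => (rU ω, rA ω, rX ω)) (jointLaw_mem ch q)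
  have hc := condMutualInfo_nonneg rV rY₁ (fun ω => (rU ω, rA ω, rX ω, rX₁ ω, rY ω))
    (jointLaw_mem ch q)
  have hJ2 := condMutualInfo_XX₁_le (ch := ch) (q := q)
  have hν := rateV_description_nonneg (ch := ch) (q := q)
  have hr0 := rate₀_description ch q
  have hr1 := rate₁_description ch q
  have hr2 := rate₂_description ch q
  have hr3 := rate₃_description ch q
  have hr4 := le_rate₄_description ch q
  have he0 := rate₀_erased ch q
  have he1 := rate₁_erased ch q
  have he2 := rate₂_erased ch q
  have he3 := rate₃_erased ch q
  have he4 := le_rate₄_erased ch q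
  have heV := rateV_erased ch q
  have hΔ0 := expDistortion_nonneg (ch := ch) (q := q) hd est
  have hΔ : (q.description ch).avg (fun u a x x₁ o v => d o.2.1 (est x x₁ o.2.2.1 v)) =
    expDistortion ch q d est := avg_description ch q _
  obtain ⟨s₀⟩ := ‹Nonempty Shat›
  have hregE : (q.erased ch).Regular := regular_description ch q.erase
  have hsel := fun h0 => exists_erased_estimator (ch := ch) (q := q) (d := d) est h0
  revert hI0 hI1 hJ1 hJ3 hc hJ2 hr0 hr1 hr2 hr3 hr4 he1 he2 he3 he4 hR h₄ hsel
  generalize condMutualInfo (jointLaw ch q) rA rY₁ (fun ω => (rU ω, rX₁ ω)) = I0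
  generalize condMutualInfo (jointLaw ch q) rX (fun ω => (rV ω, rY ω))
    (fun ω => (rU ω, rA ω, rX₁ ω)) = I1
  generalize condMutualInfo (jointLaw ch q) (fun ω => (rX ω, rX₁ ω)) rY
    (fun ω => (rU ω, rA ω)) = J2
  generalize condMutualInfo (jointLaw ch q) rV rY₁
    (fun ω => (rU ω, rA ω, rX ω, rX₁ ω, rY ω)) = c
  generalize condMutualInfo (jointLaw ch q) rX₁ rY (fun ω => (rU ω, rA ω, rX ω)) = J3
  generalize condMutualInfo (jointLaw ch q) rX rY (fun ω => (rU ω, rA ω, rX₁ ω)) = J1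
  generalize mutualInfo (jointLaw ch q) (fun ω => (rX ω, rX₁ ω)) rY = J4
  intro hR h₄ hI0 hI1 hJ1 hJ3 hc hJ2 hr0 hr1 hr2 hr3 hr4 he1 he2 he3 he4 hsel
  have h4' : R = 0 ∨ 0 < (q.erased ch).rate₄ := hR.imp id fun h => by linarith [h.2.2]
  rcases hJ3.eq_or_lt with h0 | hpos
  · -- the relay cannot convey anything: no description is sent
    have hc0 : c = 0 := le_antisymm (h0 ▸ h₄) hc
    obtain ⟨s, hs⟩ := hsel hc0
    obtain ⟨γ, r', r'', hγ, hr', hr'', hR', hR'', g0, g1, -, g4⟩ := exists_rate_split (R := R)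
      (m₀ := (q.erased ch).rate₀) (m₁ := (q.erased ch).rate₁) (m₂ := 0)
      (m₄ := (q.erased ch).rate₄) (ρ := 0) (P := True) hR0 (by linarith)
      (hR.imp id fun h => ⟨by linarith [h.2.1], Or.inl trivial, by linarith [h.2.2]⟩)
    obtain ⟨η, hη, hη1, hη2⟩ : ∃ η : ℝ, 0 < η ∧ 2 * η ≤ γ ∧
        (r' = 0 ∨ 2 * η < (q.erased ch).rate₄) := by
      rcases h4' with h | h
      · exact ⟨γ / 2, half_pos hγ, by linarith, Or.inl (hR'' h)⟩
      · exact ⟨min γ (q.erased ch).rate₄ / 4, div_pos (lt_min hγ h) (by norm_num),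
          by linarith [min_le_left γ (q.erased ch).rate₄],
          Or.inr (by linarith [min_le_right γ (q.erased ch).rate₄])⟩
    have key := eventually_exists_code (q.erased ch) hregE
      (fun u a x x₁ _ y => est x x₁ y (s (u, a, x, x₁, y))) s₀ hb hd hdb hη hr' hr'' le_rfl hR0
      (g0.imp id fun h => by linarith) (g1.imp id fun h => by linarith) (Or.inr (Or.inl rfl))
      (Or.inl rfl) (g4.imp id fun h => by linarith) (Or.inl (erased_pV ch q)) (Or.inl rfl) hη2
      hR' hz
    filter_upwards [key] with n ⟨code, hcode1, hcode2⟩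
    exact ⟨code, hcode1, hcode2.trans (add_le_add hs le_rfl)⟩
  · -- the description is dropped with a small probability `l`
    obtain ⟨l, hl0, hl1, hlR, hlz⟩ : ∃ l : ℝ, 0 < l ∧ l < 1 ∧
        (R = 0 ∨ R < I0 + (1 - l) * I1) ∧ l * b ≤ z / 2 := by
      obtain ⟨l₁, h1, h2⟩ : ∃ l₁ : ℝ, 0 < l₁ ∧ (R = 0 ∨ ∀ l, l ≤ l₁ → R < I0 + (1 - l) * I1) := by
        rcases hR with h | h
        · exact ⟨1, one_pos, Or.inl h⟩
        · have hgap : 0 < I0 + I1 - R := by linarith [h.1]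
          have hI1' : 0 < I1 + 1 := by linarith
          refine ⟨(I0 + I1 - R) / (I1 + 1), div_pos hgap hI1', Or.inr fun l hl => ?_⟩
          rw [le_div_iff₀ hI1'] at hl
          rcases le_or_gt l 0 with hl' | hl' <;> nlinarith
      refine ⟨min l₁ (min (1 / 2) (z / (2 * (b + 1)))), lt_min h1 (lt_min (by norm_num)
        (by positivity)), ?_, h2.imp id fun h => h _ (min_le_left _ _), ?_⟩
      · exact ((min_le_right _ _).trans (min_le_left _ _)).trans_lt (by norm_num)
      · have h3 : min l₁ (min (1 / 2) (z / (2 * (b + 1)))) ≤ z / (2 * (b + 1)) :=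
          (min_le_right _ _).trans (min_le_right _ _)
        refine (mul_le_mul_of_nonneg_right h3 hb).trans ?_
        rw [div_mul_eq_mul_div, div_le_iff₀ (by positivity)]
        nlinarith
    set t := (q.description ch).mix (q.erased ch) l hl0.le hl1.le with ht
    have hreg : t.Regular := (regular_description ch q).mix hregE hl0 hl1 fun u a x x₁ o v h => by
      rw [← τ₀_erased]; exact hregE.τ₀_pos u a x x₁ o v h
    have ht0 : t.rate₀ = I0 := by
      rw [ht, Description.rate₀_mix _ _ _ _ he0 (τ₀_erased ch q), hr0]
    have ht1 : t.rate₁ = (1 - l) * I1 + l * J1 := by rw [ht, Description.rate₁_mix, hr1, he1]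
    set ν := (q.description ch).rateV
    have ht2 : t.rate₂ = J2 + (1 - l) * (ν - c) := by
      rw [ht, Description.rate₂_mix, hr2, he2]; ring
    have ht3 : t.rate₃ = J3 + (1 - l) * (ν - c) := by
      rw [ht, Description.rate₃_mix, hr3, he3]; ring
    have ht4 : J4 + (1 - l) * (ν - c) ≤ t.rate₄ := by
      rw [ht, Description.rate₄_mix]
      nlinarith [mul_le_mul_of_nonneg_left hr4 (sub_nonneg.2 hl1.le),
        mul_le_mul_of_nonneg_left he4 hl0.le]
    have htV : t.rateV = (1 - l) * ν := by
      rw [ht, Description.rateV_mix _ _ _ _ hl0.ne' hl1.ne, heV, mul_zero, add_zero]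
    have hl1' : 0 < 1 - l := sub_pos.2 hl1
    have hlc : 0 ≤ l * c := mul_nonneg hl0.le hc
    have hlJ : 0 ≤ l * J1 := mul_nonneg hl0.le hJ1
    -- equality in the condition on `I(X₁ ; Y | U A X)` becomes strict
    have hlt : (1 - l) * c < J3 := by
      rcases hc.eq_or_lt with h | h
      · rw [← h, mul_zero]; exact hpos
      · nlinarith [mul_pos hl0 h]
    obtain ⟨γ, r', r'', hγ, hr', hr'', hR', hR'', g0, g1, g2, g4⟩ := exists_rate_split (R := R)
      (m₀ := t.rate₀) (m₁ := t.rate₁) (m₂ := t.rate₂)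
      (m₄ := t.rate₄) (ρ := (1 - l) * ν) (P := False) hR0 (by linarith)
      (by
        rcases hR with h | h
        · exact Or.inl h
        rcases hlR with h' | h'
        · exact Or.inl h'
        · exact Or.inr ⟨by linarith, Or.inr (by linarith [h.2.1]), by linarith [h.2.2]⟩)
    obtain ⟨η, hη, hη1, hη2, hη3, hη4⟩ : ∃ η : ℝ, 0 < η ∧ 5 * η ≤ γ ∧
        5 * η ≤ J3 - (1 - l) * c ∧ 2 * η < J3 ∧ (r' = 0 ∨ 2 * η < (q.erased ch).rate₄) := by
      have hlt' : 0 < J3 - (1 - l) * c := by linarith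
      have hlc' : 0 ≤ (1 - l) * c := mul_nonneg hl1'.le hc
      rcases h4' with h | h
      · refine ⟨min γ (J3 - (1 - l) * c) / 5, div_pos (lt_min hγ hlt') (by norm_num), ?_, ?_, ?_,
          Or.inl (hR'' h)⟩ <;>
        linarith [min_le_left γ (J3 - (1 - l) * c), min_le_right γ (J3 - (1 - l) * c)]
      · have e1 := min_le_left γ (min (J3 - (1 - l) * c) (q.erased ch).rate₄)
        have e2 := min_le_right γ (min (J3 - (1 - l) * c) (q.erased ch).rate₄)
        have e3 := min_le_left (J3 - (1 - l) * c) (q.erased ch).rate₄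
        have e4 := min_le_right (J3 - (1 - l) * c) (q.erased ch).rate₄
        refine ⟨min γ (min (J3 - (1 - l) * c) (q.erased ch).rate₄) / 5,
          div_pos (lt_min hγ (lt_min hlt' h)) (by norm_num), by linarith, by linarith,
          by linarith, Or.inr (by linarith)⟩
    have key := eventually_exists_code t hreg
      (fun _ _ x x₁ v y => v.elim (fun v => est x x₁ y v) fun _ => s₀) s₀ hb hd hdb hη hr' hr''
      (rk := (1 - l) * ν + 3 * η) (by have := mul_nonneg hl1'.le hν; linarith) hR0
      (g0.imp id fun h => by linarith) (g1.imp id fun h => by linarith)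
      (g2.imp id fun h => Or.inr (by linarith [h.resolve_left id]))
      (Or.inr (by linarith)) (g4.imp id fun h => by linarith) (Or.inr (by linarith))
      (Or.inr (by linarith)) hη4 hR' (half_pos hz)
    have hdist : t.avg (fun u a x x₁ o v => d o.2.1
        ((fun (_ : U) (_ : A) x x₁ (v : V ⊕ Unit) y => v.elim (fun v => est x x₁ y v) fun _ => s₀)
          u a x x₁ v o.2.2.1)) ≤ expDistortion ch q d est + z / 2 := by
      rw [ht, Description.avg_mix]
      simp only [Sum.elim_inl, Sum.elim_inr]
      rw [hΔ]
      have h1 : (q.erased ch).avg (fun _ _ _ _ o _ => d o.2.1 s₀) ≤ b := by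
        rw [← (q.erased ch).avg_const b]
        exact (q.erased ch).avg_mono fun _ _ _ _ _ _ => hdb _ _
      nlinarith [mul_le_mul_of_nonneg_left h1 hl0.le, mul_nonneg hl0.le hΔ0]
    filter_upwards [key] with n ⟨code, hcode1, hcode2⟩
    exact ⟨code, hcode1.trans (by linarith), hcode2.trans (by linarith)⟩

end Achievability

end BistaticISAC

theorem theorem2 {X X₁ S Sd Y Y₁ Shat U A V : Type*}
    [Fintype X] [Fintype X₁] [Fintype S] [Fintype Sd] [Fintype Y] [Fintype Y₁]
    [Fintype U] [Fintype A] [Fintype V]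
    (ch : Channel X X₁ S Sd Y Y₁)
    (d : Sd → Shat → ℝ) (hd_nonneg : ∀ s s', 0 ≤ d s s') (hd_bdd : ∃ B, ∀ s s', d s s' ≤ B)
    (q : Choice U A X X₁ Y₁ V)
    (est : X → X₁ → Y → V → Shat) (hest : IsOptimalEstimator ch q d est)
    (R D : ℝ) (hR : 0 ≤ R)
    (h₁ : R ≤ condMutualInfo (jointLaw ch q) rA rY₁ (fun ω => (rU ω, rX₁ ω))
      + condMutualInfo (jointLaw ch q) rX (fun ω => (rV ω, rY ω)) (fun ω => (rU ω, rA ω, rX₁ ω)))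
    (h₂ : R ≤ condMutualInfo (jointLaw ch q) rA rY₁ (fun ω => (rU ω, rX₁ ω))
      + condMutualInfo (jointLaw ch q) (fun ω => (rX ω, rX₁ ω)) rY (fun ω => (rU ω, rA ω))
      - condMutualInfo (jointLaw ch q) rV rY₁ (fun ω => (rU ω, rA ω, rX ω, rX₁ ω, rY ω)))
    (h₃ : R ≤ mutualInfo (jointLaw ch q) (fun ω => (rX ω, rX₁ ω)) rY
      - condMutualInfo (jointLaw ch q) rV rY₁ (fun ω => (rU ω, rA ω, rX ω, rX₁ ω, rY ω)))
    (h₄ : condMutualInfo (jointLaw ch q) rX₁ rY (fun ω => (rU ω, rA ω, rX ω))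
      ≥ condMutualInfo (jointLaw ch q) rV rY₁ (fun ω => (rU ω, rA ω, rX ω, rX₁ ω, rY ω)))
    (hD : expDistortion ch q d est ≤ D) :
    (R : EReal) ≤ capacityDistortion ch d D := by
  obtain ⟨u, -⟩ := q.pU.support_nonempty
  obtain ⟨a, -⟩ := (q.pA u).support_nonempty
  obtain ⟨x, -⟩ := (q.pX u a).support_nonempty
  obtain ⟨x₁, -⟩ := (q.pX₁ u).support_nonempty
  obtain ⟨s, -⟩ := ch.state.support_nonempty
  obtain ⟨o, -⟩ := (ch.output x x₁ s.1).support_nonempty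
  obtain ⟨v, -⟩ := (q.pV u a x₁ o.2).support_nonempty
  have : Nonempty X := ⟨x⟩
  have : Nonempty X₁ := ⟨x₁⟩
  have : Nonempty Y₁ := ⟨o.2⟩
  have : Nonempty Shat := ⟨est x x₁ o.1 v⟩
  obtain ⟨b, hb⟩ := hd_bdd
  have hb0 : 0 ≤ b := (hd_nonneg s.2 (est x x₁ o.1 v)).trans (hb _ _)
  have key : ∀ R' : ℝ, 0 ≤ R' → (R' = 0 ∨ R' < R) → (R' : EReal) ≤ capacityDistortion ch d D := by
    intro R' h0 hlt
    refine le_sSup ⟨R', ⟨h0, achievable_of_forall_eventually hd_nonneg fun z hz => ?_⟩, rfl⟩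
    filter_upwards [eventually_exists_code_of_lt est hb0 hd_nonneg hb h0
      (hlt.imp id fun h => ⟨h.trans_le h₁, h.trans_le h₂, h.trans_le h₃⟩) h₄ hz]
      with n ⟨code, hc1, hc2⟩
    exact ⟨code, hc1, hc2.trans (by linarith)⟩
  rcases hR.eq_or_lt with h0 | hpos
  · exact key R hR (Or.inl h0.symm)
  · -- every rate below `R` is achievable
    refine le_of_forall_lt fun c hc => ?_
    obtain ⟨R', hR1, hR2⟩ := EReal.lt_iff_exists_real_btwn.1 (max_lt hc (EReal.coe_pos.2 hpos))
    have h0 : (0 : ℝ) ≤ R' := by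
      exact_mod_cast ((le_max_right c 0).trans_lt hR1).le
    exact ((le_max_left c 0).trans_lt hR1).trans_le (key R' h0 (Or.inr (by exact_mod_cast hR2)))
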